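/- Let $\Omega\subset\mathbb R^2$ be a bounded domain with $C^\infty$ boundary, and let $D$ be a bounded domain with $\overline D\subset\Omega$ whose boundary $\partial D$ is a single smooth simple closed curve, with arclength parameter $s$ and tangential derivative $\partial_s$. Let $$\mathcal H=\{u\in H^1(\Omega;\mathbb R) : u|_{\partial D}\in H^2(\partial D)\}.$$ For positive constants $\mu,\mu_s,\ell$ and $f\in H^{1/2}(\partial\Omega)$, let $u\in\mathcal H$ be the weak solution of $$-\Delta u=0 \text{ in }\Omega\setminus \overline D,\qquad -\mu\Delta u=0\text{ in } D,\qquad \partial_\nu u^+-\mu\,\partial_\nu u^-=\partial_s^2(\mu_s\ell^2\partial_s^2u)-\partial_s(\mu_s\partial_s u)\text{ on }\partial D,\qquad u=f\text{ on }\partial\Omega,$$ where $\nu$ is the outward unit normal and $u^+$, $u^-$ denote the limits on $\partial D$ from $\Omega\setminus\overline D$ and from $D$; that is, $u\in\mathcal H$, $u|_{\partial\Omega}=f$ and $$\int_{\Omega\setminus D}\nabla u\cdot\nabla\varphi\,dx+\int_D\mu\nabla u\cdot\nabla\varphi\,dx+\int_{\partial D}\mu_s\,\partial_su\,\partial_s\varphi\,ds+\int_{\partial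 D}\mu_s\ell^2\,\partial_s^2u\,\partial_s^2\varphi\,ds=0\qquad\text{for all }\varphi\in\mathcal H\cap H^1_0(\Omega).$$ Let $\Lambda=\Lambda_{\mu,\mu_s,\ell}:H^{1/2}(\partial\Omega)\to H^{-1/2}(\partial\Omega)$, $\Lambda f=\partial_\nu u|_{\partial\Omega}$, be the associated Dirichlet-to-Neumann map, with $\partial_\nu u|_{\partial\Omega}$ understood weakly, through Green's identity. Then, for fixed $\Omega$ and $D$, the map $$(0,\infty)^3\ni(\mu,\mu_s,\ell)\longmapsto\Lambda_{\mu,\mu_s,\ell}$$ is injective: if $\Lambda_{\mu^{(1)},\mu_s^{(1)},\ell^{(1)}}=\Lambda_{\mu^{(2)},\mu_s^{(2)},\ell^{(2)}}$, then $\mu^{(1)}=\mu^{(2)}$, $\mu_s^{(1)}=\mu_s^{(2)}$ and $\ell^{(1)}=\ell^{(2)}$. -/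

import Mathlib

namespace AntiplaneShear

open MeasureTheory Filter Topology Set
open scoped ContDiff

/-- The Euclidean plane. -/
abbrev Plane : Type := EuclideanSpace ℝ (Fin 2)

/-- A bounded domain (nonempty, open, connected) with `C^∞` boundary: near each of its boundary
points it is the sublevel set of a smooth function with nonvanishing differential. -/
structure IsSmoothDomain (U : Set Plane) : Prop where
  isOpen : IsOpen U
  isConnected : IsConnected U
  isBounded : Bornology.IsBounded U
  smooth_boundary : ∀ x ∈ frontier U, ∃ V : Set Plane, IsOpen V ∧ x ∈ V ∧
    ∃ ρ : Plane → ℝ, ContDiff ℝ ∞ ρ ∧ fderiv ℝ ρ x ≠ 0 ∧ U ∩ V = {y ∈ V | ρ y < 0}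

/-- `γ` is a smooth arclength parametrization, of period (total length) `L`, of a simple closed
curve with image `Γ`. -/
structure IsArclengthParam (Γ : Set Plane) (L : ℝ) (γ : ℝ → Plane) : Prop where
  length_pos : 0 < L
  smooth : ContDiff ℝ ∞ γ
  periodic : Function.Periodic γ L
  unit_speed : ∀ s, ‖deriv γ s‖ = 1
  injOn : InjOn γ (Ico 0 L)
  range_eq : range γ = Γ

/-! ### The spaces `H¹(Ω)`, `H¹₀(Ω)`, `H^{1/2}(∂Ω)`, `H^{-1/2}(∂Ω)` -/

/-- Smooth functions with compact support in `Ω`. -/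
structure IsTestFunction (Ω : Set Plane) (φ : Plane → ℝ) : Prop where
  smooth : ContDiff ℝ ∞ φ
  compact : HasCompactSupport φ
  supp : tsupport φ ⊆ Ω

/-- `G` is the weak gradient of `u` in `Ω`. -/
def IsWeakGrad (Ω : Set Plane) (u : Lp ℝ 2 (volume.restrict Ω))
    (G : Lp Plane 2 (volume.restrict Ω)) : Prop :=
  ∀ φ : Plane → ℝ, IsTestFunction Ω φ → ∀ v : Plane,
    ∫ x in Ω, u x * fderiv ℝ φ x v = - ∫ x in Ω, inner ℝ (G x) v * φ x

theorem IsTestFunction.memLp {Ω : Set Plane} {φ : Plane → ℝ} (h : IsTestFunction Ω φ) :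
    MemLp φ 2 (volume.restrict Ω) :=
  (h.smooth.continuous.memLp_of_hasCompactSupport h.compact).restrict Ω

theorem IsTestFunction.memLp_fderiv {Ω : Set Plane} {φ : Plane → ℝ} (h : IsTestFunction Ω φ)
    (v : Plane) : MemLp (fun x => fderiv ℝ φ x v) 2 (volume.restrict Ω) := by
  have hc : Continuous (fun x => fderiv ℝ φ x v) :=
    (h.smooth.continuous_fderiv (by simp)).clm_apply continuous_const
  have hs : HasCompactSupport (fun x => fderiv ℝ φ x v) :=
    (h.compact.fderiv (𝕜 := ℝ)).comp_left (g := fun T : Plane →L[ℝ] ℝ => T v) (by simp)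
  exact (hc.memLp_of_hasCompactSupport hs).restrict Ω

theorem integrable_left {Ω : Set Plane} {φ : Plane → ℝ} (h : IsTestFunction Ω φ)
    (u : Lp ℝ 2 (volume.restrict Ω)) (v : Plane) :
    Integrable (fun x => u x * fderiv ℝ φ x v) (volume.restrict Ω) :=
  (Lp.memLp u).integrable_mul (h.memLp_fderiv v)

theorem integrable_right {Ω : Set Plane} {φ : Plane → ℝ} (h : IsTestFunction Ω φ)
    (G : Lp Plane 2 (volume.restrict Ω)) (v : Plane) :
    Integrable (fun x => inner ℝ (G x) v * φ x) (volume.restrict Ω) :=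
  ((Lp.memLp G).inner_const v).integrable_mul h.memLp

/-- The Sobolev space `H¹(Ω)`: pairs of an `L²` function and its `L²` weak gradient, with the
norm `(‖u‖² + ‖∇u‖²)^{1/2}`. -/
noncomputable def H1 (Ω : Set Plane) : Submodule ℝ
    (WithLp 2 (Lp ℝ 2 (volume.restrict Ω) × Lp Plane 2 (volume.restrict Ω))) where
  carrier := {p | IsWeakGrad Ω p.fst p.snd}
  zero_mem' := by
    intro φ hφ v
    have h1 : ∫ x in Ω, (0 : Lp ℝ 2 (volume.restrict Ω)) x * fderiv ℝ φ x v = 0 := by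
      rw [← integral_zero Plane ℝ (μ := volume.restrict Ω)]
      refine integral_congr_ae ?_
      filter_upwards [Lp.coeFn_zero ℝ 2 (volume.restrict Ω)] with x hx
      rw [hx]
      simp
    have h2 : ∫ x in Ω, inner ℝ ((0 : Lp Plane 2 (volume.restrict Ω)) x) v * φ x = 0 := by
      rw [← integral_zero Plane ℝ (μ := volume.restrict Ω)]
      refine integral_congr_ae ?_
      filter_upwards [Lp.coeFn_zero Plane 2 (volume.restrict Ω)] with x hx
      rw [hx]
      simp
    rw [WithLp.zero_fst, WithLp.zero_snd, h1, h2, neg_zero]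
  add_mem' := by
    intro p q hp hq φ hφ v
    have h1 : ∫ x in Ω, (p.fst + q.fst) x * fderiv ℝ φ x v
        = ∫ x in Ω, p.fst x * fderiv ℝ φ x v + q.fst x * fderiv ℝ φ x v := by
      refine integral_congr_ae ?_
      filter_upwards [Lp.coeFn_add p.fst q.fst] with x hx
      simp only [hx, Pi.add_apply, add_mul]
    have h2 : ∫ x in Ω, inner ℝ ((p.snd + q.snd) x) v * φ x
        = ∫ x in Ω, inner ℝ (p.snd x) v * φ x + inner ℝ (q.snd x) v * φ x := by
      refine integral_congr_ae ?_
      filter_upwards [Lp.coeFn_add p.snd q.snd] with x hx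
      simp only [hx, Pi.add_apply, inner_add_left, add_mul]
    rw [WithLp.add_fst, WithLp.add_snd, h1, h2,
      integral_add (integrable_left hφ _ v) (integrable_left hφ _ v),
      integral_add (integrable_right hφ _ v) (integrable_right hφ _ v), hp φ hφ v, hq φ hφ v]
    ring
  smul_mem' := by
    intro c p hp φ hφ v
    have h1 : ∫ x in Ω, (c • p.fst) x * fderiv ℝ φ x v
        = ∫ x in Ω, c * (p.fst x * fderiv ℝ φ x v) := by
      refine integral_congr_ae ?_
      filter_upwards [Lp.coeFn_smul c p.fst] with x hx
      simp only [hx, Pi.smul_apply, smul_eq_mul, mul_assoc]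
    have h2 : ∫ x in Ω, inner ℝ ((c • p.snd) x) v * φ x
        = ∫ x in Ω, c * (inner ℝ (p.snd x) v * φ x) := by
      refine integral_congr_ae ?_
      filter_upwards [Lp.coeFn_smul c p.snd] with x hx
      simp only [hx, Pi.smul_apply, real_inner_smul_left, mul_assoc]
    rw [WithLp.smul_fst, WithLp.smul_snd, h1, h2, integral_const_mul, integral_const_mul,
      hp φ hφ v]
    ring

/-- The underlying `L²` function of an element of `H¹(Ω)`. -/
noncomputable def fn {Ω : Set Plane} (u : H1 Ω) : Lp ℝ 2 (volume.restrict Ω) := u.1.fst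

/-- The weak gradient of an element of `H¹(Ω)`. -/
noncomputable def grad {Ω : Set Plane} (u : H1 Ω) : Lp Plane 2 (volume.restrict Ω) := u.1.snd

/-- `H¹₀(Ω)`, the closure of the test functions in `H¹(Ω)`. -/
noncomputable def H10 (Ω : Set Plane) : Submodule ℝ (H1 Ω) :=
  (Submodule.span ℝ
    {w : H1 Ω | ∃ φ, IsTestFunction Ω φ ∧ fn w =ᵐ[volume.restrict Ω] φ}).topologicalClosure

/-- The trace space `H^{1/2}(∂Ω) = H¹(Ω) / H¹₀(Ω)`, with the quotient norm. -/
abbrev HalfTrace (Ω : Set Plane) : Type := H1 Ω ⧸ H10 Ω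

/-- The trace `u|_{∂Ω} ∈ H^{1/2}(∂Ω)` of `u ∈ H¹(Ω)`. -/
noncomputable def outerTrace {Ω : Set Plane} (u : H1 Ω) : HalfTrace Ω := (H10 Ω).mkQ u

/-- `H^{-1/2}(∂Ω)`, the topological dual of `H^{1/2}(∂Ω)`. -/
abbrev NegHalf (Ω : Set Plane) : Type := StrongDual ℝ (HalfTrace Ω)

/-! ### The space `H²(∂D)` and traces on `∂D`, in the arclength parameter -/

/-- `L²` of a closed curve of length `L`, in the arclength parameter. -/
abbrev L2Curve (L : ℝ) : Type := Lp ℝ 2 (volume.restrict (Ioc 0 L))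

/-- `g' = ∂_s g` weakly on the closed curve of length `L` (smooth periodic test functions). -/
def IsWeakDerivCurve (L : ℝ) (g g' : L2Curve L) : Prop :=
  ∀ η : ℝ → ℝ, ContDiff ℝ ∞ η → Function.Periodic η L →
    ∫ s in Ioc 0 L, g s * deriv η s = - ∫ s in Ioc 0 L, g' s * η s

/-- `g` is the trace of `u ∈ H¹(Ω)` on the closed curve `γ` inside `Ω`: the limit in `L²` of the
restrictions to `γ` of smooth functions on `Ω` converging to `u` in `H¹(Ω)`. -/
def IsCurveTrace {Ω : Set Plane} (L : ℝ) (γ : ℝ → Plane) (u : H1 Ω) (g : L2Curve L) : Prop :=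
  ∃ (w : ℕ → H1 Ω) (φ : ℕ → Plane → ℝ),
    (∀ n, ContDiffOn ℝ ∞ (φ n) Ω ∧ fn (w n) =ᵐ[volume.restrict Ω] φ n) ∧
    Tendsto w atTop (𝓝 u) ∧
    Tendsto (fun n => eLpNorm (fun s => φ n (γ s) - g s) 2 (volume.restrict (Ioc 0 L)))
      atTop (𝓝 0)

/-- `u` belongs to `ℋ = {u ∈ H¹(Ω) : u|_{∂D} ∈ H²(∂D)}`, with `∂_s u = g₁` and `∂_s² u = g₂`
on `∂D`. -/
def HasH2Trace {Ω : Set Plane} (L : ℝ) (γ : ℝ → Plane) (u : H1 Ω) (g₁ g₂ : L2Curve L) : Prop :=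
  ∃ g : L2Curve L, IsCurveTrace L γ u g ∧ IsWeakDerivCurve L g g₁ ∧ IsWeakDerivCurve L g₁ g₂

/-! ### The boundary value problem and its Dirichlet-to-Neumann map -/

/-- `u ∈ ℋ` is the weak solution of
`-Δu = 0` in `Ω \ D`, `-μ Δu = 0` in `D`,
`∂_ν u⁺ - μ ∂_ν u⁻ = ∂_s²(μ_s ℓ² ∂_s² u) - ∂_s(μ_s ∂_s u)` on `∂D`, `u = f` on `∂Ω`;
the test functions range over `ℋ ∩ H¹₀(Ω)`. -/
def IsWeakSolution {Ω : Set Plane} (D : Set Plane) (L : ℝ) (γ : ℝ → Plane) (μ μs ℓ : ℝ)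
    (f : HalfTrace Ω) (u : H1 Ω) : Prop :=
  outerTrace u = f ∧
  ∃ u₁ u₂ : L2Curve L, HasH2Trace L γ u u₁ u₂ ∧
    ∀ φ ∈ H10 Ω, ∀ φ₁ φ₂ : L2Curve L, HasH2Trace L γ φ φ₁ φ₂ →
      (∫ x in Ω \ D, inner ℝ (grad u x) (grad φ x))
        + (∫ x in D, μ * inner ℝ (grad u x) (grad φ x))
        + (∫ s in Ioc 0 L, μs * (u₁ s * φ₁ s))
        + (∫ s in Ioc 0 L, μs * ℓ ^ 2 * (u₂ s * φ₂ s)) = 0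

/-- `ξ ∈ H^{-1/2}(∂Ω)` is the weak outward normal derivative `∂_ν u|_{∂Ω}` of a function `u`
harmonic in `Ω \ closure D`: Green's identity against all `φ ∈ H¹(Ω)` that vanish in a
neighbourhood of `closure D` (every class in `H^{1/2}(∂Ω)` has such a representative when
`closure D ⊆ Ω` is compact). -/
def IsNormalDeriv {Ω : Set Plane} (D : Set Plane) (u : H1 Ω) (ξ : NegHalf Ω) : Prop :=
  ∀ φ : H1 Ω,
    (∃ V : Set Plane, IsOpen V ∧ closure D ⊆ V ∧
      ∀ᵐ x ∂(volume.restrict Ω), x ∈ V → fn φ x = 0) →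
    ξ (outerTrace φ) = ∫ x in Ω \ D, inner ℝ (grad u x) (grad φ x)

/-- `ξ = ∂_ν u|_{∂Ω}` for a solution `u ∈ ℋ` of the boundary value problem with data `f`. -/
def IsDtNValue {Ω : Set Plane} (D : Set Plane) (L : ℝ) (γ : ℝ → Plane) (μ μs ℓ : ℝ)
    (f : HalfTrace Ω) (ξ : NegHalf Ω) : Prop :=
  ∃ u : H1 Ω, IsWeakSolution D L γ μ μs ℓ f u ∧ IsNormalDeriv D u ξ

open Classical in
/-- The Dirichlet-to-Neumann map `Λ : H^{1/2}(∂Ω) → H^{-1/2}(∂Ω)`, `f ↦ ∂_ν u|_{∂Ω}`. The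
boundary value problem is well-posed for positive parameters, so the value is the unique `ξ` with
`IsDtNValue`; the value `0` is only a default where there is none. -/
noncomputable def dtn (Ω D : Set Plane) (L : ℝ) (γ : ℝ → Plane) (μ μs ℓ : ℝ) :
    HalfTrace Ω → NegHalf Ω :=
  fun f => if h : ∃ ξ, IsDtNValue D L γ μ μs ℓ f ξ then h.choose else 0

end AntiplaneShear

namespace AntiplaneShear

open MeasureTheory Filter Topology Set
open scoped ContDiff

/-! ### Partial derivatives and the Laplacian -/

/-! Suppose two parameter triples have the same map, and let m, b, a be the differences of μ, μ_s
and μ_s ℓ². Then m ∫_D |∇φ|² + b ∫_{∂D} |∂_s φ|² + a ∫_{∂D} |∂_s² φ|² = 0 for every φ harmonic in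
the plane (`integral_identity`). Take for φ the real and imaginary parts of exp(λ(x₀ + i x₁)) and
add the two identities. With I and J the integrals of exp(2λx₀) over D and over ∂D, the three
integrals become 2λ²I, λ²J and a quantity of at least λ⁴J/2 for large λ. The weight concentrates
where x₀ is largest; this happens on the curve, at a point where x₀ is stationary along it, so that
I = o(J). Hence a, b and m vanish in turn (`eq_zero_of_asymptotics`).

The identity comes from a duality argument of Runge type (`energy_difference_eq_zero`). Two
solutions with the same boundary data and the same flux agree outside D by unique continuation, and
then everywhere by coercivity. Subtracting their weak equations tested with φ shows that the
functional F(v) = m ∫_D ∇φ·∇v + b ∫ ∂_sφ ∂_sv + a ∫ ∂_s²φ ∂_s²v annihilates all solutions. Let w ∈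
H¹₀(Ω) solve the first problem with right-hand side F. Testing w against solutions shows that w has
no flux through ∂Ω, so w vanishes outside D and has zero trace on ∂D. Now test the equation of w
with φ. The left side is zero, because φ is harmonic in D and the tangential derivatives can be
moved onto φ. What remains is F(φ) = 0, which is the identity.

Unique continuation (`fn_eq_zero_of_flux_eq_zero`) needs no Cauchy problem on ∂Ω. A function of
H¹₀(Ω) without flux, extended by zero, is weakly harmonic across ∂Ω, in the whole exterior of D. It
is analytic there by Weyl's lemma, it vanishes far away, and the exterior is connected. The trace on
∂D is controlled from the exterior side alone (`trace_inequality`), so it vanishes together with the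
function outside D. -/

theorem inner_single (y : Plane) (i : Fin 2) : inner ℝ y (EuclideanSpace.single i 1) = y i := by
  simp [PiLp.inner_apply]

/-- The partial derivative in the `i`-th coordinate direction. -/
noncomputable def pd (i : Fin 2) (ψ : Plane → ℝ) (x : Plane) : ℝ :=
  fderiv ℝ ψ x (EuclideanSpace.single i 1)

/-- The Laplacian of a function on the plane. -/
noncomputable def lap (ψ : Plane → ℝ) (x : Plane) : ℝ := ∑ i, pd i (pd i ψ) x

theorem contDiff_pd {ψ : Plane → ℝ} (h : ContDiff ℝ ∞ ψ) (i : Fin 2) : ContDiff ℝ ∞ (pd i ψ) :=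
  (h.fderiv_right (m := ∞) (by simp)).clm_apply contDiff_const

theorem tsupport_pd_subset (ψ : Plane → ℝ) (i : Fin 2) : tsupport (pd i ψ) ⊆ tsupport ψ :=
  tsupport_fderiv_apply_subset ℝ _

theorem IsTestFunction.pd {U : Set Plane} {ψ : Plane → ℝ} (h : IsTestFunction U ψ) (i : Fin 2) :
    IsTestFunction U (pd i ψ) where
  smooth := contDiff_pd h.smooth i
  compact := h.compact.of_isClosed_subset (isClosed_tsupport _) (tsupport_pd_subset ψ i)
  supp := (tsupport_pd_subset ψ i).trans h.supp

theorem pd_congr {f g : Plane → ℝ} {x : Plane} (h : f =ᶠ[𝓝 x] g) (i : Fin 2) :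
    pd i f =ᶠ[𝓝 x] pd i g := by
  filter_upwards [h.fderiv (𝕜 := ℝ)] with y hy
  simp only [pd, hy]

theorem lap_congr {f g : Plane → ℝ} {x : Plane} (h : f =ᶠ[𝓝 x] g) : lap f x = lap g x := by
  unfold lap
  exact Finset.sum_congr rfl fun i _ => (pd_congr (pd_congr h i) i).eq_of_nhds

/-- In the variable q = ‖x‖² the radial Laplacian in two dimensions is 4 (q F')'. The choice F' =
cutoff(q)/q therefore turns it into a bump, the derivative of the cutoff. -/
theorem lap_radial {F : ℝ → ℝ} (hF : ContDiff ℝ ∞ F) (x : Plane) :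
    lap (fun y => F (‖y‖ ^ 2)) x
      = 4 * (‖x‖ ^ 2 * deriv (deriv F) (‖x‖ ^ 2) + deriv F (‖x‖ ^ 2)) := by
  have hF1 : Differentiable ℝ F := hF.differentiable (by simp)
  have hF2 : Differentiable ℝ (deriv F) :=
    ((contDiff_infty_iff_deriv.1 hF).2).differentiable (by simp)
  have hn : ∀ y : Plane, HasFDerivAt (fun z : Plane => ‖z‖ ^ 2) (2 • innerSL ℝ y) y := fun y =>
    (hasStrictFDerivAt_norm_sq y).hasFDerivAt
  have h1 : ∀ i, pd i (fun y => F (‖y‖ ^ 2)) = fun y => deriv F (‖y‖ ^ 2) * (2 * y i) := by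
    intro i
    funext y
    have := ((hF1 _).hasDerivAt (x := ‖y‖ ^ 2)).comp_hasFDerivAt y (hn y)
    rw [pd, HasFDerivAt.fderiv (f := fun y => F (‖y‖ ^ 2)) this]
    simp [inner_single]
  have h2 : ∀ i, pd i (fun y => deriv F (‖y‖ ^ 2) * (2 * y i)) x
      = deriv (deriv F) (‖x‖ ^ 2) * (2 * x i) * (2 * x i) + deriv F (‖x‖ ^ 2) * 2 := by
    intro i
    have hd := ((hF2 _).hasDerivAt (x := ‖x‖ ^ 2)).comp_hasFDerivAt x (hn x)
    have hp : HasFDerivAt (fun y : Plane => 2 * y i)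
        ((2 : ℝ) • (EuclideanSpace.proj i : Plane →L[ℝ] ℝ)) x :=
      (EuclideanSpace.proj i : Plane →L[ℝ] ℝ).hasFDerivAt.const_mul 2
    have := hd.mul hp
    rw [pd, HasFDerivAt.fderiv (f := fun y : Plane => deriv F (‖y‖ ^ 2) * (2 * y i)) this]
    simp [inner_single]
    ring
  have h3 : ‖x‖ ^ 2 = x 0 ^ 2 + x 1 ^ 2 := by
    rw [EuclideanSpace.norm_sq_eq]; simp
  unfold lap
  simp only [h1, h2, Fin.sum_univ_two]
  rw [← h3.symm] at *
  generalize deriv (deriv F) (‖x‖ ^ 2) = p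
  generalize deriv F (‖x‖ ^ 2) = q
  rw [h3]
  ring

/-! ### A regularized logarithm -/

/-- A smooth monotone cutoff, `0` on `(-∞, 1/2]` and `1` on `[1, ∞)`. -/
noncomputable def cutoff (t : ℝ) : ℝ := Real.smoothTransition (2 * t - 1)

theorem contDiff_cutoff : ContDiff ℝ ∞ cutoff :=
  Real.smoothTransition.contDiff.comp ((contDiff_const.mul contDiff_id).sub contDiff_const)

theorem cutoff_eq_zero {t : ℝ} (h : t ≤ 1 / 2) : cutoff t = 0 :=
  Real.smoothTransition.zero_of_nonpos (by linarith)

theorem cutoff_eq_one {t : ℝ} (h : 1 ≤ t) : cutoff t = 1 :=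
  Real.smoothTransition.one_of_one_le (by linarith)

theorem monotone_cutoff : Monotone cutoff := fun a b h =>
  Real.smoothTransition.monotone (by linarith)

/-- The quotient is harmless at the origin: the numerator is identically zero for t ≤ 1/2. -/
theorem contDiff_cutoff_div : ContDiff ℝ ∞ (fun t => cutoff t / t) := by
  rw [contDiff_iff_contDiffAt]
  intro t
  by_cases ht : t = 0
  · have : (fun t => cutoff t / t) =ᶠ[𝓝 t] fun _ => 0 := by
      filter_upwards [Iio_mem_nhds (show t < 1 / 2 by rw [ht]; norm_num)] with s hs
      rw [cutoff_eq_zero (le_of_lt hs), zero_div]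
    exact contDiffAt_const.congr_of_eventuallyEq this
  · exact contDiff_cutoff.contDiffAt.div contDiffAt_id ht

/-- A smooth function of `q` that agrees with `log q` for `q ≥ 1`. -/
noncomputable def smoothLog (q : ℝ) : ℝ := ∫ t in (1 : ℝ)..q, cutoff t / t

theorem hasDerivAt_smoothLog (q : ℝ) : HasDerivAt smoothLog (cutoff q / q) q :=
  intervalIntegral.integral_hasDerivAt_right
    (contDiff_cutoff_div.continuous.intervalIntegrable _ _)
    (contDiff_cutoff_div.continuous.stronglyMeasurableAtFilter _ _)
    contDiff_cutoff_div.continuous.continuousAt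

theorem deriv_smoothLog : deriv smoothLog = fun q => cutoff q / q :=
  funext fun q => (hasDerivAt_smoothLog q).deriv

theorem contDiff_smoothLog : ContDiff ℝ ∞ smoothLog := by
  rw [contDiff_infty_iff_deriv]
  exact ⟨fun q => (hasDerivAt_smoothLog q).differentiableAt,
    by rw [deriv_smoothLog]; exact contDiff_cutoff_div⟩

theorem smoothLog_eq_log {q : ℝ} (hq : 1 ≤ q) : smoothLog q = Real.log q := by
  have : smoothLog q = ∫ t in (1 : ℝ)..q, 1 / t := by
    refine intervalIntegral.integral_congr fun t ht => ?_
    rw [uIcc_of_le hq] at ht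
    simp only [cutoff_eq_one ht.1]
  rw [this, integral_one_div_of_pos one_pos (by linarith), div_one]

/-- The left side is the derivative of q · smoothLog'(q), which is the cutoff itself. -/
theorem smoothLog_laplacian (q : ℝ) :
    q * deriv (deriv smoothLog) q + deriv smoothLog q = deriv cutoff q := by
  have h : cutoff = fun q => q * (cutoff q / q) := by
    funext q
    by_cases hq : q = 0
    · rw [hq, zero_mul, cutoff_eq_zero (by norm_num)]
    · field_simp
  have hd : DifferentiableAt ℝ (fun q => cutoff q / q) q :=
    contDiff_cutoff_div.differentiable (by simp) q
  have h2 : deriv cutoff q = 1 * (cutoff q / q) + q * deriv (fun q => cutoff q / q) q := by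
    conv_lhs => rw [h]
    exact ((hasDerivAt_id q).mul hd.hasDerivAt).deriv
  rw [h2, deriv_smoothLog]
  ring

/-- `log ‖x‖²`, smoothed in the ball of radius `ε`. -/
noncomputable def regLog (ε : ℝ) (x : Plane) : ℝ :=
  smoothLog (‖x‖ ^ 2 * (ε ^ 2)⁻¹) + Real.log (ε ^ 2)

/-- The Laplacian of the regularized logarithm, a mollifier at scale `ε`. -/
noncomputable def kern (ε : ℝ) (x : Plane) : ℝ :=
  4 * (ε ^ 2)⁻¹ * deriv cutoff (‖x‖ ^ 2 * (ε ^ 2)⁻¹)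

theorem contDiff_regLog (ε : ℝ) : ContDiff ℝ ∞ (regLog ε) :=
  (contDiff_smoothLog.comp ((contDiff_norm_sq ℝ).mul contDiff_const)).add contDiff_const

theorem contDiff_deriv_cutoff : ContDiff ℝ ∞ (deriv cutoff) :=
  (contDiff_infty_iff_deriv.1 contDiff_cutoff).2

theorem contDiff_kern (ε : ℝ) : ContDiff ℝ ∞ (kern ε) :=
  contDiff_const.mul (contDiff_deriv_cutoff.comp ((contDiff_norm_sq ℝ).mul contDiff_const))

theorem lap_regLog (ε : ℝ) : lap (regLog ε) = kern ε := by
  funext x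
  have hF : ContDiff ℝ ∞ (fun q => smoothLog (q * (ε ^ 2)⁻¹) + Real.log (ε ^ 2)) :=
    (contDiff_smoothLog.comp (contDiff_id.mul contDiff_const)).add contDiff_const
  have hd : deriv (fun q => smoothLog (q * (ε ^ 2)⁻¹) + Real.log (ε ^ 2))
      = fun q => (ε ^ 2)⁻¹ * deriv smoothLog (q * (ε ^ 2)⁻¹) := by
    funext q
    rw [deriv_add_const]
    have := (hasDerivAt_smoothLog (q * (ε ^ 2)⁻¹)).comp q ((hasDerivAt_id q).mul_const (ε ^ 2)⁻¹)
    rw [HasDerivAt.deriv (f := fun q => smoothLog (q * (ε ^ 2)⁻¹)) this, deriv_smoothLog]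
    ring
  have hd2 : deriv (fun q => (ε ^ 2)⁻¹ * deriv smoothLog (q * (ε ^ 2)⁻¹))
      = fun q => (ε ^ 2)⁻¹ * ((ε ^ 2)⁻¹ * deriv (deriv smoothLog) (q * (ε ^ 2)⁻¹)) := by
    funext q
    have hs : DifferentiableAt ℝ (deriv smoothLog) (q * (ε ^ 2)⁻¹) :=
      ((contDiff_infty_iff_deriv.1 contDiff_smoothLog).2).differentiable (by simp) _
    have := (hs.hasDerivAt.comp q ((hasDerivAt_id q).mul_const (ε ^ 2)⁻¹)).const_mul (ε ^ 2)⁻¹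
    rw [HasDerivAt.deriv (f := fun q => (ε ^ 2)⁻¹ * deriv smoothLog (q * (ε ^ 2)⁻¹)) this]
    ring
  have := lap_radial hF x
  rw [hd, hd2] at this
  rw [show regLog ε = fun y => smoothLog (‖y‖ ^ 2 * (ε ^ 2)⁻¹) + Real.log (ε ^ 2) from rfl, this,
    kern, ← smoothLog_laplacian]
  ring

/-- The additive constant in `regLog` undoes the rescaling. All regularizations thus agree away from
the origin, and the difference of any two has compact support. -/
theorem regLog_eq {ε : ℝ} (hε : 0 < ε) {x : Plane} (hx : ε ≤ ‖x‖) :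
    regLog ε x = Real.log (‖x‖ ^ 2) := by
  have h1 : 1 ≤ ‖x‖ ^ 2 * (ε ^ 2)⁻¹ := by
    rw [← div_eq_mul_inv, one_le_div (by positivity)]
    gcongr
  have h0 : 0 < ‖x‖ := hε.trans_le hx
  rw [regLog, smoothLog_eq_log h1, Real.log_mul (by positivity) (by positivity), Real.log_inv]
  ring

/-! ### The kernels as an approximate identity -/

theorem kern_nonneg (ε : ℝ) (x : Plane) : 0 ≤ kern ε x :=
  mul_nonneg (by positivity) monotone_cutoff.deriv_nonneg

theorem kern_eq_zero {ε : ℝ} (hε : 0 < ε) {x : Plane} (hx : ε < ‖x‖) : kern ε x = 0 := by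
  have h1 : 1 < ‖x‖ ^ 2 * (ε ^ 2)⁻¹ := by
    rw [← div_eq_mul_inv, one_lt_div (by positivity)]
    gcongr
  have : cutoff =ᶠ[𝓝 (‖x‖ ^ 2 * (ε ^ 2)⁻¹)] fun _ => 1 := by
    filter_upwards [Ioi_mem_nhds h1] with s hs
    exact cutoff_eq_one (le_of_lt hs)
  rw [kern, this.deriv_eq]
  simp

theorem tsupport_kern {ε : ℝ} (hε : 0 < ε) : tsupport (kern ε) ⊆ Metric.closedBall 0 ε := by
  refine closure_minimal (fun x hx => ?_) Metric.isClosed_closedBall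
  rw [mem_closedBall_zero_iff]
  by_contra! h
  exact hx (kern_eq_zero hε h)

theorem hasCompactSupport_kern {ε : ℝ} (hε : 0 < ε) : HasCompactSupport (kern ε) :=
  (isCompact_closedBall 0 ε).of_isClosed_subset (isClosed_tsupport _) (tsupport_kern hε)

theorem exists_deriv_cutoff_ne : ∃ t ∈ Ioo (0 : ℝ) 1, deriv cutoff t ≠ 0 := by
  obtain ⟨t, ht, h⟩ := exists_deriv_eq_slope cutoff (zero_lt_one)
    contDiff_cutoff.continuous.continuousOn
    (contDiff_cutoff.differentiable (by simp)).differentiableOn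
  refine ⟨t, ht, ?_⟩
  rw [h, cutoff_eq_one le_rfl, cutoff_eq_zero (by norm_num)]
  norm_num

/-- The kernels are rescalings of one another that preserve mass. The value of the mass is never
computed; its positivity suffices to normalize. -/
theorem integral_kern {ε : ℝ} (hε : 0 < ε) : ∫ x, kern ε x = ∫ x, kern 1 x := by
  have h : kern ε = fun x => (ε ^ 2)⁻¹ * kern 1 (ε⁻¹ • x) := by
    funext x
    simp only [kern, norm_smul, norm_inv, Real.norm_of_nonneg hε.le]
    rw [show (ε⁻¹ * ‖x‖) ^ 2 * ((1 : ℝ) ^ 2)⁻¹ = ‖x‖ ^ 2 * (ε ^ 2)⁻¹ by field_simp]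
    ring
  rw [h, integral_const_mul, Measure.integral_comp_inv_smul_of_nonneg volume (kern 1) hε.le]
  simp only [finrank_euclideanSpace, Fintype.card_fin, smul_eq_mul]
  field_simp

theorem integral_kern_pos : 0 < ∫ x, kern 1 x := by
  obtain ⟨t, ht, h⟩ := exists_deriv_cutoff_ne
  refine (contDiff_kern 1).continuous.integral_pos_of_hasCompactSupport_nonneg_nonzero
    (hasCompactSupport_kern one_pos) (kern_nonneg 1) (x := EuclideanSpace.single 0 (Real.sqrt t)) ?_
  simp only [kern, PiLp.norm_single, Real.norm_eq_abs, sq_abs, Real.sq_sqrt ht.1.le]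
  simpa using h

theorem exists_kern_bound : ∃ C : ℝ, ∀ ε > 0, ∀ x, |kern ε x| ≤ C * (ε ^ 2)⁻¹ := by
  obtain ⟨C, hC⟩ := (contDiff_kern 1).continuous.bounded_above_of_compact_support
    (hasCompactSupport_kern one_pos)
  refine ⟨C, fun ε hε x => ?_⟩
  have h : kern ε x = (ε ^ 2)⁻¹ * kern 1 (ε⁻¹ • x) := by
    simp only [kern, norm_smul, norm_inv, Real.norm_of_nonneg hε.le]
    rw [show (ε⁻¹ * ‖x‖) ^ 2 * ((1 : ℝ) ^ 2)⁻¹ = ‖x‖ ^ 2 * (ε ^ 2)⁻¹ by field_simp]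
    ring
  rw [h, abs_mul, abs_of_pos (by positivity : 0 < (ε ^ 2)⁻¹), mul_comm]
  gcongr
  exact hC _

end AntiplaneShear

namespace AntiplaneShear

open MeasureTheory Filter Topology Set
open scoped ContDiff

/-! ### Weyl's lemma -/

/-- The convolution of two real functions on the plane. -/
noncomputable def conv (u g : Plane → ℝ) (x : Plane) : ℝ := ∫ y, u y * g (x - y)

theorem conv_eq (u g : Plane → ℝ) :
    conv u g = convolution u g (ContinuousLinearMap.mul ℝ ℝ) volume := rfl

theorem contDiff_conv {u g : Plane → ℝ} (hu : Integrable u) (hg : ContDiff ℝ ∞ g)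
    (hc : HasCompactSupport g) : ContDiff ℝ ∞ (conv u g) := by
  rw [conv_eq]
  exact hc.contDiff_convolution_right _ hu.locallyIntegrable hg

theorem pd_conv {u g : Plane → ℝ} (hu : Integrable u) (hg : ContDiff ℝ ∞ g)
    (hc : HasCompactSupport g) (i : Fin 2) : pd i (conv u g) = conv u (pd i g) := by
  funext x
  have h := hc.hasFDerivAt_convolution_right (ContinuousLinearMap.mul ℝ ℝ)
    hu.locallyIntegrable (hg.of_le (by simp)) x
  rw [pd, conv_eq, h.fderiv, convolution_precompR_apply (ContinuousLinearMap.mul ℝ ℝ)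
    hu.locallyIntegrable (hc.fderiv ℝ) (hg.continuous_fderiv (by simp))]
  rfl

theorem hasCompactSupport_pd {g : Plane → ℝ} (hc : HasCompactSupport g) (i : Fin 2) :
    HasCompactSupport (pd i g) :=
  hc.of_isClosed_subset (isClosed_tsupport _) (tsupport_pd_subset g i)

theorem integrable_mul_shift {u g : Plane → ℝ} (hu : Integrable u) (hg : Continuous g)
    (hc : HasCompactSupport g) (x : Plane) : Integrable (fun y => u y * g (x - y)) :=
  hc.convolutionExists_right (ContinuousLinearMap.mul ℝ ℝ) hu.locallyIntegrable hg x

theorem lap_conv {u g : Plane → ℝ} (hu : Integrable u) (hg : ContDiff ℝ ∞ g)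
    (hc : HasCompactSupport g) (x : Plane) : lap (conv u g) x = ∫ y, u y * lap g (x - y) := by
  unfold lap
  simp only [pd_conv hu hg hc, pd_conv hu (contDiff_pd hg _) (hasCompactSupport_pd hc _),
    Finset.mul_sum]
  rw [integral_finsetSum]
  · rfl
  · intro i _
    exact integrable_mul_shift hu (contDiff_pd (contDiff_pd hg _) _).continuous
      (hasCompactSupport_pd (hasCompactSupport_pd hc _) _) x

theorem pd_neg (ψ : Plane → ℝ) (i : Fin 2) : pd i (fun y => -ψ y) = fun y => -pd i ψ y := by
  funext y
  simp only [pd, fderiv_fun_neg, neg_apply]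

theorem pd_const_sub (ψ : Plane → ℝ) (x : Plane) (i : Fin 2) :
    pd i (fun y => ψ (x - y)) = fun y => -pd i ψ (x - y) := by
  funext y
  have h := (ContinuousLinearEquiv.neg ℝ (M := Plane)).comp_right_fderiv
    (f := fun z => ψ (x + z)) (x := y)
  have h' : fderiv ℝ (fun z => ψ (x + z)) (-y) = fderiv ℝ ψ (x + -y) := fderiv_comp_add_left x
  simp only [pd, sub_eq_add_neg]
  have h2 := congrArg (fun T => T (EuclideanSpace.single i 1)) h
  simpa [Function.comp_def, h'] using h2

theorem lap_const_sub (ψ : Plane → ℝ) (x y : Plane) :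
    lap (fun y => ψ (x - y)) y = lap ψ (x - y) := by
  simp only [lap, pd_const_sub, pd_neg, neg_neg]

theorem pd_sub {f g : Plane → ℝ} (hf : ContDiff ℝ ∞ f) (hg : ContDiff ℝ ∞ g) (i : Fin 2) :
    pd i (fun y => f y - g y) = fun y => pd i f y - pd i g y := by
  funext y
  simp only [pd]
  rw [fderiv_fun_sub (hf.differentiable (by simp) y) (hg.differentiable (by simp) y)]
  rfl

theorem lap_sub {f g : Plane → ℝ} (hf : ContDiff ℝ ∞ f) (hg : ContDiff ℝ ∞ g) (x : Plane) :
    lap (fun y => f y - g y) x = lap f x - lap g x := by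
  simp only [lap, pd_sub hf hg, pd_sub (contDiff_pd hf _) (contDiff_pd hg _),
    Finset.sum_sub_distrib]

/-- A smooth function supported in a ball around the origin gives, after reflection and
translation, a test function. -/
theorem isTestFunction_const_sub {U : Set Plane} {ψ : Plane → ℝ} {x : Plane} {r : ℝ}
    (hψ : ContDiff ℝ ∞ ψ) (hs : ∀ y, r < ‖y‖ → ψ y = 0) (hU : Metric.closedBall x r ⊆ U) :
    IsTestFunction U (fun y => ψ (x - y)) := by
  have hsub : tsupport (fun y => ψ (x - y)) ⊆ Metric.closedBall x r := by
    refine closure_minimal (fun y hy => ?_) Metric.isClosed_closedBall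
    rw [mem_closedBall_iff_norm']
    by_contra! h
    exact hy (hs _ h)
  exact ⟨hψ.comp (contDiff_const.sub contDiff_id),
    (isCompact_closedBall x r).of_isClosed_subset (isClosed_tsupport _) hsub, hsub.trans hU⟩

/-- `u` is weakly harmonic in `U`. -/
def IsWeaklyHarmonic (U : Set Plane) (u : Plane → ℝ) : Prop :=
  ∀ ψ, IsTestFunction U ψ → ∫ y, u y * lap ψ y = 0

/-- The heart of Weyl's lemma: the two kernels differ by the Laplacian of a difference of
regularized logarithms, which is a test function in U once centred at x. -/
theorem IsWeaklyHarmonic.conv_kern_eq {U : Set Plane} {u : Plane → ℝ} (hw : IsWeaklyHarmonic U u)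
    (hu : Integrable u) {ε δ : ℝ} (hε : 0 < ε) (hδ : 0 < δ) {x : Plane}
    (hx : Metric.closedBall x ε ⊆ U) (hx' : Metric.closedBall x δ ⊆ U) :
    conv u (kern ε) x = conv u (kern δ) x := by
  have hψ : ContDiff ℝ ∞ (fun y => regLog ε y - regLog δ y) :=
    (contDiff_regLog ε).sub (contDiff_regLog δ)
  have ht : IsTestFunction U (fun y => regLog ε (x - y) - regLog δ (x - y)) := by
    refine isTestFunction_const_sub (r := max ε δ) hψ (fun y hy => ?_) ?_
    · rw [regLog_eq hε ((le_max_left _ _).trans hy.le),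
        regLog_eq hδ ((le_max_right _ _).trans hy.le), sub_self]
    · rcases max_cases ε δ with h | h <;> rw [h.1] <;> assumption
  have h0 := hw _ ht
  have h1 : ∀ y, lap (fun y => regLog ε (x - y) - regLog δ (x - y)) y
      = kern ε (x - y) - kern δ (x - y) := by
    intro y
    rw [lap_const_sub (fun y => regLog ε y - regLog δ y), lap_sub (contDiff_regLog ε)
      (contDiff_regLog δ), lap_regLog, lap_regLog]
  simp only [h1, mul_sub] at h0
  rw [integral_sub (integrable_mul_shift hu (contDiff_kern ε).continuous
    (hasCompactSupport_kern hε) x) (integrable_mul_shift hu (contDiff_kern δ).continuous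
    (hasCompactSupport_kern hδ) x)] at h0
  exact sub_eq_zero.1 h0

theorem IsWeaklyHarmonic.lap_conv_kern {U : Set Plane} {u : Plane → ℝ}
    (hw : IsWeaklyHarmonic U u) (hu : Integrable u) {ε : ℝ} (hε : 0 < ε) {x : Plane}
    (hx : Metric.closedBall x ε ⊆ U) : lap (conv u (kern ε)) x = 0 := by
  rw [lap_conv hu (contDiff_kern ε) (hasCompactSupport_kern hε)]
  have := hw _ (isTestFunction_const_sub (contDiff_kern ε) (fun y hy => kern_eq_zero hε hy) hx)
  simpa only [lap_const_sub] using this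

/-- This holds at every Lebesgue point, since the kernel is bounded by a multiple of the inverse
area of the ball that supports it. -/
theorem tendsto_conv_kern {u : Plane → ℝ} (hu : Integrable u) :
    ∀ᵐ x, Tendsto (fun ε => conv u (kern ε) x) (𝓝[>] 0) (𝓝 (u x * ∫ y, kern 1 y)) := by
  obtain ⟨C, hC⟩ := exists_kern_bound
  have hC0 : 0 ≤ C := by simpa using (abs_nonneg _).trans (hC 1 one_pos 0)
  filter_upwards [IsUnifLocDoublingMeasure.ae_tendsto_average_norm_sub volume
    hu.locallyIntegrable 1] with x hx
  have hav : Tendsto (fun ε : ℝ => ⨍ y in Metric.closedBall x ε, ‖u y - u x‖) (𝓝[>] 0) (𝓝 0) :=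
    hx (fun _ => x) id tendsto_id (eventually_mem_nhdsWithin.mono fun ε hε => by
      simpa using (le_of_lt hε : (0:ℝ) ≤ ε))
  set V : ℝ := volume.real (Metric.closedBall (0 : Plane) 1) with hV
  have hlim : Tendsto (fun ε : ℝ => (C * V) * ⨍ y in Metric.closedBall x ε, ‖u y - u x‖)
      (𝓝[>] 0) (𝓝 0) := by simpa using hav.const_mul (C * V)
  rw [tendsto_iff_norm_sub_tendsto_zero]
  refine squeeze_zero' (Eventually.of_forall fun _ => norm_nonneg _) ?_ hlim
  filter_upwards [self_mem_nhdsWithin] with ε (hε : 0 < ε)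
  have hvol : volume.real (Metric.closedBall x ε) = ε ^ 2 * V := by
    rw [hV, Measure.real, Measure.real, Measure.addHaar_closedBall' volume x hε.le,
      ENNReal.toReal_mul, ENNReal.toReal_ofReal (by positivity)]
    simp
  have hVpos : 0 < V := by
    rw [hV]
    exact ENNReal.toReal_pos (Metric.measure_closedBall_pos _ _ one_pos).ne'
      (isCompact_closedBall _ _).measure_lt_top.ne
  have hfi : Integrable (fun y => kern ε (x - y)) :=
    ((contDiff_kern ε).continuous.integrable_of_hasCompactSupport
      (hasCompactSupport_kern hε)).comp_sub_left x
  have hi1 : Integrable (fun y => u y * kern ε (x - y)) :=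
    integrable_mul_shift hu (contDiff_kern ε).continuous (hasCompactSupport_kern hε) x
  have h1 : conv u (kern ε) x - u x * ∫ y, kern 1 y = ∫ y, (u y - u x) * kern ε (x - y) := by
    simp only [sub_mul]
    rw [integral_sub hi1 (hfi.const_mul _), integral_const_mul,
      integral_sub_left_eq_self (kern ε), integral_kern hε]
    rfl
  have h2 : ∫ y, (u y - u x) * kern ε (x - y)
      = ∫ y in Metric.closedBall x ε, (u y - u x) * kern ε (x - y) := by
    refine (setIntegral_eq_integral_of_forall_compl_eq_zero fun y hy => ?_).symm
    rw [mem_closedBall_iff_norm', not_le] at hy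
    rw [kern_eq_zero hε hy, mul_zero]
  have hiu : IntegrableOn (fun y => ‖u y - u x‖) (Metric.closedBall x ε) := by
    refine (Integrable.sub hu.integrableOn ?_).norm
    exact integrableOn_const (isCompact_closedBall _ _).measure_lt_top.ne
  rw [h1, h2]
  calc ‖∫ y in Metric.closedBall x ε, (u y - u x) * kern ε (x - y)‖
      ≤ ∫ y in Metric.closedBall x ε, ‖u y - u x‖ * (C * (ε ^ 2)⁻¹) := by
        refine norm_integral_le_of_norm_le (hiu.mul_const _) (Eventually.of_forall fun y => ?_)
        rw [norm_mul]
        gcongr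
        exact hC ε hε _
    _ = C * V * ⨍ y in Metric.closedBall x ε, ‖u y - u x‖ := by
        rw [integral_mul_const, setAverage_eq, hvol, smul_eq_mul]
        field_simp

/-- **Weyl's lemma** in the plane. -/
theorem IsWeaklyHarmonic.exists_harmonic {U : Set Plane} {u : Plane → ℝ} (hU : IsOpen U)
    (hw : IsWeaklyHarmonic U u) (hu : Integrable u) :
    ∃ h : Plane → ℝ, ContDiffOn ℝ ∞ h U ∧ (∀ x ∈ U, lap h x = 0) ∧ ∀ᵐ x, x ∈ U → u x = h x := by
  set c : ℝ := ∫ y, kern 1 y with hc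
  have hcpos : 0 < c := integral_kern_pos
  -- The factor 2 leaves room for the same radius `r x` to be admissible at all points of the ball
  -- of radius `r x` about x.
  have hr : ∀ x : Plane, ∃ r : ℝ, 0 < r ∧ (x ∈ U → Metric.closedBall x (2 * r) ⊆ U) := by
    intro x
    by_cases hx : x ∈ U
    · obtain ⟨r, hr, h⟩ := Metric.nhds_basis_closedBall.mem_iff.1 (hU.mem_nhds hx)
      exact ⟨r / 2, by positivity, fun _ => by rwa [mul_div_cancel₀ _ (two_ne_zero)]⟩
    · exact ⟨1, one_pos, fun h => absurd h hx⟩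
  choose r hr0 hr using hr
  have hloc : ∀ x ∈ U, ∀ y ∈ Metric.ball x (r x), Metric.closedBall y (r x) ⊆ U := by
    intro x hx y hy
    refine (Metric.closedBall_subset_closedBall' ?_).trans (hr x hx)
    linarith [Metric.mem_ball.1 hy]
  let h : Plane → ℝ := fun x => c⁻¹ * conv u (fun y => kern (r x) y) x
  have heq : ∀ x ∈ U, ∀ y ∈ Metric.ball x (r x), ∀ ε, 0 < ε → Metric.closedBall y ε ⊆ U →
      conv u (kern ε) y = conv u (kern (r x)) y := fun x hx y hy ε hε hεU =>
    hw.conv_kern_eq hu hε (hr0 x) hεU (hloc x hx y hy)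
  -- The radius in `h` varies with the point without any regularity, but near x the value is that of
  -- a convolution with one fixed kernel, which is smooth.
  have hev : ∀ x ∈ U, h =ᶠ[𝓝 x] fun y => c⁻¹ * conv u (kern (r x)) y := by
    intro x hx
    filter_upwards [Metric.ball_mem_nhds x (hr0 x)] with y hy
    have hyU : y ∈ U := hloc x hx y hy (Metric.mem_closedBall_self (hr0 x).le)
    have := heq x hx y hy (r y) (hr0 y)
      ((Metric.closedBall_subset_closedBall (by linarith [hr0 y])).trans (hr y hyU))
    simp only [h, ← this]
  have hsm : ∀ x, ContDiff ℝ ∞ (conv u (kern (r x))) := fun x =>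
    contDiff_conv hu (contDiff_kern _) (hasCompactSupport_kern (hr0 x))
  refine ⟨h, fun x hx => ?_, fun x hx => ?_, ?_⟩
  · exact ((contDiff_const.mul (hsm x)).contDiffAt.congr_of_eventuallyEq
      (hev x hx)).contDiffWithinAt
  · rw [lap_congr (hev x hx)]
    have hl := hw.lap_conv_kern hu (hr0 x) (hloc x hx x (Metric.mem_ball_self (hr0 x)))
    have hpd : ∀ (i : Fin 2) (f : Plane → ℝ), ContDiff ℝ ∞ f →
        pd i (fun y => c⁻¹ * f y) = fun y => c⁻¹ * pd i f y := by
      intro i f hf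
      funext y
      simp only [pd]
      rw [fderiv_const_mul (hf.differentiable (by simp) y)]
      rfl
    simp only [lap] at hl ⊢
    simp only [hpd _ _ (hsm x), hpd _ _ (contDiff_pd (hsm x) _), ← Finset.mul_sum, hl, mul_zero]
  · filter_upwards [tendsto_conv_kern hu] with x hx hxU
    -- The convolution does not depend on small ε, so its almost everywhere limit, u times the mass
    -- c, is already attained.
    have hconst : (fun ε => conv u (kern ε) x) =ᶠ[𝓝[>] 0] fun _ => conv u (kern (r x)) x := by
      filter_upwards [Ioo_mem_nhdsGT (hr0 x)] with ε hε
      exact heq x hxU x (Metric.mem_ball_self (hr0 x)) ε hε.1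
        ((Metric.closedBall_subset_closedBall (by linarith [hε.2, hr0 x])).trans (hr x hxU))
    have := tendsto_nhds_unique (hx.congr' hconst) tendsto_const_nhds
    simp only [h, ← this, ← hc]
    field_simp

/-! ### Analyticity of harmonic functions -/

theorem laplacian_complex_comp {h : Plane → ℝ} {z : ℂ}
    (hh : ContDiffAt ℝ 2 h (Complex.orthonormalBasisOneI.repr z)) :
    Laplacian.laplacian (fun w : ℂ => h (Complex.orthonormalBasisOneI.repr w)) z
      = lap h (Complex.orthonormalBasisOneI.repr z) := by
  set J := Complex.orthonormalBasisOneI.repr with hJ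
  have hd : DifferentiableAt ℝ (fderiv ℝ h) (J z) :=
    (hh.fderiv_right (m := 1) (by norm_num)).differentiableAt (by norm_num)
  have h1 : ∀ i, pd i (pd i h) (J z) = iteratedFDeriv ℝ 2 h (J z)
      ![EuclideanSpace.single i 1, EuclideanSpace.single i 1] := by
    intro i
    rw [iteratedFDeriv_two_apply]
    simp only [pd]
    have := (hd.hasFDerivAt.clm_apply
      (hasFDerivAt_const (EuclideanSpace.single i (1 : ℝ)) (J z))).fderiv
    rw [show fderiv ℝ (pd i h) (J z) = _ from this]
    simp
  have h2 : ∀ m : Fin 2 → ℂ, iteratedFDeriv ℝ 2 (fun w : ℂ => h (J w)) z m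
      = iteratedFDeriv ℝ 2 h (J z) (fun k => J (m k)) := by
    intro m
    have := J.toContinuousLinearEquiv.iteratedFDerivWithin_comp_right (s := univ) h
      uniqueDiffOn_univ (x := z) (mem_univ _) 2
    simp only [preimage_univ, iteratedFDerivWithin_univ] at this
    have h3 := congrArg (fun T => T m) this
    exact h3
  rw [InnerProductSpace.laplacian_eq_iteratedFDeriv_orthonormalBasis _
    Complex.orthonormalBasisOneI]
  simp only [h2, lap, h1]
  refine Finset.sum_congr rfl fun i _ => ?_
  congr 1
  funext k
  have : J (Complex.orthonormalBasisOneI i) = EuclideanSpace.single i 1 :=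
    Complex.orthonormalBasisOneI.repr_self i
  fin_cases k <;> exact this

/-- The plane is identified isometrically with ℂ, where a real harmonic function is analytic. -/
theorem analyticOnNhd_of_lap_eq_zero {U : Set Plane} (hU : IsOpen U) {h : Plane → ℝ}
    (hs : ContDiffOn ℝ ∞ h U) (hl : ∀ x ∈ U, lap h x = 0) : AnalyticOnNhd ℝ h U := by
  intro x hx
  set J := Complex.orthonormalBasisOneI.repr with hJ
  have hU' : J ⁻¹' U ∈ 𝓝 (J.symm x) :=
    (hU.preimage J.continuous).mem_nhds (by simpa using hx)
  have hcd : ∀ w ∈ J ⁻¹' U, ContDiffAt ℝ 2 h (J w) := fun w hw =>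
    ((hs _ hw).contDiffAt (hU.mem_nhds hw)).of_le (by norm_cast)
  have hharm : InnerProductSpace.HarmonicAt (fun w : ℂ => h (J w)) (J.symm x) := by
    refine ⟨?_, ?_⟩
    · exact (hcd _ (mem_of_mem_nhds hU')).comp _ J.contDiff.contDiffAt
    · filter_upwards [hU'] with w hw
      rw [laplacian_complex_comp (hcd w hw), hl _ hw]
      rfl
  have h1 := HarmonicAt.analyticAt hharm
  have h2 : AnalyticAt ℝ (fun y => (fun w : ℂ => h (J w)) (J.symm y)) x :=
    AnalyticAt.fun_comp (f := fun y => J.symm y) h1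
      (J.symm.toContinuousLinearEquiv.toContinuousLinearMap.analyticAt x)
  simpa using h2

end AntiplaneShear

namespace AntiplaneShear

open MeasureTheory Filter Topology Set
open scoped ContDiff

/-! ### Boundary charts and connectedness of the exterior -/

/-- Near a boundary point `x`, the domain is the sublevel set of a smooth function which grows
at rate at least `1/2` in the direction `n`, a normal vector at `x`. -/
theorem IsSmoothDomain.exists_chart {U : Set Plane} (hU : IsSmoothDomain U) {x : Plane}
    (hx : x ∈ frontier U) {N : Set Plane} (hN : N ∈ 𝓝 x) :
    ∃ (ρ : Plane → ℝ) (n : Plane) (r : ℝ), 0 < r ∧ Metric.ball x r ⊆ N ∧ ContDiff ℝ ∞ ρ ∧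
      fderiv ℝ ρ x n = 1 ∧ (∀ v, fderiv ℝ ρ x v = 0 → inner ℝ v n = 0) ∧
      (∀ y ∈ Metric.ball x r, y ∈ U ↔ ρ y < 0) ∧
      (∀ y ∈ Metric.ball x r, y ∈ (closure U)ᶜ ↔ 0 < ρ y) ∧
      (∀ y t, 0 ≤ t → y ∈ Metric.ball x r → y + t • n ∈ Metric.ball x r →
        ρ y + t / 2 ≤ ρ (y + t • n)) := by
  obtain ⟨V, hV, hxV, ρ, hρ, hdρ, hUV⟩ := hU.smooth_boundary x hx
  set g : Plane := (InnerProductSpace.toDual ℝ Plane).symm (fderiv ℝ ρ x) with hg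
  have hgi : ∀ v, inner ℝ g v = fderiv ℝ ρ x v := fun v => by
    rw [hg, InnerProductSpace.toDual_symm_apply]
  have hg0 : g ≠ 0 := by
    rw [hg]; simpa using hdρ
  have hgn : ‖g‖ ^ 2 ≠ 0 := pow_ne_zero 2 (norm_ne_zero_iff.2 hg0)
  -- The gradient is rescaled so that ρ has slope exactly 1 along n at x; by continuity the slope
  -- stays above 1/2 nearby.
  set n : Plane := (‖g‖ ^ 2)⁻¹ • g with hn
  have hn1 : fderiv ℝ ρ x n = 1 := by
    rw [← hgi, hn, inner_smul_right, real_inner_self_eq_norm_sq, inv_mul_cancel₀ hgn]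
  have hcont : ContinuousAt (fun y => fderiv ℝ ρ y n) x :=
    ((hρ.continuous_fderiv (by simp)).clm_apply continuous_const).continuousAt
  have hev : ∀ᶠ y in 𝓝 x, 1 / 2 < fderiv ℝ ρ y n :=
    hcont.eventually (lt_mem_nhds (by simp only [hn1]; norm_num))
  obtain ⟨r, hr, hball⟩ := Metric.mem_nhds_iff.1
    (inter_mem hN (inter_mem (hV.mem_nhds hxV) hev))
  have hmono : ∀ y t, 0 ≤ t → y ∈ Metric.ball x r → y + t • n ∈ Metric.ball x r →
      ρ y + t / 2 ≤ ρ (y + t • n) := by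
    intro y t ht hy hyt
    have hseg : ∀ τ ∈ Icc 0 t, y + τ • n ∈ Metric.ball x r := by
      intro τ hτ
      rcases ht.eq_or_lt with h0 | h0
      · have : τ = 0 := le_antisymm (by rw [h0]; exact hτ.2) hτ.1
        simpa [this] using hy
      · have := (convex_ball x r) hy hyt (a := 1 - τ / t) (b := τ / t)
          (by rw [sub_nonneg, div_le_one h0]; exact hτ.2) (div_nonneg hτ.1 ht) (by ring)
        convert this using 1
        rw [smul_add, smul_smul (τ / t) t n, div_mul_cancel₀ _ h0.ne', ← add_assoc, ← add_smul]
        simp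
    have hder : ∀ τ, HasDerivAt (fun τ : ℝ => ρ (y + τ • n) - τ / 2)
        (fderiv ℝ ρ (y + τ • n) n - 1 / 2) τ := by
      intro τ
      have h1 : HasDerivAt (fun τ : ℝ => y + τ • n) n τ := by
        simpa using ((hasDerivAt_id τ).smul_const n).const_add y
      have h2 := ((hρ.differentiable (by simp)) (y + τ • n)).hasFDerivAt.comp_hasDerivAt τ h1
      exact h2.sub ((hasDerivAt_id τ).div_const 2)
    have hm : MonotoneOn (fun τ : ℝ => ρ (y + τ • n) - τ / 2) (Icc 0 t) := by
      refine monotoneOn_of_deriv_nonneg (convex_Icc 0 t)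
        (fun τ _ => (hder τ).continuousAt.continuousWithinAt)
        (fun τ _ => (hder τ).differentiableAt.differentiableWithinAt) fun τ hτ => ?_
      rw [(hder τ).deriv]
      have := (hball (hseg τ (interior_subset hτ))).2.2
      simp only [mem_ofPred_eq] at this
      linarith
    have := hm (left_mem_Icc.2 ht) (right_mem_Icc.2 ht) ht
    simp only [zero_smul, add_zero, zero_div, sub_zero] at this
    linarith
  have hiff : ∀ y ∈ Metric.ball x r, y ∈ U ↔ ρ y < 0 := by
    intro y hy
    have hyV : y ∈ V := (hball hy).2.1
    have := Set.ext_iff.1 hUV y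
    simp only [mem_inter_iff, mem_ofPred_eq] at this
    tauto
  refine ⟨ρ, n, r, hr, fun y hy => (hball hy).1, hρ, hn1, fun v hv => ?_, hiff, ?_, hmono⟩
  · rw [hn, inner_smul_right, real_inner_comm, hgi, hv, mul_zero]
  · intro y hy
    constructor
    · intro hyE
      by_contra! hle
      apply hyE
      -- If ρ y ≤ 0, a small step backwards along n makes ρ negative, so y is a limit of points of
      -- U.
      have hct : Tendsto (fun t : ℝ => y + (-t) • n) (𝓝[>] 0) (𝓝 y) := by
        have : Continuous (fun t : ℝ => y + (-t) • n) := by fun_prop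
        have h := this.tendsto 0
        simp only [neg_zero, zero_smul, add_zero] at h
        exact h.mono_left nhdsWithin_le_nhds
      refine mem_closure_of_tendsto hct ?_
      filter_upwards [self_mem_nhdsWithin, hct.eventually (Metric.isOpen_ball.mem_nhds hy)]
        with t (ht : 0 < t) htb
      have := hmono (y + (-t) • n) t ht.le htb (by simpa using hy)
      simp only [neg_smul, neg_add_cancel_right] at this
      rw [hiff _ htb, neg_smul]
      linarith
    · intro hpos hcl
      have : {z | 0 < ρ z} ∩ Metric.ball x r ∈ 𝓝 y :=
        inter_mem ((isOpen_lt continuous_const hρ.continuous).mem_nhds hpos)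
          (Metric.isOpen_ball.mem_nhds hy)
      obtain ⟨z, hz, hzU⟩ := mem_closure_iff_nhds.1 hcl _ this
      have := (hiff z hz.2).1 hzU
      have h2 : 0 < ρ z := hz.1
      linarith

/-- Sliding along n increases ρ, so every exterior point close to x is carried inside the exterior
into one fixed small ball. Hence only one component of the exterior reaches x. -/
theorem IsSmoothDomain.exterior_connected_at {U : Set Plane} (hU : IsSmoothDomain U) {x : Plane}
    (hx : x ∈ frontier U) : x ∈ closure (closure U)ᶜ ∧ ∃ p, ∀ᶠ y in 𝓝 x, y ∈ (closure U)ᶜ →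
      connectedComponentIn (closure U)ᶜ y = connectedComponentIn (closure U)ᶜ p := by
  obtain ⟨ρ, n, r, hr, -, hρ, hn, -, hiff, hE, hmono⟩ := hU.exists_chart hx univ_mem
  have hxr : x ∈ Metric.ball x r := Metric.mem_ball_self hr
  have hx0 : 0 ≤ ρ x := by
    by_contra! h
    have : x ∈ U := (hiff x hxr).2 h
    rw [frontier, hU.isOpen.interior_eq] at hx
    exact hx.2 this
  have hct : Tendsto (fun t : ℝ => x + t • n) (𝓝[>] 0) (𝓝 x) := by
    have : Continuous (fun t : ℝ => x + t • n) := by fun_prop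
    have h := this.tendsto 0
    simp only [zero_smul, add_zero] at h
    exact h.mono_left nhdsWithin_le_nhds
  have hEt : ∀ᶠ t : ℝ in 𝓝[>] 0, 0 < t ∧ x + t • n ∈ Metric.ball x (r / 2) ∧ 0 < ρ (x + t • n) := by
    filter_upwards [self_mem_nhdsWithin,
      hct.eventually (Metric.ball_mem_nhds x (half_pos hr))] with t (ht : 0 < t) htb
    have := hmono x t ht.le hxr (Metric.ball_subset_ball (by linarith) htb)
    exact ⟨ht, htb, by linarith⟩
  refine ⟨mem_closure_of_tendsto hct ?_, ?_⟩
  · filter_upwards [hEt] with t ht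
    exact (hE _ (Metric.ball_subset_ball (by linarith) ht.2.1)).2 ht.2.2
  · obtain ⟨t, ht, htb, htρ⟩ := hEt.exists
    obtain ⟨δ, hδ, hball⟩ := Metric.mem_nhds_iff.1
      (inter_mem ((isOpen_lt continuous_const hρ.continuous).mem_nhds htρ)
        (Metric.isOpen_ball.mem_nhds htb))
    refine ⟨x + t • n, ?_⟩
    filter_upwards [Metric.ball_mem_nhds x hδ, Metric.ball_mem_nhds x hr] with y hy hyr hyE
    have hyt : y + t • n ∈ Metric.ball (x + t • n) δ := by
      simpa [Metric.mem_ball, dist_add_right] using hy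
    have hytr : y + t • n ∈ Metric.ball x r :=
      Metric.ball_subset_ball (by linarith) (hball hyt).2
    have hseg : segment ℝ y (y + t • n) ⊆ (closure U)ᶜ := by
      intro z hz
      have hzr : z ∈ Metric.ball x r := (convex_ball x r).segment_subset hyr hytr hz
      rw [segment_eq_image'] at hz
      obtain ⟨θ, hθ, rfl⟩ := hz
      have hz' : y + θ • (y + t • n - y) = y + (θ * t) • n := by
        rw [add_sub_cancel_left, smul_smul]
      simp only [hz'] at hzr ⊢
      have := hmono y (θ * t) (mul_nonneg hθ.1 ht.le) hyr hzr
      have h0 := (hE y hyr).1 hyE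
      have h1 : 0 ≤ θ * t := mul_nonneg hθ.1 ht.le
      exact (hE _ hzr).2 (by linarith)
    have hballE : Metric.ball (x + t • n) δ ⊆ (closure U)ᶜ := fun z hz =>
      (hE z (Metric.ball_subset_ball (by linarith) (hball hz).2)).2 (hball hz).1
    have hpre : IsPreconnected (segment ℝ y (y + t • n) ∪ Metric.ball (x + t • n) δ) :=
      (convex_segment y (y + t • n)).isPreconnected.union (y + t • n)
        (right_mem_segment ℝ _ _) hyt (convex_ball _ _).isPreconnected
    have hsub := hpre.subset_connectedComponentIn (F := (closure U)ᶜ)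
      (Or.inl (left_mem_segment ℝ y (y + t • n))) (union_subset hseg hballE)
    exact connectedComponentIn_eq (hsub (Or.inr (Metric.mem_ball_self hδ)))

/-- The exterior of a smooth domain bounded by a single closed curve is connected. -/
theorem IsSmoothDomain.isPreconnected_exterior {D : Set Plane} (hD : IsSmoothDomain D) {L : ℝ}
    {γ : ℝ → Plane} (hγ : IsArclengthParam (frontier D) L γ) :
    IsPreconnected (closure D)ᶜ := by
  set E := (closure D)ᶜ with hEdef
  have hEo : IsOpen E := isClosed_closure.isOpen_compl
  have hmem : ∀ s, γ s ∈ frontier D := fun s => hγ.range_eq ▸ mem_range_self s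
  choose p hp using fun s => (hD.exterior_connected_at (hmem s)).2
  have hcl := fun s => (hD.exterior_connected_at (hmem s)).1
  -- Nearby boundary points share nearby exterior points, so the component attached to γ s is
  -- locally constant in s, and constant because the line is connected.
  have hloc : IsLocallyConstant fun s => connectedComponentIn E (p s) := by
    rw [IsLocallyConstant.iff_eventually_eq]
    intro s
    have := (hγ.smooth.continuous.tendsto s).eventually (eventually_eventually_nhds.2 (hp s))
    filter_upwards [this] with s' hs'
    obtain ⟨y, hy⟩ := (mem_closure_iff_frequently.1 (hcl s')).and_eventually
      (hs'.and (hp s')) |>.exists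
    rw [← hy.2.1 hy.1, ← hy.2.2 hy.1]
  have hall : ∀ y ∈ E, connectedComponentIn E y = connectedComponentIn E (p 0) := by
    intro y hy
    set K := connectedComponentIn E y with hK
    have hKo : IsOpen K := hEo.connectedComponentIn
    have hKE : K ⊆ E := connectedComponentIn_subset E y
    have hyK : y ∈ K := mem_connectedComponentIn hy
    -- Every component K of the exterior misses D, so it has a boundary point; that point must lie
    -- on the curve, where K is the component already attached.
    have hne : (frontier K).Nonempty := by
      rw [nonempty_frontier_iff]
      refine ⟨⟨y, hyK⟩, fun h => ?_⟩
      obtain ⟨d, hd⟩ := hD.isConnected.nonempty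
      exact hKE (h ▸ mem_univ d) (subset_closure hd)
    obtain ⟨z, hz⟩ := hne
    have hzE : z ∉ E := by
      intro hzE
      have hzo : connectedComponentIn E z ∈ 𝓝 z :=
        hEo.connectedComponentIn.mem_nhds (mem_connectedComponentIn hzE)
      obtain ⟨w, hw, hwK⟩ := mem_closure_iff_nhds.1 hz.1 _ hzo
      have h1 := connectedComponentIn_eq hw
      have h2 := connectedComponentIn_eq hwK
      have : z ∈ K := by
        rw [hK, h2, ← h1]; exact mem_connectedComponentIn hzE
      exact hz.2 (by rwa [hKo.interior_eq])
    have hzD : z ∈ frontier D := by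
      refine ⟨not_not.1 hzE, fun hzi => ?_⟩
      obtain ⟨w, hw, hwK⟩ := mem_closure_iff_nhds.1 hz.1 _ (isOpen_interior.mem_nhds hzi)
      exact hKE hwK (subset_closure (interior_subset hw))
    obtain ⟨s, rfl⟩ : z ∈ range γ := hγ.range_eq ▸ hzD
    obtain ⟨w, hwK, hw⟩ :=
      ((mem_closure_iff_frequently.1 hz.1).and_eventually (hp s)).exists
    rw [hK, connectedComponentIn_eq hwK, hw (hKE hwK)]
    exact hloc.apply_eq_of_isPreconnected isPreconnected_univ (mem_univ _) (mem_univ _)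
  rcases E.eq_empty_or_nonempty with h | ⟨y, hy⟩
  · rw [h]; exact isPreconnected_empty
  · have : connectedComponentIn E y = E := by
      refine (connectedComponentIn_subset E y).antisymm fun z hz => ?_
      rw [hall y hy, ← hall z hz]
      exact mem_connectedComponentIn hz
    rw [← this]
    exact isPreconnected_connectedComponentIn

/-- The curve is the image of the null line `q 1 = 0` under the differentiable map q ↦ γ (q 0) of
the plane. -/
theorem IsArclengthParam.volume_eq_zero {Γ : Set Plane} {L : ℝ} {γ : ℝ → Plane}
    (hγ : IsArclengthParam Γ L γ) : volume Γ = 0 := by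
  have hdim : volume ((LinearMap.ker (EuclideanSpace.proj (1 : Fin 2) :
      Plane →L[ℝ] ℝ).toLinearMap : Submodule ℝ Plane) : Set Plane) = 0 := by
    refine Measure.addHaar_submodule _ _ fun h => ?_
    have : EuclideanSpace.single (1 : Fin 2) (1 : ℝ) ∈ (⊤ : Submodule ℝ Plane) := trivial
    rw [← h, LinearMap.mem_ker] at this
    simp at this
  have himg := addHaar_image_eq_zero_of_differentiableOn_of_addHaar_eq_zero volume
    (f := fun q : Plane => γ (q 0)) (s := _) (fun q _ => DifferentiableAt.differentiableWithinAt
      (((hγ.smooth.differentiable (by simp)) (q 0)).comp q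
        (EuclideanSpace.proj (0 : Fin 2) : Plane →L[ℝ] ℝ).differentiableAt)) hdim
  rw [← hγ.range_eq]
  refine measure_mono_null ?_ himg
  rintro _ ⟨s, rfl⟩
  exact ⟨EuclideanSpace.single 0 s, by simp, by simp⟩

end AntiplaneShear

namespace AntiplaneShear

open MeasureTheory Filter Topology Set
open scoped ContDiff ENNReal NNReal

/-! ### The trace inequality on the curve, from the exterior side -/

/-- The fundamental theorem of calculus is applied to (1 - t/t₀) f², which equals f(0)² at 0 and
vanishes at t₀. No boundary term at t₀ remains. -/
theorem sq_le_lintegral {f f' : ℝ → ℝ} {t₀ : ℝ} (ht₀ : 0 < t₀)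
    (hf : ∀ t ∈ Icc 0 t₀, HasDerivAt f (f' t) t) (hf' : ContinuousOn f' (Icc 0 t₀)) :
    ENNReal.ofReal (f 0 ^ 2) ≤ ENNReal.ofReal (1 + t₀⁻¹) *
      ∫⁻ t in Ioo 0 t₀, ENNReal.ofReal (f t ^ 2 + f' t ^ 2) := by
  have hc : ContinuousOn f (Icc 0 t₀) := fun t ht => (hf t ht).continuousAt.continuousWithinAt
  have hle : (0 : ℝ) ≤ t₀ := ht₀.le
  have hk : ∀ t ∈ uIcc 0 t₀, HasDerivAt (fun t => -((1 - t * t₀⁻¹) * f t ^ 2))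
      (t₀⁻¹ * f t ^ 2 - (1 - t * t₀⁻¹) * (2 * f t * f' t)) t := by
    intro t ht
    rw [uIcc_of_le hle] at ht
    have h1 : HasDerivAt (fun t : ℝ => 1 - t * t₀⁻¹) (-t₀⁻¹) t := by
      simpa using ((hasDerivAt_id t).mul_const t₀⁻¹).const_sub 1
    have := (h1.mul ((hf t ht).pow 2)).neg
    convert! this using 1
    simp
    ring
  have hcont : ContinuousOn (fun t => t₀⁻¹ * f t ^ 2 - (1 - t * t₀⁻¹) * (2 * f t * f' t))
      (uIcc 0 t₀) := by
    rw [uIcc_of_le hle]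
    fun_prop
  have hcont2 : ContinuousOn (fun t => (1 + t₀⁻¹) * (f t ^ 2 + f' t ^ 2)) (uIcc 0 t₀) := by
    rw [uIcc_of_le hle]
    fun_prop
  have hftc := intervalIntegral.integral_eq_sub_of_hasDerivAt hk hcont.intervalIntegrable
  have hval : f 0 ^ 2 = ∫ t in (0 : ℝ)..t₀,
      (t₀⁻¹ * f t ^ 2 - (1 - t * t₀⁻¹) * (2 * f t * f' t)) := by
    rw [hftc, mul_inv_cancel₀ ht₀.ne']
    simp
  have hmono : f 0 ^ 2 ≤ ∫ t in (0 : ℝ)..t₀, (1 + t₀⁻¹) * (f t ^ 2 + f' t ^ 2) := by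
    rw [hval]
    refine intervalIntegral.integral_mono_on hle hcont.intervalIntegrable
      hcont2.intervalIntegrable fun t ht => ?_
    have ha : 0 ≤ t * t₀⁻¹ := mul_nonneg ht.1 (inv_nonneg.2 hle)
    have hb : t * t₀⁻¹ ≤ 1 := by
      rw [← div_eq_mul_inv, div_le_one ht₀]; exact ht.2
    have hi : 0 < t₀⁻¹ := inv_pos.2 ht₀
    nlinarith [mul_nonneg (sub_nonneg.2 hb) (sq_nonneg (f t + f' t)),
      mul_nonneg ha (add_nonneg (sq_nonneg (f t)) (sq_nonneg (f' t))),
      mul_nonneg hi.le (sq_nonneg (f' t))]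
  have hfi : IntegrableOn (fun t => f t ^ 2 + f' t ^ 2) (Ioo 0 t₀) := by
    have : ContinuousOn (fun t => f t ^ 2 + f' t ^ 2) (Icc 0 t₀) := by fun_prop
    exact (this.integrableOn_compact isCompact_Icc).mono_set Ioo_subset_Icc_self
  rw [intervalIntegral.integral_const_mul, intervalIntegral.integral_of_le hle,
    integral_Ioc_eq_integral_Ioo] at hmono
  rw [← ofReal_integral_eq_lintegral_ofReal hfi
    (Eventually.of_forall fun t => add_nonneg (sq_nonneg _) (sq_nonneg _)),
    ← ENNReal.ofReal_mul (by positivity)]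
  exact ENNReal.ofReal_le_ofReal hmono

/-- The coordinate rectangle `I × J` in the plane. -/
def box (I J : Set ℝ) : Set Plane := {q | q 0 ∈ I ∧ q 1 ∈ J}

theorem lintegral_box {I J : Set ℝ} (hI : MeasurableSet I) (hJ : MeasurableSet J)
    {F : Plane → ℝ≥0∞} (hF : Measurable F) :
    ∫⁻ q in box I J, F q = ∫⁻ s in I, ∫⁻ t in J, F !₂[s, t] := by
  have e1 := (PiLp.volume_preserving_toLp (Fin 2))
  have e2 := (volume_preserving_finTwoArrow ℝ).symm
  have e := e1.comp e2
  have hbox : MeasurableSet (box I J) :=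
    ((EuclideanSpace.proj (0 : Fin 2) : Plane →L[ℝ] ℝ).continuous.measurable hI).inter
      ((EuclideanSpace.proj (1 : Fin 2) : Plane →L[ℝ] ℝ).continuous.measurable hJ)
  rw [← e.setLIntegral_comp_preimage hbox hF]
  have hpre : (WithLp.toLp 2 ∘ ⇑(MeasurableEquiv.finTwoArrow (α := ℝ)).symm) ⁻¹' box I J
      = I ×ˢ J := by
    ext ⟨s, t⟩
    simp [box]
  rw [hpre, Measure.volume_eq_prod, ← Measure.prod_restrict]
  exact lintegral_prod _ (hF.comp e.measurable).aemeasurable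

/-- The density `φ² + |∇φ|²`. -/
noncomputable def dens (φ : Plane → ℝ) (x : Plane) : ℝ≥0∞ :=
  ENNReal.ofReal (φ x ^ 2 + ‖fderiv ℝ φ x‖ ^ 2)

/-- Outside Ω the function φ is arbitrary, so measurability is only available after cutting off. -/
theorem measurable_indicator_dens {Ω : Set Plane} (hΩ : IsOpen Ω) {φ : Plane → ℝ}
    (hφ : ContDiffOn ℝ ∞ φ Ω) : Measurable (Ω.indicator (dens φ)) := by
  have hc : ContinuousOn (dens φ) Ω := by
    refine ENNReal.continuous_ofReal.comp_continuousOn ?_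
    exact (hφ.continuousOn.pow 2).add
      ((hφ.continuousOn_fderiv_of_isOpen hΩ (by simp)).norm.pow 2)
  classical
  have := hc.measurable_piecewise (continuousOn_const (c := (0 : ℝ≥0∞)) (s := Ωᶜ))
    hΩ.measurableSet
  rwa [← piecewise_eq_indicator]

/-- The one-dimensional estimate is integrated over the segments γ s + t n with 0 < t < t₀, which
lie outside D; the change of variables (s, t) ↦ γ s + t n turns the double integral into an area
integral. -/
theorem trace_local {D Ω N : Set Plane} (hD : IsSmoothDomain D) {L : ℝ} {γ : ℝ → Plane}
    (hγ : IsArclengthParam (frontier D) L γ) (hΩ : IsOpen Ω) (hN : IsOpen N)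
    (hDN : frontier D ⊆ N) (hNΩ : N ⊆ Ω) (s₀ : ℝ) :
    ∃ S ∈ 𝓝 s₀, ∃ C : ℝ≥0, ∀ φ : Plane → ℝ, ContDiffOn ℝ ∞ φ Ω →
      ∫⁻ s in S, ENNReal.ofReal (φ (γ s) ^ 2) ≤ C * ∫⁻ x in N \ closure D, dens φ x := by
  have hmem : ∀ s, γ s ∈ frontier D := fun s => hγ.range_eq ▸ mem_range_self s
  obtain ⟨ρ, n, r, hr, hrN, hρ, hn, hnperp, hiff, hE, hmono⟩ :=
    hD.exists_chart (hmem s₀) (hN.mem_nhds (hDN (hmem s₀)))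
  have hγd : ∀ s, HasDerivAt γ (deriv γ s) s := fun s =>
    (hγ.smooth.differentiable (by simp) s).hasDerivAt
  have hγ' : Continuous (deriv γ) := (contDiff_infty_iff_deriv.1 hγ.smooth).2.continuous
  have hnn : n ≠ 0 := by
    rintro rfl
    simp at hn
  have hρ0 : ∀ s, γ s ∈ Metric.ball (γ s₀) r → ρ (γ s) = 0 := by
    intro s hs
    refine le_antisymm ?_ ?_
    · by_contra! h
      exact (hE _ hs).2 h (hmem s).1
    · by_contra! h
      have := (hiff _ hs).2 h
      exact (hmem s).2 (by rwa [hD.isOpen.interior_eq])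
  have hnear : ∀ᶠ s in 𝓝 s₀, γ s ∈ Metric.ball (γ s₀) (r / 2) :=
    (hγ.smooth.continuous.tendsto s₀).eventually (Metric.ball_mem_nhds _ (half_pos hr))
  set τ : Plane := deriv γ s₀ with hτ
  have hτ1 : ‖τ‖ = 1 := hγ.unit_speed s₀
  -- ρ vanishes along the curve, so its differential kills the tangent, and n is normal to the
  -- kernel of that differential.
  have hτn : inner ℝ τ n = 0 := by
    refine hnperp τ ?_
    have h1 := ((hρ.differentiable (by simp)) (γ s₀)).hasFDerivAt.comp_hasDerivAt s₀ (hγd s₀)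
    have h2 : (fun s => ρ (γ s)) =ᶠ[𝓝 s₀] fun _ => 0 := by
      filter_upwards [hnear] with s hs
      exact hρ0 s (Metric.ball_subset_ball (by linarith) hs)
    have h3 := h2.deriv_eq
    rw [deriv_const] at h3
    rw [← h3]
    exact h1.deriv.symm
  let p0 : Plane →L[ℝ] ℝ := EuclideanSpace.proj (0 : Fin 2)
  let p1 : Plane →L[ℝ] ℝ := EuclideanSpace.proj (1 : Fin 2)
  let A : ℝ → (Plane →L[ℝ] Plane) := fun s => p0.smulRight (deriv γ s) + p1.smulRight n
  let Φ : Plane → Plane := fun q => γ (q 0) + q 1 • n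
  have hΦ : ∀ q, HasFDerivAt Φ (A (q 0)) q := by
    intro q
    have h1 : HasFDerivAt (fun q : Plane => γ (q 0)) (p0.smulRight (deriv γ (q 0))) q := by
      have := (hγd (q 0)).hasFDerivAt.comp q p0.hasFDerivAt
      convert! this using 1
    have h2 : HasFDerivAt (fun q : Plane => q 1 • n) (p1.smulRight n) q :=
      (p1.smulRight n).hasFDerivAt
    exact h1.add h2
  have hAc : Continuous fun s => |(A s).det| := by
    refine (ContinuousLinearMap.continuous_det.comp ?_).abs
    refine Continuous.add ?_ continuous_const
    exact (ContinuousLinearMap.smulRightL ℝ Plane Plane p0).continuous.comp hγ'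
  have hAdet : (A s₀).det ≠ 0 := by
    intro h0
    obtain ⟨v, hv, hv0⟩ := (Submodule.ne_bot_iff _).1
      (LinearMap.bot_lt_ker_of_det_eq_zero (f := (A s₀ : Plane →ₗ[ℝ] Plane)) h0).ne'
    have hv' : v 0 • τ + v 1 • n = 0 := hv
    have e0 : v 0 = 0 := by
      have := congrArg (fun z => inner ℝ τ z) hv'
      simpa [inner_add_right, inner_smul_right, hτn, real_inner_self_eq_norm_sq, hτ1] using this
    have e1 : v 1 = 0 := by
      rw [e0, zero_smul, zero_add, smul_eq_zero] at hv'
      exact hv'.resolve_right hnn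
    apply hv0
    ext i
    fin_cases i
    · exact e0
    · exact e1
  -- The Jacobian does not depend on t; on a short interval around s₀ it stays above half its value
  -- at s₀.
  set c : ℝ := |(A s₀).det| / 2 with hcdef
  have hc : 0 < c := half_pos (abs_pos.2 hAdet)
  have hdet : ∀ᶠ s in 𝓝 s₀, c < |(A s).det| :=
    hAc.continuousAt.eventually (lt_mem_nhds (half_lt_self (abs_pos.2 hAdet)))
  have hinner : ∀ᶠ s in 𝓝 s₀, 0 < inner ℝ τ (deriv γ s) := by
    have : Continuous fun s => inner ℝ τ (deriv γ s) := continuous_const.inner hγ'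
    refine this.continuousAt.eventually (lt_mem_nhds ?_)
    simp only [← hτ, real_inner_self_eq_norm_sq, hτ1]
    norm_num
  obtain ⟨δ, hδ, hδall⟩ := Metric.nhds_basis_closedBall.mem_iff.1
    (inter_mem hnear (inter_mem hdet hinner))
  rw [Real.closedBall_eq_Icc] at hδall
  set I : Set ℝ := Icc (s₀ - δ) (s₀ + δ) with hI
  -- Pairing with the tangent τ at s₀ forgets the n-component and is strictly increasing along γ;
  -- this gives the injectivity of Φ.
  have hmonoγ : StrictMonoOn (fun s => inner ℝ τ (γ s)) I := by
    refine strictMonoOn_of_deriv_pos (convex_Icc _ _)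
      (continuous_const.inner hγ.smooth.continuous).continuousOn fun s hs => ?_
    have := (hasDerivAt_const s τ).inner ℝ (hγd s)
    rw [this.deriv]
    simpa using (hδall (interior_subset hs)).2.2
  set t₀ : ℝ := r / (2 * ‖n‖) with ht₀def
  have hnpos : 0 < ‖n‖ := norm_pos_iff.2 hnn
  have ht₀ : 0 < t₀ := by positivity
  have hball : ∀ s ∈ I, ∀ t ∈ Icc 0 t₀, γ s + t • n ∈ Metric.ball (γ s₀) r := by
    intro s hs t ht
    have h1 : ‖γ s - γ s₀‖ < r / 2 := by
      have : γ s ∈ Metric.ball (γ s₀) (r / 2) := (hδall hs).1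
      rwa [mem_ball_iff_norm] at this
    have h2 : ‖t • n‖ ≤ r / 2 := by
      rw [norm_smul, Real.norm_of_nonneg ht.1]
      calc t * ‖n‖ ≤ t₀ * ‖n‖ := by gcongr; exact ht.2
        _ = r / 2 := by rw [ht₀def]; field_simp
    rw [mem_ball_iff_norm, add_sub_right_comm]
    linarith [norm_add_le (γ s - γ s₀) (t • n)]
  have hΦinj : InjOn Φ (box I (Ioo 0 t₀)) := by
    intro q hq q' hq' h
    have h0 : inner ℝ τ (γ (q 0)) = inner ℝ τ (γ (q' 0)) := by
      have := congrArg (fun z => inner ℝ τ z) h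
      simpa [Φ, inner_add_right, inner_smul_right, hτn] using this
    have e0 : q 0 = q' 0 := hmonoγ.injOn hq.1 hq'.1 h0
    have e1 : q 1 = q' 1 := by
      simp only [Φ, e0, add_right_inj] at h
      exact smul_left_injective ℝ hnn h
    ext i
    fin_cases i
    · exact e0
    · exact e1
  have hΦsub : Φ '' box I (Ioo 0 t₀) ⊆ N \ closure D := by
    rintro _ ⟨q, hq, rfl⟩
    have hb := hball (q 0) hq.1 (q 1) (Ioo_subset_Icc_self hq.2)
    have hb0 := hball (q 0) hq.1 0 (left_mem_Icc.2 ht₀.le)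
    rw [zero_smul, add_zero] at hb0
    refine ⟨hrN hb, (hE _ hb).2 ?_⟩
    have := hmono (γ (q 0)) (q 1) hq.2.1.le hb0 hb
    rw [hρ0 _ hb0] at this
    have h2 := hq.2.1
    linarith
  have hboxm : MeasurableSet (box I (Ioo 0 t₀)) :=
    (p0.continuous.measurable measurableSet_Icc).inter (p1.continuous.measurable measurableSet_Ioo)
  set K : ℝ := (1 + t₀⁻¹) * (1 + ‖n‖ ^ 2) with hK
  have hK0 : 0 < K := by positivity
  refine ⟨I, Icc_mem_nhds (by linarith) (by linarith), ⟨K * c⁻¹, by positivity⟩, fun φ hφ => ?_⟩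
  have hpt : ∀ s ∈ I, ENNReal.ofReal (φ (γ s) ^ 2) ≤ ENNReal.ofReal K *
      ∫⁻ t in Ioo 0 t₀, Ω.indicator (dens φ) (Φ !₂[s, t]) := by
    intro s hs
    have hin : ∀ t ∈ Icc 0 t₀, γ s + t • n ∈ Ω := fun t ht => hNΩ (hrN (hball s hs t ht))
    have hd : ∀ t ∈ Icc 0 t₀, HasDerivAt (fun t : ℝ => φ (γ s + t • n))
        (fderiv ℝ φ (γ s + t • n) n) t := by
      intro t ht
      have h1 : HasDerivAt (fun t : ℝ => γ s + t • n) n t := by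
        simpa using ((hasDerivAt_id t).smul_const n).const_add (γ s)
      have h2 : DifferentiableAt ℝ φ (γ s + t • n) :=
        (hφ.contDiffAt (hΩ.mem_nhds (hin t ht))).differentiableAt (by simp)
      exact h2.hasFDerivAt.comp_hasDerivAt t h1
    have hcd : ContinuousOn (fun t : ℝ => fderiv ℝ φ (γ s + t • n) n) (Icc 0 t₀) := by
      have h1 := hφ.continuousOn_fderiv_of_isOpen hΩ (by simp)
      have h2 : ContinuousOn (fun t : ℝ => γ s + t • n) (Icc 0 t₀) := by fun_prop
      exact (h1.comp h2 hin).clm_apply continuousOn_const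
    have := sq_le_lintegral ht₀ hd hcd
    simp only [zero_smul, add_zero] at this
    refine this.trans ?_
    rw [hK, ENNReal.ofReal_mul (by positivity), mul_assoc]
    gcongr
    rw [← lintegral_const_mul' _ _ ENNReal.ofReal_ne_top]
    refine setLIntegral_mono' measurableSet_Ioo fun t ht => ?_
    have hΩt : Φ !₂[s, t] ∈ Ω := hin t (Ioo_subset_Icc_self ht)
    rw [indicator_of_mem hΩt, dens, ← ENNReal.ofReal_mul (by positivity)]
    refine ENNReal.ofReal_le_ofReal ?_
    have hle : |fderiv ℝ φ (γ s + t • n) n| ≤ ‖fderiv ℝ φ (γ s + t • n)‖ * ‖n‖ :=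
      (fderiv ℝ φ (γ s + t • n)).le_opNorm n
    have hsq : fderiv ℝ φ (γ s + t • n) n ^ 2
        ≤ ‖fderiv ℝ φ (γ s + t • n)‖ ^ 2 * ‖n‖ ^ 2 := by
      rw [← sq_abs, ← mul_pow]
      gcongr
    change φ (γ s + t • n) ^ 2 + fderiv ℝ φ (γ s + t • n) n ^ 2
      ≤ (1 + ‖n‖ ^ 2) * (φ (γ s + t • n) ^ 2 + ‖fderiv ℝ φ (γ s + t • n)‖ ^ 2)
    nlinarith [mul_nonneg (sq_nonneg ‖n‖) (sq_nonneg (φ (γ s + t • n))),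
      sq_nonneg ‖fderiv ℝ φ (γ s + t • n)‖]
  have hΦm : Measurable Φ :=
    ((hγ.smooth.continuous.comp p0.continuous).add (p1.continuous.smul continuous_const)).measurable
  have hGm := measurable_indicator_dens hΩ hφ
  calc ∫⁻ s in I, ENNReal.ofReal (φ (γ s) ^ 2)
      ≤ ∫⁻ s in I, ENNReal.ofReal K *
          ∫⁻ t in Ioo 0 t₀, Ω.indicator (dens φ) (Φ !₂[s, t]) :=
        setLIntegral_mono' measurableSet_Icc hpt
    _ = ENNReal.ofReal K * ∫⁻ q in box I (Ioo 0 t₀), Ω.indicator (dens φ) (Φ q) := by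
        rw [lintegral_const_mul' _ _ ENNReal.ofReal_ne_top]
        congr 1
        exact (lintegral_box measurableSet_Icc measurableSet_Ioo (hGm.comp hΦm)).symm
    _ ≤ ENNReal.ofReal K * (ENNReal.ofReal c⁻¹ *
          ∫⁻ q in box I (Ioo 0 t₀), ENNReal.ofReal |(A (q 0)).det| *
            Ω.indicator (dens φ) (Φ q)) := by
        gcongr
        rw [← lintegral_const_mul' _ _ ENNReal.ofReal_ne_top]
        refine setLIntegral_mono' hboxm fun q hq => ?_
        rw [← mul_assoc, ← ENNReal.ofReal_mul (by positivity)]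
        refine le_mul_of_one_le_left zero_le ?_
        rw [ENNReal.one_le_ofReal, inv_mul_eq_div, one_le_div hc]
        exact (le_of_lt (hδall hq.1).2.1)
    _ = ENNReal.ofReal K * (ENNReal.ofReal c⁻¹ *
          ∫⁻ x in Φ '' box I (Ioo 0 t₀), Ω.indicator (dens φ) x) := by
        rw [lintegral_image_eq_lintegral_abs_det_fderiv_mul volume hboxm
          (fun q _ => (hΦ q).hasFDerivWithinAt) hΦinj]
    _ ≤ ENNReal.ofReal K * (ENNReal.ofReal c⁻¹ * ∫⁻ x in N \ closure D, dens φ x) := by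
        gcongr
        exact indicator_le_self _ _ _
    _ = _ := by
        rw [← mul_assoc, ← ENNReal.ofReal_mul hK0.le]
        congr 1
        exact ENNReal.ofReal_eq_coe_nnreal _

/-- The trace inequality, with only the part of a neighbourhood of the curve outside `D`. -/
theorem trace_inequality {D Ω N : Set Plane} (hD : IsSmoothDomain D) {L : ℝ} {γ : ℝ → Plane}
    (hγ : IsArclengthParam (frontier D) L γ) (hΩ : IsOpen Ω) (hN : IsOpen N)
    (hDN : frontier D ⊆ N) (hNΩ : N ⊆ Ω) :
    ∃ C : ℝ≥0, ∀ φ : Plane → ℝ, ContDiffOn ℝ ∞ φ Ω →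
      ∫⁻ s in Ioc 0 L, ENNReal.ofReal (φ (γ s) ^ 2) ≤ C * ∫⁻ x in N \ closure D, dens φ x := by
  -- The local estimates are patched over one period by compactness; the constants add up under
  -- unions.
  have key := (isCompact_Icc (a := (0 : ℝ)) (b := L)).induction_on
    (p := fun S => ∃ C : ℝ≥0, ∀ φ : Plane → ℝ, ContDiffOn ℝ ∞ φ Ω →
      ∫⁻ s in S, ENNReal.ofReal (φ (γ s) ^ 2) ≤ C * ∫⁻ x in N \ closure D, dens φ x)
    ⟨0, fun φ _ => by simp⟩
    (fun S T hST ⟨C, hC⟩ => ⟨C, fun φ hφ => (lintegral_mono_set hST).trans (hC φ hφ)⟩)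
    (fun S T ⟨C, hC⟩ ⟨C', hC'⟩ => ⟨C + C', fun φ hφ => by
      rw [ENNReal.coe_add, add_mul]
      exact (lintegral_union_le _ _ _).trans (add_le_add (hC φ hφ) (hC' φ hφ))⟩)
    (fun s _ => by
      obtain ⟨S, hS, C, hC⟩ := trace_local hD hγ hΩ hN hDN hNΩ s
      exact ⟨S, mem_nhdsWithin_of_mem_nhds hS, C, hC⟩)
  obtain ⟨C, hC⟩ := key
  exact ⟨C, fun φ hφ => (lintegral_mono_set Ioc_subset_Icc_self).trans (hC φ hφ)⟩

end AntiplaneShear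

namespace AntiplaneShear

open MeasureTheory Filter Topology Set
open scoped ContDiff ENNReal NNReal

/-! ### Basic theory of `H¹(Ω)` -/

theorem integrable_norm_sq {α : Type*} [MeasurableSpace α] {ν : Measure α} {F : Type*}
    [NormedAddCommGroup F] (u : Lp F 2 ν) : Integrable (fun x => ‖u x‖ ^ 2) ν :=
  (memLp_two_iff_integrable_sq_norm (Lp.aestronglyMeasurable u)).1 (Lp.memLp u)

theorem real_inner_eq_integral_mul {α : Type*} [MeasurableSpace α] {ν : Measure α}
    (u v : Lp ℝ 2 ν) : inner ℝ u v = ∫ x, u x * v x ∂ν := by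
  rw [L2.inner_def]
  refine integral_congr_ae (Eventually.of_forall fun x => ?_)
  simp [mul_comm]

section Lp

variable {α : Type*} [MeasurableSpace α] {ν : Measure α} {F : Type*} [NormedAddCommGroup F]
  [InnerProductSpace ℝ F]

theorem inner_toLp_left {f : α → F} (hf : MemLp f 2 ν) (u : Lp F 2 ν) :
    inner ℝ (hf.toLp f) u = ∫ x, inner ℝ (f x) (u x) ∂ν := by
  rw [L2.inner_def]
  refine integral_congr_ae ?_
  filter_upwards [hf.coeFn_toLp] with x hx
  rw [hx]

theorem norm_sq_eq_integral (u : Lp F 2 ν) : ‖u‖ ^ 2 = ∫ x, ‖u x‖ ^ 2 ∂ν := by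
  rw [← real_inner_self_eq_norm_sq, L2.inner_def]
  simp only [real_inner_self_eq_norm_sq]

end Lp

variable {Ω : Set Plane}

theorem inner_gradient (φ : Plane → ℝ) (x v : Plane) :
    inner ℝ (gradient φ x) v = fderiv ℝ φ x v := by
  rw [gradient, InnerProductSpace.toDual_symm_apply]

theorem norm_gradient (φ : Plane → ℝ) (x : Plane) : ‖gradient φ x‖ = ‖fderiv ℝ φ x‖ := by
  rw [gradient, LinearIsometryEquiv.norm_map]

theorem gradient_apply (φ : Plane → ℝ) (x : Plane) (i : Fin 2) : gradient φ x i = pd i φ x := by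
  rw [← inner_single, inner_gradient, pd]

theorem continuous_gradient {φ : Plane → ℝ} (hφ : ContDiff ℝ ∞ φ) : Continuous (gradient φ) :=
  (InnerProductSpace.toDual ℝ Plane).symm.continuous.comp (hφ.continuous_fderiv (by simp))

theorem hasCompactSupport_gradient {φ : Plane → ℝ} (hφ : HasCompactSupport φ) :
    HasCompactSupport (gradient φ) :=
  (hφ.fderiv (𝕜 := ℝ)).comp_left (g := (InnerProductSpace.toDual ℝ Plane).symm) (by simp)

/-- Each identity that defines the weak gradient is a closed condition on the pair. This provides
the completeness needed for Lax–Milgram. -/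
theorem isClosed_H1 (Ω : Set Plane) : IsClosed (H1 Ω : Set
    (WithLp 2 (Lp ℝ 2 (volume.restrict Ω) × Lp Plane 2 (volume.restrict Ω)))) := by
  have : (H1 Ω : Set (WithLp 2 (Lp ℝ 2 (volume.restrict Ω) × Lp Plane 2 (volume.restrict Ω))))
      = ⋂ φ : {φ : Plane → ℝ // IsTestFunction Ω φ}, ⋂ v : Plane, {p |
        ∫ x in Ω, p.fst x * fderiv ℝ φ.1 x v = - ∫ x in Ω, inner ℝ (p.snd x) v * φ.1 x} := by
    ext p
    simp only [mem_iInter, Subtype.forall]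
    rfl
  rw [this]
  refine isClosed_iInter fun φ => isClosed_iInter fun v => ?_
  obtain ⟨φ, hφ⟩ := φ
  have hv : MemLp (fun x => φ x • v) 2 (volume.restrict Ω) := 
    ((hφ.smooth.continuous.smul continuous_const).memLp_of_hasCompactSupport
      hφ.compact.smul_right).restrict Ω
  have h1 : ∀ p : WithLp 2 (Lp ℝ 2 (volume.restrict Ω) × Lp Plane 2 (volume.restrict Ω)),
      ∫ x in Ω, p.fst x * fderiv ℝ φ x v = inner ℝ ((hφ.memLp_fderiv v).toLp _) p.fst := by
    intro p
    rw [inner_toLp_left]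
    rfl
  have h2 : ∀ p : WithLp 2 (Lp ℝ 2 (volume.restrict Ω) × Lp Plane 2 (volume.restrict Ω)),
      ∫ x in Ω, inner ℝ (p.snd x) v * φ x = inner ℝ (hv.toLp _) p.snd := by
    intro p
    rw [inner_toLp_left]
    refine integral_congr_ae (Eventually.of_forall fun x => ?_)
    simp only [real_inner_smul_left]
    rw [real_inner_comm, mul_comm]
  simp only [h1, h2]
  have c1 := (WithLp.fstL 2 ℝ (Lp ℝ 2 (volume.restrict Ω)) (Lp Plane 2 (volume.restrict Ω))).continuous
  have c2 := (WithLp.sndL 2 ℝ (Lp ℝ 2 (volume.restrict Ω)) (Lp Plane 2 (volume.restrict Ω))).continuous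
  exact isClosed_eq (continuous_const.inner c1) (continuous_const.inner c2).neg

instance completeSpace_H1 (Ω : Set Plane) : CompleteSpace (H1 Ω) :=
  (isClosed_H1 Ω).completeSpace_coe

instance isClosed_H10 (Ω : Set Plane) : IsClosed (H10 Ω : Set (H1 Ω)) :=
  Submodule.isClosed_topologicalClosure _

/-- The inclusion `H¹(Ω) → L²(Ω)`. -/
noncomputable def fnL (Ω : Set Plane) : H1 Ω →L[ℝ] Lp ℝ 2 (volume.restrict Ω) :=
  (WithLp.fstL 2 ℝ _ _).comp (H1 Ω).subtypeL

/-- The gradient `H¹(Ω) → L²(Ω; ℝ²)`. -/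
noncomputable def gradL (Ω : Set Plane) : H1 Ω →L[ℝ] Lp Plane 2 (volume.restrict Ω) :=
  (WithLp.sndL 2 ℝ _ _).comp (H1 Ω).subtypeL

theorem norm_sq_H1 (u : H1 Ω) : ‖u‖ ^ 2 = ‖fn u‖ ^ 2 + ‖grad u‖ ^ 2 :=
  WithLp.prod_norm_sq_eq_of_L2 u.1

theorem H1_ext {u v : H1 Ω} (h1 : fn u = fn v) (h2 : grad u = grad v) : u = v := by
  refine Subtype.ext (WithLp.ofLp_injective 2 (Prod.ext h1 h2))

theorem fn_add (u v : H1 Ω) : fn (u + v) =ᵐ[volume.restrict Ω] fun x => fn u x + fn v x :=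
  Lp.coeFn_add (fn u) (fn v)

theorem fn_sub (u v : H1 Ω) : fn (u - v) =ᵐ[volume.restrict Ω] fun x => fn u x - fn v x :=
  Lp.coeFn_sub (fn u) (fn v)

theorem fn_smul (c : ℝ) (u : H1 Ω) : fn (c • u) =ᵐ[volume.restrict Ω] fun x => c * fn u x :=
  Lp.coeFn_smul c (fn u)

theorem fn_zero : fn (0 : H1 Ω) =ᵐ[volume.restrict Ω] fun _ => 0 :=
  Lp.coeFn_zero ℝ 2 (volume.restrict Ω)

theorem grad_sub (u v : H1 Ω) : grad (u - v) =ᵐ[volume.restrict Ω] fun x => grad u x - grad v x :=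
  Lp.coeFn_sub (grad u) (grad v)

/-- The weak gradient coincides, on an open set where the function is smooth, with the classical
gradient. -/
theorem grad_eq_gradient {W : Set Plane} (hΩ : IsOpen Ω) (hW : IsOpen W) (hWΩ : W ⊆ Ω)
    (u : H1 Ω) {φ : Plane → ℝ} (hφ : ContDiffOn ℝ ∞ φ W)
    (h : ∀ᵐ x ∂(volume.restrict Ω), x ∈ W → fn u x = φ x) :
    ∀ᵐ x ∂(volume.restrict Ω), x ∈ W → grad u x = gradient φ x := by
  have key : ∀ v : Plane, ∀ᵐ x ∂(volume : Measure Plane), x ∈ W →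
      inner ℝ (grad u x) v - fderiv ℝ φ x v = 0 := by
    intro v
    have hcφ : ContinuousOn (fun x => fderiv ℝ φ x v) W :=
      (hφ.continuousOn_fderiv_of_isOpen hW (by simp)).clm_apply continuousOn_const
    have hl1 : LocallyIntegrableOn (fun x => inner ℝ (grad u x) v) W := by
      have : LocallyIntegrable (fun x => inner ℝ (grad u x) v) (volume.restrict Ω) :=
        ((Lp.memLp (grad u)).inner_const v).locallyIntegrable (by norm_num)
      intro x hx
      obtain ⟨s, hs, hi⟩ := this x
      refine ⟨W ∩ s, inter_mem self_mem_nhdsWithin (mem_nhdsWithin_of_mem_nhds hs), ?_⟩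
      rw [IntegrableOn, Measure.restrict_restrict' hΩ.measurableSet] at hi
      exact IntegrableOn.mono_set (t := s ∩ Ω) hi fun y hy => ⟨hy.2, hWΩ hy.1⟩
    have hl2 : LocallyIntegrableOn (fun x => fderiv ℝ φ x v) W :=
      hcφ.locallyIntegrableOn hW.measurableSet
    -- Fundamental lemma of the calculus of variations on W: a test function g supported in W is
    -- also one for Ω, and the weak and classical integrations by parts of it are compared.
    refine hW.ae_eq_zero_of_integral_contDiff_smul_eq_zero (hl1.sub hl2) fun g hg hgc hgs => ?_
    have hgt : IsTestFunction Ω g := ⟨hg, hgc, hgs.trans hWΩ⟩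
    have hgW : ∀ x ∉ W, g x = 0 := fun x hx => image_eq_zero_of_notMem_tsupport fun h => hx (hgs h)
    have hgW' : ∀ x ∉ W, fderiv ℝ g x v = 0 := fun x hx => by
      rw [fderiv_of_notMem_tsupport ℝ fun h => hx (hgs h)]
      rfl
    have hw := u.2 g hgt v
    have e1 : ∫ x in Ω, u.1.fst x * fderiv ℝ g x v = ∫ x, φ x * fderiv ℝ g x v := by
      rw [← setIntegral_eq_integral_of_forall_compl_eq_zero (s := Ω)
        (f := fun x => φ x * fderiv ℝ g x v) fun x hx => by
          rw [hgW' x fun h => hx (hWΩ h), mul_zero]]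
      refine integral_congr_ae ?_
      filter_upwards [h] with x hx
      by_cases hxW : x ∈ W
      · rw [← hx hxW]; rfl
      · simp only [hgW' x hxW, mul_zero]
    have hcs : ∀ f : Plane → ℝ, ContinuousOn f W → ∀ k : Plane → ℝ, Continuous k →
        tsupport k ⊆ tsupport g → Integrable (fun x => f x * k x) := by
      intro f hf k hk hks
      have hc : HasCompactSupport (fun x => f x * k x) :=
        HasCompactSupport.mul_left (hgc.of_isClosed_subset (isClosed_tsupport _) hks)
      refine Continuous.integrable_of_hasCompactSupport ?_ hc
      refine continuous_iff_continuousAt.2 fun x => ?_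
      by_cases hx : x ∈ W
      · exact (hf.continuousAt (hW.mem_nhds hx)).mul hk.continuousAt
      · have hx' : x ∉ tsupport k := fun h => hx (hgs (hks h))
        have : (fun x => f x * k x) =ᶠ[𝓝 x] fun _ => 0 := by
          filter_upwards [(isClosed_tsupport k).isOpen_compl.mem_nhds hx'] with y hy
          rw [image_eq_zero_of_notMem_tsupport hy, mul_zero]
        exact continuousAt_const.congr this.symm
    have hkf : Continuous (fun x => fderiv ℝ g x v) :=
      (hg.continuous_fderiv (by simp)).clm_apply continuous_const
    have e2 : ∫ x, φ x * fderiv ℝ g x v = - ∫ x, fderiv ℝ φ x v * g x := by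
      refine integral_mul_fderiv_eq_neg_fderiv_mul_of_integrable
        (hcs _ hcφ g hg.continuous le_rfl)
        (hcs _ hφ.continuousOn _ hkf (tsupport_fderiv_apply_subset ℝ v))
        (hcs _ hφ.continuousOn g hg.continuous le_rfl) (fun x hx => ?_)
        (fun x _ => hg.differentiable (by simp) x)
      exact (hφ.contDiffAt (hW.mem_nhds (hgs hx))).differentiableAt (by simp)
    have e3 : ∫ x in Ω, inner ℝ (u.1.snd x) v * g x = ∫ x, inner ℝ (grad u x) v * g x :=
      setIntegral_eq_integral_of_forall_compl_eq_zero fun x hx => by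
        rw [hgW x fun h => hx (hWΩ h), mul_zero]
    have i1 : Integrable (fun x => inner ℝ (grad u x) v * g x) := by
      have : IntegrableOn (fun x => inner ℝ (grad u x) v * g x) Ω := integrable_right hgt (grad u) v
      exact this.integrable_of_forall_notMem_eq_zero fun x hx => by
        rw [hgW x fun h => hx (hWΩ h), mul_zero]
    have i2 := hcs _ hcφ g hg.continuous le_rfl
    rw [e1, e2, e3, neg_inj] at hw
    have : ∀ x, g x • (inner ℝ (grad u x) v - fderiv ℝ φ x v)
        = inner ℝ (grad u x) v * g x - fderiv ℝ φ x v * g x := fun x => by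
      rw [smul_eq_mul]; ring
    simp only [this]
    rw [integral_sub i1 i2, hw, sub_self]
  refine ae_restrict_of_ae ?_
  filter_upwards [key (EuclideanSpace.single 0 1), key (EuclideanSpace.single 1 1)] with x h0 h1 hx
  ext i
  rw [gradient_apply, ← inner_single, pd]
  fin_cases i
  · exact sub_eq_zero.1 (h0 hx)
  · exact sub_eq_zero.1 (h1 hx)

theorem grad_eq_zero_of_fn_eq_zero {W : Set Plane} (hΩ : IsOpen Ω) (hW : IsOpen W) (hWΩ : W ⊆ Ω)
    (u : H1 Ω) (h : ∀ᵐ x ∂(volume.restrict Ω), x ∈ W → fn u x = 0) :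
    ∀ᵐ x ∂(volume.restrict Ω), x ∈ W → grad u x = 0 := by
  filter_upwards [grad_eq_gradient hΩ hW hWΩ u contDiffOn_const h] with x hx hxW
  rw [hx hxW, gradient_fun_const]

theorem memLp_smooth (Ω : Set Plane) {φ : Plane → ℝ} (hφ : ContDiff ℝ ∞ φ)
    (hc : HasCompactSupport φ) : MemLp φ 2 (volume.restrict Ω) :=
  (hφ.continuous.memLp_of_hasCompactSupport hc).restrict Ω

theorem memLp_gradient (Ω : Set Plane) {φ : Plane → ℝ} (hφ : ContDiff ℝ ∞ φ)
    (hc : HasCompactSupport φ) : MemLp (gradient φ) 2 (volume.restrict Ω) :=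
  ((continuous_gradient hφ).memLp_of_hasCompactSupport (hasCompactSupport_gradient hc)).restrict Ω

theorem isWeakGrad_smooth (Ω : Set Plane) {φ : Plane → ℝ} (hφ : ContDiff ℝ ∞ φ)
    (hc : HasCompactSupport φ) :
    IsWeakGrad Ω ((memLp_smooth Ω hφ hc).toLp φ) ((memLp_gradient Ω hφ hc).toLp (gradient φ)) := by
  intro ψ hψ v
  have h1 : ∫ x in Ω, ((memLp_smooth Ω hφ hc).toLp φ) x * fderiv ℝ ψ x v
      = ∫ x in Ω, φ x * fderiv ℝ ψ x v := by
    refine integral_congr_ae ?_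
    filter_upwards [(memLp_smooth Ω hφ hc).coeFn_toLp] with x hx
    rw [hx]
  have h2 : ∫ x in Ω, inner ℝ (((memLp_gradient Ω hφ hc).toLp (gradient φ)) x) v * ψ x
      = ∫ x in Ω, fderiv ℝ φ x v * ψ x := by
    refine integral_congr_ae ?_
    filter_upwards [(memLp_gradient Ω hφ hc).coeFn_toLp] with x hx
    rw [hx, inner_gradient]
  have hz : ∀ x ∉ Ω, x ∉ tsupport ψ := fun x hx h => hx (hψ.supp h)
  have h3 : ∫ x in Ω, φ x * fderiv ℝ ψ x v = ∫ x, φ x * fderiv ℝ ψ x v :=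
    setIntegral_eq_integral_of_forall_compl_eq_zero fun x hx => by
      rw [fderiv_of_notMem_tsupport ℝ (hz x hx)]; simp
  have h4 : ∫ x in Ω, fderiv ℝ φ x v * ψ x = ∫ x, fderiv ℝ φ x v * ψ x :=
    setIntegral_eq_integral_of_forall_compl_eq_zero fun x hx => by
      rw [image_eq_zero_of_notMem_tsupport (hz x hx), mul_zero]
  have c1 : Continuous (fun x => fderiv ℝ φ x v) :=
    (hφ.continuous_fderiv (by simp)).clm_apply continuous_const
  have c2 : Continuous (fun x => fderiv ℝ ψ x v) :=
    (hψ.smooth.continuous_fderiv (by simp)).clm_apply continuous_const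
  rw [h1, h2, h3, h4]
  exact integral_mul_fderiv_eq_neg_fderiv_mul_of_integrable
    ((c1.mul hψ.smooth.continuous).integrable_of_hasCompactSupport hψ.compact.mul_left)
    ((hφ.continuous.mul c2).integrable_of_hasCompactSupport hc.mul_right)
    ((hφ.continuous.mul hψ.smooth.continuous).integrable_of_hasCompactSupport hc.mul_right)
    (fun x _ => hφ.differentiable (by simp) x) (fun x _ => hψ.smooth.differentiable (by simp) x)

/-- The restriction to `Ω` of a smooth compactly supported function. -/
noncomputable def ofSmooth (Ω : Set Plane) (φ : Plane → ℝ) (hφ : ContDiff ℝ ∞ φ)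
    (hc : HasCompactSupport φ) : H1 Ω :=
  ⟨WithLp.toLp 2 ((memLp_smooth Ω hφ hc).toLp φ, (memLp_gradient Ω hφ hc).toLp (gradient φ)),
    isWeakGrad_smooth Ω hφ hc⟩

theorem fn_ofSmooth {φ : Plane → ℝ} (hφ : ContDiff ℝ ∞ φ) (hc : HasCompactSupport φ) :
    fn (ofSmooth Ω φ hφ hc) =ᵐ[volume.restrict Ω] φ :=
  (memLp_smooth Ω hφ hc).coeFn_toLp

theorem grad_ofSmooth {φ : Plane → ℝ} (hφ : ContDiff ℝ ∞ φ) (hc : HasCompactSupport φ) :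
    grad (ofSmooth Ω φ hφ hc) =ᵐ[volume.restrict Ω] gradient φ :=
  (memLp_gradient Ω hφ hc).coeFn_toLp

theorem ofSmooth_mem_H10 {φ : Plane → ℝ} (hφ : IsTestFunction Ω φ) :
    ofSmooth Ω φ hφ.smooth hφ.compact ∈ H10 Ω :=
  Submodule.le_topologicalClosure _ (Submodule.subset_span ⟨φ, hφ, fn_ofSmooth _ _⟩)

theorem exists_test_of_mem_span {w : H1 Ω} (hw : w ∈ Submodule.span ℝ
    {w : H1 Ω | ∃ φ, IsTestFunction Ω φ ∧ fn w =ᵐ[volume.restrict Ω] φ}) :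
    ∃ φ, IsTestFunction Ω φ ∧ fn w =ᵐ[volume.restrict Ω] φ := by
  induction hw using Submodule.span_induction with
  | mem w hw => exact hw
  | zero =>
    refine ⟨fun _ => 0, ⟨contDiff_const, HasCompactSupport.zero, ?_⟩, fn_zero⟩
    simp [tsupport]
  | add u v _ _ hu hv =>
    obtain ⟨φ, hφ, hu⟩ := hu
    obtain ⟨ψ, hψ, hv⟩ := hv
    refine ⟨fun x => φ x + ψ x, ⟨hφ.smooth.add hψ.smooth, hφ.compact.add hψ.compact,
      (tsupport_add φ ψ).trans (union_subset hφ.supp hψ.supp)⟩, ?_⟩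
    filter_upwards [fn_add u v, hu, hv] with x h1 h2 h3
    rw [h1, h2, h3]
  | smul c u _ hu =>
    obtain ⟨φ, hφ, hu⟩ := hu
    refine ⟨fun x => c * φ x, ⟨contDiff_const.mul hφ.smooth, hφ.compact.mul_left,
      (tsupport_mul_subset_right (f := fun _ => c) (g := φ)).trans hφ.supp⟩, ?_⟩
    filter_upwards [fn_smul c u, hu] with x h1 h2
    rw [h1, h2]

/-- A closed property that holds for test functions holds on `H¹₀(Ω)`. -/
theorem H10_induction {P : H1 Ω → Prop} (hP : IsClosed {u | P u})
    (h : ∀ φ (hφ : IsTestFunction Ω φ), P (ofSmooth Ω φ hφ.smooth hφ.compact))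
    (hΩ : IsOpen Ω) {u : H1 Ω} (hu : u ∈ H10 Ω) : P u := by
  refine closure_minimal (s := (Submodule.span ℝ {w : H1 Ω | ∃ φ, IsTestFunction Ω φ ∧
    fn w =ᵐ[volume.restrict Ω] φ} : Set (H1 Ω))) (fun w hw => ?_) hP hu
  obtain ⟨φ, hφ, hwφ⟩ := exists_test_of_mem_span hw
  -- An element of `H1` is determined by its function alone, since the weak gradient is unique.
  have : w = ofSmooth Ω φ hφ.smooth hφ.compact := by
    refine H1_ext (Lp.ext (hwφ.trans (fn_ofSmooth _ _).symm)) (Lp.ext ?_)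
    have h1 := grad_eq_gradient hΩ hΩ le_rfl w hφ.smooth.contDiffOn
      (hwφ.mono fun x hx _ => hx)
    filter_upwards [h1, grad_ofSmooth hφ.smooth hφ.compact, ae_restrict_mem hΩ.measurableSet]
      with x hx hx' hxΩ
    rw [hx hxΩ, hx']
  rw [this]
  exact h φ hφ

end AntiplaneShear

namespace AntiplaneShear

open MeasureTheory Filter Topology Set
open scoped ContDiff ENNReal NNReal

variable {Ω : Set Plane}

/-! ### The Poincaré inequality and the harmonic decomposition -/

/-- In dimension two the Gagliardo–Nirenberg–Sobolev inequality bounds the L² norm of a test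
function by the L¹ norm of its gradient; Hölder on the bounded set Ω replaces L¹ by L². The bound
then passes to the closure. -/
theorem poincare (hΩ : IsOpen Ω) (hb : Bornology.IsBounded Ω) :
    ∃ C : ℝ, 0 < C ∧ ∀ u ∈ H10 Ω, ‖fn u‖ ≤ C * ‖grad u‖ := by
  have hfin : volume Ω < ⊤ := hb.measure_lt_top
  set K : ℝ≥0∞ := eLpNormLESNormFDerivOneConst (volume : Measure Plane) 2 *
    (volume Ω) ^ ((1 : ℝ) / 1 - 1 / 2) with hK
  have hKt : K ≠ ⊤ := ENNReal.mul_ne_top ENNReal.coe_ne_top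
    (ENNReal.rpow_ne_top_of_nonneg (by norm_num) hfin.ne)
  refine ⟨K.toReal + 1, by positivity, fun u hu => ?_⟩
  refine H10_induction (P := fun u => ‖fn u‖ ≤ (K.toReal + 1) * ‖grad u‖) ?_ ?_ hΩ hu
  · exact isClosed_le (fnL Ω).continuous.norm (continuous_const.mul (gradL Ω).continuous.norm)
  intro φ hφ
  have h1 : ‖fn (ofSmooth Ω φ hφ.smooth hφ.compact)‖
      = (eLpNorm φ 2 (volume.restrict Ω)).toReal :=
    Lp.norm_toLp _ (memLp_smooth Ω hφ.smooth hφ.compact)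
  have h2 : ‖grad (ofSmooth Ω φ hφ.smooth hφ.compact)‖
      = (eLpNorm (gradient φ) 2 (volume.restrict Ω)).toReal :=
    Lp.norm_toLp _ (memLp_gradient Ω hφ.smooth hφ.compact)
  have hsup : Function.support (gradient φ) ⊆ Ω := by
    intro x hx
    by_contra hxΩ
    refine hx ?_
    rw [gradient, fderiv_of_notMem_tsupport ℝ fun h => hxΩ (hφ.supp h), map_zero]
  have h3 : eLpNorm φ 2 (volume.restrict Ω) ≤ K * eLpNorm (gradient φ) 2 (volume.restrict Ω) := by
    have hconj : NNReal.HolderConjugate (Module.finrank ℝ Plane) 2 := by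
      rw [finrank_euclideanSpace, Fintype.card_fin]
      norm_num [NNReal.holderConjugate_iff]
    calc eLpNorm φ 2 (volume.restrict Ω) ≤ eLpNorm φ 2 volume :=
          eLpNorm_mono_measure _ Measure.restrict_le_self
      _ ≤ eLpNormLESNormFDerivOneConst (volume : Measure Plane) 2 *
          eLpNorm (fderiv ℝ φ) 1 volume :=
        eLpNorm_le_eLpNorm_fderiv_one volume (hφ.smooth.of_le (by simp)) hφ.compact hconj
      _ = eLpNormLESNormFDerivOneConst (volume : Measure Plane) 2 *
          eLpNorm (gradient φ) 1 (volume.restrict Ω) := by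
        rw [eLpNorm_restrict_eq_of_support_subset hsup]
        congr 1
        exact eLpNorm_congr_norm_ae (Eventually.of_forall fun x => (norm_gradient φ x).symm)
      _ ≤ eLpNormLESNormFDerivOneConst (volume : Measure Plane) 2 *
          (eLpNorm (gradient φ) 2 (volume.restrict Ω) * (volume Ω) ^ ((1 : ℝ) / 1 - 1 / 2)) := by
        gcongr
        have := eLpNorm_le_eLpNorm_mul_rpow_measure_univ (p := 1) (q := 2) (by norm_num)
          (memLp_gradient Ω hφ.smooth hφ.compact).1
        simpa using this
      _ = K * eLpNorm (gradient φ) 2 (volume.restrict Ω) := by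
        rw [hK]; ring
  have hgt : eLpNorm (gradient φ) 2 (volume.restrict Ω) ≠ ⊤ :=
    (memLp_gradient Ω hφ.smooth hφ.compact).2.ne
  rw [h1, h2]
  have h4 := ENNReal.toReal_mono (ENNReal.mul_ne_top hKt hgt) h3
  rw [ENNReal.toReal_mul] at h4
  have h5 : (0 : ℝ) ≤ (eLpNorm (gradient φ) 2 (volume.restrict Ω)).toReal := ENNReal.toReal_nonneg
  linarith

theorem exists_of_coercive {V : Type*} [NormedAddCommGroup V] [InnerProductSpace ℝ V]
    [CompleteSpace V] (B : V →L[ℝ] V →L[ℝ] ℝ) (hB : IsCoercive B) (f : V →L[ℝ] ℝ) :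
    ∃ v, ∀ w, B v w = f w := by
  refine ⟨hB.continuousLinearEquivOfBilin.symm ((InnerProductSpace.toDual ℝ V).symm f),
    fun w => ?_⟩
  rw [← hB.continuousLinearEquivOfBilin_apply, ContinuousLinearEquiv.apply_symm_apply,
    InnerProductSpace.toDual_symm_apply]

/-- Lax–Milgram on the complete subspace K, the only place where B has to be coercive. -/
theorem exists_of_coercive_on {H : Type*} [NormedAddCommGroup H] [InnerProductSpace ℝ H]
    {K : Submodule ℝ H} (hK : IsComplete (K : Set H)) (B : H →L[ℝ] H →L[ℝ] ℝ) {c : ℝ} (hc : 0 < c)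
    (hB : ∀ w ∈ K, c * ‖w‖ ^ 2 ≤ B w w) (f : H →L[ℝ] ℝ) :
    ∃ w ∈ K, ∀ φ ∈ K, B w φ = f φ := by
  have : CompleteSpace K := hK.completeSpace_coe
  have hco : IsCoercive (B.bilinearComp K.subtypeL K.subtypeL) := by
    refine ⟨c, hc, fun w => ?_⟩
    rw [mul_assoc, ← sq]
    exact hB w w.2
  obtain ⟨w, hw⟩ := exists_of_coercive _ hco (f.comp K.subtypeL)
  exact ⟨w, w.2, fun φ hφ => hw ⟨φ, hφ⟩⟩

theorem poincare_norm_sq (hΩ : IsOpen Ω) (hb : Bornology.IsBounded Ω) :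
    ∃ c : ℝ, 0 < c ∧ ∀ u ∈ H10 Ω, c * ‖u‖ ^ 2 ≤ ‖grad u‖ ^ 2 := by
  obtain ⟨C, hC, hP⟩ := poincare hΩ hb
  refine ⟨(C ^ 2 + 1)⁻¹, by positivity, fun w hw => ?_⟩
  have h3 : ‖fn w‖ ^ 2 ≤ C ^ 2 * ‖grad w‖ ^ 2 := by
    rw [← mul_pow]
    exact pow_le_pow_left₀ (norm_nonneg _) (hP _ hw) 2
  rw [inv_mul_le_iff₀ (by positivity), norm_sq_H1]
  linarith

theorem exists_orthogonal_mod {H F : Type*} [NormedAddCommGroup H] [InnerProductSpace ℝ H]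
    [NormedAddCommGroup F] [InnerProductSpace ℝ F] {K : Submodule ℝ H}
    (hK : IsComplete (K : Set H)) (G : H →L[ℝ] F) {c : ℝ} (hc : 0 < c)
    (hG : ∀ w ∈ K, c * ‖w‖ ^ 2 ≤ ‖G w‖ ^ 2) (u : H) :
    ∃ v, v - u ∈ K ∧ ∀ φ ∈ K, inner ℝ (G v) (G φ) = 0 := by
  obtain ⟨w, hwK, hw⟩ := exists_of_coercive_on hK ((innerSL ℝ).bilinearComp G G) hc
    (fun w hw => (hG w hw).trans_eq (real_inner_self_eq_norm_sq _).symm)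
    ((innerSL ℝ (G u)).comp G)
  refine ⟨u - w, by simpa using hwK, fun φ hφ => ?_⟩
  have h1 : inner ℝ (G w) (G φ) = inner ℝ (G u) (G φ) := hw φ hφ
  rw [map_sub, inner_sub_left, h1, sub_self]

/-- Every boundary class has a harmonic representative. Being smooth inside Ω, it serves both to
show density of functions with a smooth representative and to lift boundary data into ℋ. -/
theorem exists_dirichlet_solution (hΩ : IsOpen Ω) (hb : Bornology.IsBounded Ω) (u : H1 Ω) :
    ∃ v : H1 Ω, v - u ∈ H10 Ω ∧ ∀ φ ∈ H10 Ω, inner ℝ (grad v) (grad φ) = 0 := by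
  obtain ⟨c, hc, hP⟩ := poincare_norm_sq hΩ hb
  exact exists_orthogonal_mod (isClosed_H10 Ω).isComplete (gradL Ω) hc hP u

theorem integrable_fn_mul (u : H1 Ω) {g : Plane → ℝ} (hg : MemLp g 2 (volume.restrict Ω)) :
    Integrable (fun x => fn u x * g x) (volume.restrict Ω) :=
  (Lp.memLp (fn u)).integrable_mul hg

theorem integrable_inner_grad_mul (u : H1 Ω) (v : Plane) {g : Plane → ℝ}
    (hg : MemLp g 2 (volume.restrict Ω)) :
    Integrable (fun x => inner ℝ (grad u x) v * g x) (volume.restrict Ω) :=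
  ((Lp.memLp (grad u)).inner_const v).integrable_mul hg

theorem memLp_pd (Ω : Set Plane) {φ : Plane → ℝ} (hφ : ContDiff ℝ ∞ φ)
    (hc : HasCompactSupport φ) (i : Fin 2) : MemLp (pd i φ) 2 (volume.restrict Ω) :=
  memLp_smooth Ω (contDiff_pd hφ i) (hasCompactSupport_pd hc i)

/-- Integration by parts against the Laplacian, for a function `v` whose weak derivatives are
known to be compatible with `ψ`. -/
theorem integral_fn_mul_lap (v : H1 Ω) {ψ : Plane → ℝ} (hψ : ContDiff ℝ ∞ ψ)
    (hc : HasCompactSupport ψ) (h : ∀ i, ∫ x in Ω, fn v x * pd i (pd i ψ) x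
      = -∫ x in Ω, inner ℝ (grad v x) (EuclideanSpace.single i 1) * pd i ψ x) :
    ∫ x in Ω, fn v x * lap ψ x = -inner ℝ (grad v) (grad (ofSmooth Ω ψ hψ hc)) := by
  have h1 : inner ℝ (grad v) (grad (ofSmooth Ω ψ hψ hc))
      = ∑ i, ∫ x in Ω, inner ℝ (grad v x) (EuclideanSpace.single i 1) * pd i ψ x := by
    rw [L2.inner_def, ← integral_finsetSum _ fun i _ =>
      integrable_inner_grad_mul v _ (memLp_pd Ω hψ hc i)]
    refine integral_congr_ae ?_
    filter_upwards [grad_ofSmooth (Ω := Ω) hψ hc] with x hx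
    rw [hx, PiLp.inner_apply]
    refine Finset.sum_congr rfl fun i _ => ?_
    rw [inner_single, gradient_apply]
    simp [mul_comm]
  rw [h1, ← Finset.sum_neg_distrib]
  simp only [lap, Finset.mul_sum]
  rw [integral_finsetSum _ fun i _ => integrable_fn_mul v
    (memLp_pd Ω (contDiff_pd hψ i) (hasCompactSupport_pd hc i) i)]
  exact Finset.sum_congr rfl fun i _ => h i

/-- The extension by zero of the function underlying `u`. -/
noncomputable def ext0 (u : H1 Ω) : Plane → ℝ := Ω.indicator (fn u)

theorem integrable_ext0 (hΩ : IsOpen Ω) (hb : Bornology.IsBounded Ω) (u : H1 Ω) :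
    Integrable (ext0 u) := by
  have : IsFiniteMeasure (volume.restrict Ω) := ⟨by
    rw [Measure.restrict_apply_univ]; exact hb.measure_lt_top⟩
  have h : IntegrableOn (fn u) Ω := (Lp.memLp (fn u)).integrable (by norm_num)
  exact h.integrable_indicator hΩ.measurableSet

theorem integral_ext0_mul (hΩ : IsOpen Ω) (u : H1 Ω) (g : Plane → ℝ) :
    ∫ x, ext0 u x * g x = ∫ x in Ω, fn u x * g x := by
  rw [← integral_indicator hΩ.measurableSet]
  refine integral_congr_ae (Eventually.of_forall fun x => ?_)
  simp only [ext0]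
  by_cases hx : x ∈ Ω <;> simp [hx]

/-- A function orthogonal to `H¹₀(Ω)` in the Dirichlet form is smooth. -/
theorem exists_smooth_of_dirichlet (hΩ : IsOpen Ω) (hb : Bornology.IsBounded Ω) {v : H1 Ω}
    (hv : ∀ φ ∈ H10 Ω, inner ℝ (grad v) (grad φ) = 0) :
    ∃ h : Plane → ℝ, ContDiffOn ℝ ∞ h Ω ∧ fn v =ᵐ[volume.restrict Ω] h := by
  have hw : IsWeaklyHarmonic Ω (ext0 v) := by
    intro ψ hψ
    rw [integral_ext0_mul hΩ, integral_fn_mul_lap v hψ.smooth hψ.compact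
      fun i => v.2 _ (hψ.pd i) _, hv _ (ofSmooth_mem_H10 hψ), neg_zero]
  obtain ⟨h, hs, -, hae⟩ := hw.exists_harmonic hΩ (integrable_ext0 hΩ hb v)
  refine ⟨h, hs, ?_⟩
  filter_upwards [ae_restrict_of_ae hae, ae_restrict_mem hΩ.measurableSet] with x hx hxΩ
  rw [← hx hxΩ, ext0, indicator_of_mem hxΩ]

theorem continuous_integral_fn_mul {g : Plane → ℝ} (hg : MemLp g 2 (volume.restrict Ω)) :
    Continuous fun u : H1 Ω => ∫ x in Ω, fn u x * g x := by
  have : ∀ u : H1 Ω, ∫ x in Ω, fn u x * g x = inner ℝ (hg.toLp g) (fnL Ω u) := fun u => by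
    rw [inner_toLp_left]; rfl
  simp only [this]
  exact continuous_const.inner (fnL Ω).continuous

theorem continuous_integral_grad_mul (v : Plane) {g : Plane → ℝ} (hg : Continuous g)
    (hc : HasCompactSupport g) :
    Continuous fun u : H1 Ω => ∫ x in Ω, inner ℝ (grad u x) v * g x := by
  have hv : MemLp (fun x => g x • v) 2 (volume.restrict Ω) :=
    ((hg.smul continuous_const).memLp_of_hasCompactSupport hc.smul_right).restrict Ω
  have : ∀ u : H1 Ω, ∫ x in Ω, inner ℝ (grad u x) v * g x = inner ℝ (hv.toLp _) (gradL Ω u) :=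
    fun u => by
      rw [inner_toLp_left]
      refine integral_congr_ae (Eventually.of_forall fun x => ?_)
      simp only [real_inner_smul_left]
      rw [real_inner_comm, mul_comm]
      rfl
  simp only [this]
  exact continuous_const.inner (gradL Ω).continuous

/-- Functions in `H¹₀(Ω)`, extended by zero, are weakly differentiable in the whole plane. -/
theorem integral_fn_mul_fderiv_of_mem_H10 (hΩ : IsOpen Ω) {u : H1 Ω} (hu : u ∈ H10 Ω)
    {ψ : Plane → ℝ} (hψ : ContDiff ℝ ∞ ψ) (hc : HasCompactSupport ψ) (i : Fin 2) :
    ∫ x in Ω, fn u x * pd i ψ x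
      = -∫ x in Ω, inner ℝ (grad u x) (EuclideanSpace.single i 1) * ψ x := by
  refine H10_induction (P := fun u => ∫ x in Ω, fn u x * pd i ψ x
      = -∫ x in Ω, inner ℝ (grad u x) (EuclideanSpace.single i 1) * ψ x) ?_ ?_ hΩ hu
  · exact isClosed_eq (continuous_integral_fn_mul (memLp_pd Ω hψ hc i))
      (continuous_integral_grad_mul _ hψ.continuous hc).neg
  intro φ hφ
  have h := isWeakGrad_smooth Ω hψ hc φ hφ (EuclideanSpace.single i 1)
  have e1 : ∫ x in Ω, ((memLp_smooth Ω hψ hc).toLp ψ) x * fderiv ℝ φ x (EuclideanSpace.single i 1)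
      = ∫ x in Ω, inner ℝ (grad (ofSmooth Ω φ hφ.smooth hφ.compact) x)
        (EuclideanSpace.single i 1) * ψ x := by
    refine integral_congr_ae ?_
    filter_upwards [(memLp_smooth Ω hψ hc).coeFn_toLp,
      grad_ofSmooth (Ω := Ω) hφ.smooth hφ.compact] with x hx hx'
    rw [hx, hx', inner_gradient, mul_comm]
  have e2 : ∫ x in Ω, inner ℝ (((memLp_gradient Ω hψ hc).toLp (gradient ψ)) x)
      (EuclideanSpace.single i 1) * φ x
      = ∫ x in Ω, fn (ofSmooth Ω φ hφ.smooth hφ.compact) x * pd i ψ x := by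
    refine integral_congr_ae ?_
    filter_upwards [(memLp_gradient Ω hψ hc).coeFn_toLp,
      fn_ofSmooth (Ω := Ω) hφ.smooth hφ.compact] with x hx hx'
    rw [hx, hx', inner_gradient, mul_comm]
    rfl
  rw [e1, e2] at h
  linarith

/-! ### Traces on the curve -/

theorem lintegral_H1 (u : H1 Ω) :
    ∫⁻ x in Ω, ENNReal.ofReal (fn u x ^ 2 + ‖grad u x‖ ^ 2) = ENNReal.ofReal (‖u‖ ^ 2) := by
  have i1 : Integrable (fun x => fn u x ^ 2) (volume.restrict Ω) := by
    simpa using integrable_norm_sq (fn u)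
  have i2 := integrable_norm_sq (grad u)
  have i3 : Integrable (fun x => fn u x ^ 2 + ‖grad u x‖ ^ 2) (volume.restrict Ω) := i1.add i2
  rw [← ofReal_integral_eq_lintegral_ofReal i3
    (Eventually.of_forall fun x => by positivity), integral_add i1 i2, norm_sq_H1,
    norm_sq_eq_integral, norm_sq_eq_integral]
  simp

theorem eLpNorm_two_sq {α : Type*} [MeasurableSpace α] (ν : Measure α) (f : α → ℝ) :
    eLpNorm f 2 ν ^ 2 = ∫⁻ x, ENNReal.ofReal (f x ^ 2) ∂ν := by
  have := eLpNorm_nnreal_pow_eq_lintegral (p := 2) (μ := ν) (f := f) (by norm_num)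
  simp only [NNReal.coe_ofNat, ENNReal.rpow_ofNat, ENNReal.coe_ofNat] at this
  rw [this]
  refine lintegral_congr fun s => ?_
  rw [← ofReal_norm, ← ENNReal.ofReal_pow (norm_nonneg _), Real.norm_eq_abs, sq_abs]

/-- On A both u and its gradient vanish, so φ has there the same density as w - u. -/
theorem lintegral_dens_le (hΩ : IsOpen Ω) {A : Set Plane} (hA : IsOpen A) (hAΩ : A ⊆ Ω)
    {w u : H1 Ω} {φ : Plane → ℝ} (hφ : ContDiffOn ℝ ∞ φ Ω) (hwφ : fn w =ᵐ[volume.restrict Ω] φ)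
    (hu : ∀ᵐ x ∂(volume.restrict Ω), x ∈ A → fn u x = 0) :
    ∫⁻ x in A, dens φ x ≤ ENNReal.ofReal (‖w - u‖ ^ 2) := by
  have hgu := grad_eq_zero_of_fn_eq_zero hΩ hA hAΩ u hu
  have hgw := grad_eq_gradient hΩ hΩ le_rfl w hφ (hwφ.mono fun x hx _ => hx)
  have hae : ∀ᵐ x ∂(volume.restrict Ω), x ∈ A → dens φ x
      = ENNReal.ofReal (fn (w - u) x ^ 2 + ‖grad (w - u) x‖ ^ 2) := by
    filter_upwards [hu, hgu, hgw, hwφ, fn_sub w u, grad_sub w u] with x h1 h2 h3 h4 h5 h6 hx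
    rw [dens, h5, h6, h1 hx, h2 hx, h3 (hAΩ hx), h4, sub_zero, sub_zero, norm_gradient]
  have hdens : ∫⁻ x in A, dens φ x
      = ∫⁻ x in A, ENNReal.ofReal (fn (w - u) x ^ 2 + ‖grad (w - u) x‖ ^ 2) := by
    refine lintegral_congr_ae ?_
    filter_upwards [ae_restrict_of_ae_restrict_of_subset hAΩ hae,
      ae_restrict_mem hA.measurableSet] with x hx hxA using hx hxA
  exact hdens.trans_le ((lintegral_mono_set hAΩ).trans_eq (lintegral_H1 (w - u)))

/-- The trace inequality for an element `w` of `H¹(Ω)` with a smooth representative, modulo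
functions `u` vanishing outside `D` near the curve. -/
theorem trace_bound {D N : Set Plane} (hD : IsSmoothDomain D) {L : ℝ} {γ : ℝ → Plane}
    (hγ : IsArclengthParam (frontier D) L γ) (hΩ : IsOpen Ω) (hN : IsOpen N)
    (hDN : frontier D ⊆ N) (hNΩ : N ⊆ Ω) :
    ∃ C : ℝ≥0, ∀ (w u : H1 Ω) (φ : Plane → ℝ), ContDiffOn ℝ ∞ φ Ω →
      fn w =ᵐ[volume.restrict Ω] φ →
      (∀ᵐ x ∂(volume.restrict Ω), x ∈ N \ closure D → fn u x = 0) →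
      eLpNorm (fun s => φ (γ s)) 2 (volume.restrict (Ioc 0 L)) ≤ C * ENNReal.ofReal ‖w - u‖ := by
  obtain ⟨C, hC⟩ := trace_inequality hD hγ hΩ hN hDN hNΩ
  refine ⟨NNReal.sqrt C, fun w u φ hφ hwφ hu => ?_⟩
  have h0 := lintegral_dens_le hΩ (hN.sdiff isClosed_closure) (sdiff_subset.trans hNΩ) hφ hwφ hu
  have h1 := (hC φ hφ).trans (mul_le_mul_right h0 (C : ℝ≥0∞))
  have hr : 0 ≤ ‖w - u‖ := norm_nonneg _
  generalize ‖w - u‖ = r at h1 hr ⊢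
  have h3 : (C : ℝ≥0∞) = (NNReal.sqrt C : ℝ≥0∞) ^ 2 := by
    rw [← ENNReal.coe_pow, NNReal.sq_sqrt]
  rw [← eLpNorm_two_sq, ENNReal.ofReal_pow hr, h3, ← mul_pow] at h1
  exact (ENNReal.pow_le_pow_left_iff (by norm_num)).1 h1

end AntiplaneShear

namespace AntiplaneShear

open MeasureTheory Filter Topology Set
open scoped ContDiff ENNReal NNReal

variable {Ω : Set Plane}

/-! ### The trace operator -/

/-- A closed linear relation that is bounded and densely defined is a bounded operator. -/
theorem exists_clm_of_graph {H F : Type*} [NormedAddCommGroup H] [NormedSpace ℝ H]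
    [NormedAddCommGroup F] [NormedSpace ℝ F] [CompleteSpace H] [CompleteSpace F]
    {G : Submodule ℝ (H × F)} (hG : IsClosed (G : Set (H × F))) {C : ℝ≥0}
    (hb : ∀ p ∈ G, ‖p.2‖ ≤ C * ‖p.1‖) (hd : ∀ u, u ∈ closure (Prod.fst '' (G : Set (H × F)))) :
    ∃ T : H →L[ℝ] F, ∀ u g, (u, g) ∈ G ↔ g = T u := by
  have : CompleteSpace G := hG.completeSpace_coe
  let f : G →L[ℝ] H := (ContinuousLinearMap.fst ℝ H F).comp G.subtypeL
  -- On a bounded relation the projection to H is bounded below, so its range is closed; being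
  -- dense, it is all of H.
  have hf : AntilipschitzWith (max 1 C) f := by
    refine f.antilipschitz_of_bound fun p => ?_
    have h1 : ‖(p : H × F).2‖ ≤ C * ‖(p : H × F).1‖ := hb p p.2
    have h2 : ‖p‖ = max ‖(p : H × F).1‖ ‖(p : H × F).2‖ := Prod.norm_def _
    have h3 : ‖f p‖ = ‖(p : H × F).1‖ := rfl
    rw [h2, h3, NNReal.coe_max, NNReal.coe_one]
    refine max_le ?_ (h1.trans ?_)
    · exact le_mul_of_one_le_left (norm_nonneg _) (le_max_left _ _)
    · gcongr
      exact le_max_right _ _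
  have hcl : IsClosed (range f) := hf.isClosed_range f.uniformContinuous
  have hex : ∀ u, ∃ g, (u, g) ∈ G := by
    intro u
    have hsub : Prod.fst '' (G : Set (H × F)) ⊆ range f := by
      rintro _ ⟨p, hp, rfl⟩
      exact ⟨⟨p, hp⟩, rfl⟩
    obtain ⟨p, hp⟩ := closure_minimal hsub hcl (hd u)
    exact ⟨(p : H × F).2, by rw [← hp]; exact p.2⟩
  have huniq : ∀ u g g', (u, g) ∈ G → (u, g') ∈ G → g = g' := by
    intro u g g' h h'
    have := hb _ (G.sub_mem h h')
    simp only [Prod.mk_sub_mk, sub_self, norm_zero, mul_zero] at this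
    exact sub_eq_zero.1 (norm_le_zero_iff.1 this)
  choose t ht using hex
  let T₀ : H →ₗ[ℝ] F :=
    { toFun := t
      map_add' := fun u v => huniq _ _ _ (ht _) (G.add_mem (ht u) (ht v))
      map_smul' := fun c u => huniq _ _ _ (ht _) (G.smul_mem c (ht u)) }
  refine ⟨T₀.mkContinuous C fun u => hb _ (ht u), fun u g => ⟨fun h => huniq _ _ _ h (ht u), ?_⟩⟩
  rintro rfl
  exact ht u

/-- The second conclusion is the bound at the point (u, T u) of the graph. It recognizes u with
vanishing trace without any approximation of u adapted to the set where it vanishes. -/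
theorem exists_clm_of_graph_closure {H F : Type*} [NormedAddCommGroup H] [NormedSpace ℝ H]
    [NormedAddCommGroup F] [NormedSpace ℝ F] [CompleteSpace H] [CompleteSpace F]
    {G : Submodule ℝ (H × F)} {C : ℝ≥0}
    (hb : ∀ p ∈ closure (G : Set (H × F)), ‖p.2‖ ≤ C * ‖p.1 - 0‖)
    (hd : ∀ u, u ∈ closure (Prod.fst '' (G : Set (H × F)))) :
    ∃ T : H →L[ℝ] F, (∀ u g, (u, g) ∈ closure (G : Set (H × F)) ↔ g = T u) ∧
      ∀ u, (∃ C : ℝ≥0, ∀ p ∈ closure (G : Set (H × F)), ‖p.2‖ ≤ C * ‖p.1 - u‖) → T u = 0 := by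
  obtain ⟨T, hT⟩ := exists_clm_of_graph (G := G.topologicalClosure)
    (Submodule.isClosed_topologicalClosure _) (C := C)
    (fun p hp => by simpa using hb p hp)
    (fun u => closure_mono (image_mono (Submodule.le_topologicalClosure _)) (hd u))
  refine ⟨T, hT, fun u ⟨C', hC'⟩ => ?_⟩
  simpa using hC' (u, T u) ((hT u (T u)).2 rfl)

theorem norm_snd_le_of_mem_closure {H F : Type*} [NormedAddCommGroup H] [NormedAddCommGroup F]
    {S : Set (H × F)} {u : H} {C : ℝ≥0} (h : ∀ p ∈ S, ‖p.2‖ ≤ C * ‖p.1 - u‖) :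
    ∀ p ∈ closure S, ‖p.2‖ ≤ C * ‖p.1 - u‖ := fun _ hp =>
  closure_minimal (t := {p : H × F | ‖p.2‖ ≤ C * ‖p.1 - u‖}) h
    (isClosed_le continuous_snd.norm
      (continuous_const.mul (continuous_fst.sub continuous_const).norm)) hp

theorem mem_closure_fst_of_sub_mem {H F : Type*} [NormedAddCommGroup H] [NormedSpace ℝ H]
    [NormedAddCommGroup F] [NormedSpace ℝ F] {G : Submodule ℝ (H × F)} {A : Set H}
    (hA : ∀ w ∈ A, ∃ g, (w, g) ∈ G) {u v : H} (hv : ∃ g, (v, g) ∈ G)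
    (h : v - u ∈ (Submodule.span ℝ A).topologicalClosure) :
    u ∈ closure (Prod.fst '' (G : Set (H × F))) := by
  set K := (G.map (LinearMap.fst ℝ H F)).topologicalClosure
  have hle : (Submodule.span ℝ A).topologicalClosure ≤ K := by
    refine Submodule.topologicalClosure_mono (Submodule.span_le.2 fun w hw => ?_)
    obtain ⟨g, hg⟩ := hA w hw
    exact ⟨_, hg, rfl⟩
  obtain ⟨g, hg⟩ := hv
  have h1 : v ∈ K := Submodule.le_topologicalClosure _ ⟨_, hg, rfl⟩
  have h2 := K.sub_mem h1 (hle h)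
  rw [sub_sub_cancel] at h2
  exact h2

theorem memLp_Ioc {L : ℝ} {f : ℝ → ℝ} (hf : Continuous f) :
    MemLp f 2 (volume.restrict (Ioc 0 L)) := by
  obtain ⟨C, hC⟩ := (isCompact_Icc (a := (0 : ℝ)) (b := L)).exists_bound_of_continuousOn
    hf.continuousOn
  refine MemLp.of_bound hf.aestronglyMeasurable C ?_
  filter_upwards [ae_restrict_mem measurableSet_Ioc] with s hs
  exact hC s (Ioc_subset_Icc_self hs)

/-- The graph of the restriction to the curve `γ`, on functions with a smooth representative. -/
noncomputable def smoothTraceGraph (Ω : Set Plane) (L : ℝ) (γ : ℝ → Plane) :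
    Submodule ℝ (H1 Ω × L2Curve L) where
  carrier := {p | ∃ φ : Plane → ℝ, ContDiffOn ℝ ∞ φ Ω ∧ fn p.1 =ᵐ[volume.restrict Ω] φ ∧
    p.2 =ᵐ[volume.restrict (Ioc 0 L)] fun s => φ (γ s)}
  zero_mem' := ⟨fun _ => 0, contDiffOn_const, fn_zero, Lp.coeFn_zero _ _ _⟩
  add_mem' := by
    rintro p q ⟨φ, hφ, h1, h2⟩ ⟨ψ, hψ, h3, h4⟩
    refine ⟨fun x => φ x + ψ x, hφ.add hψ, ?_, ?_⟩
    · filter_upwards [fn_add p.1 q.1, h1, h3] with x e1 e2 e3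
      exact e1.trans (by rw [e2, e3])
    · filter_upwards [Lp.coeFn_add p.2 q.2, h2, h4] with s e1 e2 e3
      exact e1.trans (by rw [Pi.add_apply, e2, e3])
  smul_mem' := by
    rintro c p ⟨φ, hφ, h1, h2⟩
    refine ⟨fun x => c * φ x, contDiffOn_const.mul hφ, ?_, ?_⟩
    · filter_upwards [fn_smul c p.1, h1] with x e1 e2
      exact e1.trans (by rw [e2])
    · filter_upwards [Lp.coeFn_smul c p.2, h2] with s e1 e2
      exact e1.trans (by rw [Pi.smul_apply, e2, smul_eq_mul])

theorem continuous_comp_curve {D : Set Plane} {L : ℝ} {γ : ℝ → Plane}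
    (hγ : IsArclengthParam (frontier D) L γ) (hDΩ : closure D ⊆ Ω) {φ : Plane → ℝ}
    (hφ : ContinuousOn φ Ω) : Continuous fun s => φ (γ s) :=
  hφ.comp_continuous hγ.smooth.continuous fun s =>
    hDΩ (frontier_subset_closure (hγ.range_eq ▸ mem_range_self s))

/-- Traces are defined by approximating sequences, so their graph is the closure of the graph on
functions with a smooth representative. -/
theorem isCurveTrace_iff {D : Set Plane} {L : ℝ} {γ : ℝ → Plane}
    (hγ : IsArclengthParam (frontier D) L γ) (hDΩ : closure D ⊆ Ω) (u : H1 Ω) (g : L2Curve L) :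
    IsCurveTrace L γ u g ↔ (u, g) ∈ closure (smoothTraceGraph Ω L γ : Set (H1 Ω × L2Curve L)) := by
  rw [mem_closure_iff_seq_limit]
  constructor
  · rintro ⟨w, φ, hφ, hw, hg⟩
    have hm : ∀ n, MemLp (fun s => φ n (γ s)) 2 (volume.restrict (Ioc 0 L)) := fun n =>
      memLp_Ioc (continuous_comp_curve hγ hDΩ (hφ n).1.continuousOn)
    refine ⟨fun n => (w n, (hm n).toLp _),
      fun n => ⟨φ n, (hφ n).1, (hφ n).2, (hm n).coeFn_toLp⟩, ?_⟩
    refine hw.prodMk_nhds ?_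
    rw [Lp.tendsto_Lp_iff_tendsto_eLpNorm']
    refine hg.congr fun n => eLpNorm_congr_ae ?_
    filter_upwards [(hm n).coeFn_toLp] with s hs
    rw [Pi.sub_apply, hs]
  · rintro ⟨p, hp, hlim⟩
    choose φ hφ h1 h2 using hp
    have hlim' := (Prod.tendsto_iff _ _).1 hlim
    refine ⟨fun n => (p n).1, φ, fun n => ⟨hφ n, h1 n⟩, hlim'.1, ?_⟩
    have := (Lp.tendsto_Lp_iff_tendsto_eLpNorm' _ _).1 hlim'.2
    refine this.congr fun n => eLpNorm_congr_ae ?_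
    filter_upwards [h2 n] with s hs
    rw [Pi.sub_apply, hs]

set_option maxHeartbeats 1000000 in
theorem trace_bound_graph {D N : Set Plane} (hD : IsSmoothDomain D) {L : ℝ} {γ : ℝ → Plane}
    (hγ : IsArclengthParam (frontier D) L γ) (hΩ : IsOpen Ω) (hN : IsOpen N)
    (hDN : frontier D ⊆ N) (hNΩ : N ⊆ Ω) :
    ∃ C : ℝ≥0, ∀ (u : H1 Ω), (∀ᵐ x ∂(volume.restrict Ω), x ∈ N \ closure D → fn u x = 0) →
      ∀ p ∈ closure (smoothTraceGraph Ω L γ : Set (H1 Ω × L2Curve L)),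
        ‖p.2‖ ≤ C * ‖p.1 - u‖ := by
  obtain ⟨C, hC⟩ := trace_bound hD hγ hΩ hN hDN hNΩ
  refine ⟨C, fun u hu => norm_snd_le_of_mem_closure ?_⟩
  rintro q ⟨φ, hφ, h1, h2⟩
  have h3 := hC q.1 u φ hφ h1 hu
  rw [← eLpNorm_congr_ae h2] at h3
  have h4 := ENNReal.toReal_mono
    (ENNReal.mul_ne_top ENNReal.coe_ne_top ENNReal.ofReal_ne_top) h3
  rw [ENNReal.toReal_mul, ENNReal.coe_toReal, ENNReal.toReal_ofReal (norm_nonneg _)] at h4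
  exact h4

set_option maxHeartbeats 400000 in
-- Any u is a harmonic function, smooth in Ω, plus an element of H¹₀(Ω), which is a limit of test
-- functions.
theorem dense_fst_smoothTraceGraph (hΩ : IsOpen Ω) (hb : Bornology.IsBounded Ω) {D : Set Plane}
    {L : ℝ} {γ : ℝ → Plane} (hγ : IsArclengthParam (frontier D) L γ) (hDΩ : closure D ⊆ Ω)
    (u : H1 Ω) : u ∈ closure (Prod.fst '' (smoothTraceGraph Ω L γ : Set (H1 Ω × L2Curve L))) := by
  have hsm : ∀ (w : H1 Ω) (φ : Plane → ℝ), ContDiffOn ℝ ∞ φ Ω → fn w =ᵐ[volume.restrict Ω] φ →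
      ∃ g, (w, g) ∈ smoothTraceGraph Ω L γ := by
    intro w φ hφ hw
    have hm := memLp_Ioc (L := L) (continuous_comp_curve hγ hDΩ hφ.continuousOn)
    exact ⟨hm.toLp _, φ, hφ, hw, hm.coeFn_toLp⟩
  obtain ⟨v, hv, hort⟩ := exists_dirichlet_solution hΩ hb u
  obtain ⟨h, hh, hvh⟩ := exists_smooth_of_dirichlet hΩ hb hort
  refine mem_closure_fst_of_sub_mem
    (A := {w : H1 Ω | ∃ φ, IsTestFunction Ω φ ∧ fn w =ᵐ[volume.restrict Ω] φ})
    ?_ (hsm v h hh hvh) hv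
  rintro w ⟨φ, hφ, hw⟩
  exact hsm w φ hφ.smooth.contDiffOn hw

set_option maxHeartbeats 400000 in
-- The estimate uses only the outer side of the curve. Consequently the trace vanishes as soon as u
-- vanishes outside D near the curve, whatever u does inside D.
theorem exists_traceMap {D : Set Plane} (hΩ : IsOpen Ω) (hb : Bornology.IsBounded Ω)
    (hD : IsSmoothDomain D) {L : ℝ} {γ : ℝ → Plane} (hγ : IsArclengthParam (frontier D) L γ)
    (hDΩ : closure D ⊆ Ω) :
    ∃ T : H1 Ω →L[ℝ] L2Curve L, (∀ u g, IsCurveTrace L γ u g ↔ g = T u) ∧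
      ∀ N, IsOpen N → frontier D ⊆ N → N ⊆ Ω → ∀ u : H1 Ω,
        (∀ᵐ x ∂(volume.restrict Ω), x ∈ N \ closure D → fn u x = 0) → T u = 0 := by
  obtain ⟨C, hC⟩ := trace_bound_graph hD hγ hΩ hΩ (frontier_subset_closure.trans hDΩ) le_rfl
  have hz : ∀ᵐ x ∂(volume.restrict Ω), x ∈ Ω \ closure D → fn (0 : H1 Ω) x = 0 :=
    fn_zero.mono fun x hx _ => hx
  obtain ⟨T, hT, hT0⟩ := exists_clm_of_graph_closure (G := smoothTraceGraph Ω L γ) (hC 0 hz)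
    (dense_fst_smoothTraceGraph hΩ hb hγ hDΩ)
  refine ⟨T, fun u g => (isCurveTrace_iff hγ hDΩ u g).trans (hT u g), fun N hN hDN hNΩ u hu => ?_⟩
  obtain ⟨C', hC'⟩ := trace_bound_graph hD hγ hΩ hN hDN hNΩ
  exact hT0 u ⟨C', hC' u hu⟩

end AntiplaneShear

namespace AntiplaneShear

open MeasureTheory Filter Topology Set
open scoped ContDiff ENNReal NNReal

/-! ### Coercive problems with two levels of traces -/

section Abstract

variable {H F : Type*} [NormedAddCommGroup H] [InnerProductSpace ℝ H]
  [NormedAddCommGroup F] [InnerProductSpace ℝ F]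

/-- The space of `(u, g₁, g₂)` such that `g₁` is the derivative of the trace `T u` and `g₂` the
derivative of `g₁`, where `W` is the graph of the derivation. -/
noncomputable def energySpace (T : H →L[ℝ] F) (W : Submodule ℝ (F × F)) :
    Submodule ℝ (WithLp 2 (H × WithLp 2 (F × F))) where
  carrier := {e | (T e.fst, e.snd.fst) ∈ W ∧ (e.snd.fst, e.snd.snd) ∈ W}
  zero_mem' := by
    have h : ((0 : F), (0 : F)) ∈ W := W.zero_mem
    constructor
    · simpa using h
    · simpa using h
  add_mem' := by
    rintro p q ⟨h1, h2⟩ ⟨h3, h4⟩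
    constructor
    · simpa using W.add_mem h1 h3
    · simpa using W.add_mem h2 h4
  smul_mem' := by
    rintro c p ⟨h1, h2⟩
    constructor
    · simpa using W.smul_mem c h1
    · simpa using W.smul_mem c h2

noncomputable def pr₀ : WithLp 2 (H × WithLp 2 (F × F)) →L[ℝ] H := WithLp.fstL 2 ℝ H _

noncomputable def pr₁ : WithLp 2 (H × WithLp 2 (F × F)) →L[ℝ] F :=
  (WithLp.fstL 2 ℝ F F).comp (WithLp.sndL 2 ℝ H _)

noncomputable def pr₂ : WithLp 2 (H × WithLp 2 (F × F)) →L[ℝ] F :=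
  (WithLp.sndL 2 ℝ F F).comp (WithLp.sndL 2 ℝ H _)

theorem isClosed_energySpace (T : H →L[ℝ] F) {W : Submodule ℝ (F × F)}
    (hW : IsClosed (W : Set (F × F))) :
    IsClosed (energySpace T W : Set (WithLp 2 (H × WithLp 2 (F × F)))) := by
  have h1 : Continuous fun e : WithLp 2 (H × WithLp 2 (F × F)) => (T (pr₀ e), pr₁ e) := by fun_prop
  have h2 : Continuous fun e : WithLp 2 (H × WithLp 2 (F × F)) =>
    ((pr₁ e : F), (pr₂ e : F)) := by fun_prop
  exact (hW.preimage h1).inter (hW.preimage h2)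

/-- The linear functional `(v, h₁, h₂) ↦ α v + ⟪β₁, h₁⟫ + ⟪β₂, h₂⟫`. -/
noncomputable def energyFunctional (α : H →L[ℝ] ℝ) (β₁ β₂ : F) :
    WithLp 2 (H × WithLp 2 (F × F)) →L[ℝ] ℝ :=
  α.comp (pr₀ (F := F)) + (innerSL ℝ β₁).comp (pr₁ (H := H)) + (innerSL ℝ β₂).comp (pr₂ (H := H))

variable [CompleteSpace H] [CompleteSpace F]

/-- Lax–Milgram on the closed space of triples (u, g₁, g₂). Its norm contains the norms of g₁ and
g₂, so the terms with b and a make the form coercive there. -/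
theorem exists_energy_solution {K : Submodule ℝ H} (hK : IsClosed (K : Set H)) (T : H →L[ℝ] F)
    {W : Submodule ℝ (F × F)} (hW : IsClosed (W : Set (F × F))) (A : H →L[ℝ] H →L[ℝ] ℝ)
    {c b a : ℝ} (hc : 0 < c) (hA : ∀ u ∈ K, c * ‖u‖ ^ 2 ≤ A u u) (hb : 0 < b) (ha : 0 < a)
    (α : H →L[ℝ] ℝ) (β₁ β₂ : F) :
    ∃ u ∈ K, ∃ g₁ g₂, (T u, g₁) ∈ W ∧ (g₁, g₂) ∈ W ∧
      ∀ v ∈ K, ∀ h₁ h₂, (T v, h₁) ∈ W → (h₁, h₂) ∈ W →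
        A u v + b * inner ℝ g₁ h₁ + a * inner ℝ g₂ h₂
          = α v + inner ℝ β₁ h₁ + inner ℝ β₂ h₂ := by
  let X := WithLp 2 (H × WithLp 2 (F × F))
  let V : Submodule ℝ X := energySpace T W ⊓ K.comap (pr₀ : X →L[ℝ] H).toLinearMap
  have hV : IsClosed (V : Set X) :=
    (isClosed_energySpace T hW).inter (hK.preimage (pr₀ : X →L[ℝ] H).continuous)
  let B : X →L[ℝ] X →L[ℝ] ℝ := A.bilinearComp pr₀ pr₀ + b • (innerSL ℝ).bilinearComp pr₁ pr₁
    + a • (innerSL ℝ).bilinearComp pr₂ pr₂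
  have hBe : ∀ e e' : X, B e e' = A e.fst e'.fst + b * inner ℝ e.snd.fst e'.snd.fst
    + a * inner ℝ e.snd.snd e'.snd.snd := fun _ _ => rfl
  obtain ⟨e, he, hsol⟩ := exists_of_coercive_on hV.isComplete B
    (c := min c (min b a)) (lt_min hc (lt_min hb ha)) (fun e he => by
      rw [hBe, real_inner_self_eq_norm_sq, real_inner_self_eq_norm_sq, WithLp.prod_norm_sq_eq_of_L2,
        WithLp.prod_norm_sq_eq_of_L2]
      have h1 := hA e.fst he.2
      have h2 : min c (min b a) * ‖e.fst‖ ^ 2 ≤ c * ‖e.fst‖ ^ 2 := by gcongr; exact min_le_left _ _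
      have h3 : min c (min b a) * ‖e.snd.fst‖ ^ 2 ≤ b * ‖e.snd.fst‖ ^ 2 := by
        gcongr; exact (min_le_right _ _).trans (min_le_left _ _)
      have h4 : min c (min b a) * ‖e.snd.snd‖ ^ 2 ≤ a * ‖e.snd.snd‖ ^ 2 := by
        gcongr; exact (min_le_right _ _).trans (min_le_right _ _)
      linarith) (energyFunctional α β₁ β₂)
  refine ⟨e.fst, he.2, e.snd.fst, e.snd.snd, he.1.1, he.1.2, fun v hv h₁ h₂ w1 w2 => ?_⟩
  exact hsol (WithLp.toLp 2 (v, WithLp.toLp 2 (h₁, h₂))) ⟨⟨w1, w2⟩, hv⟩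

/-- A functional on the energy space that vanishes on the elements with vanishing outer trace
factors through the trace space. -/
theorem exists_flux {K : Submodule ℝ H} (hK : IsClosed (K : Set H)) (T : H →L[ℝ] F)
    {W : Submodule ℝ (F × F)} (hW : IsClosed (W : Set (F × F)))
    (hs : ∀ u, ∃ v g₁ g₂, v - u ∈ K ∧ (T v, g₁) ∈ W ∧ (g₁, g₂) ∈ W)
    (α : H →L[ℝ] ℝ) (β₁ β₂ : F)
    (h0 : ∀ v ∈ K, ∀ h₁ h₂, (T v, h₁) ∈ W → (h₁, h₂) ∈ W →
      α v + inner ℝ β₁ h₁ + inner ℝ β₂ h₂ = 0) :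
    ∃ ξ : StrongDual ℝ (H ⧸ K), ∀ v h₁ h₂, (T v, h₁) ∈ W → (h₁, h₂) ∈ W →
      ξ (K.mkQ v) = α v + inner ℝ β₁ h₁ + inner ℝ β₂ h₂ := by
  have : IsClosed (K : Set H) := hK
  let E := energySpace T W
  have : CompleteSpace E := (isClosed_energySpace T hW).completeSpace_coe
  let q : E →L[ℝ] H ⧸ K := K.mkQL.comp (pr₀.comp E.subtypeL)
  have hq : Function.Surjective q := by
    intro y
    obtain ⟨u, rfl⟩ := K.mkQ_surjective y
    obtain ⟨v, g₁, g₂, h1, h2, h3⟩ := hs u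
    exact ⟨⟨WithLp.toLp 2 (v, WithLp.toLp 2 (g₁, g₂)), h2, h3⟩, (Submodule.Quotient.eq K).2 h1⟩
  let f : E →L[ℝ] ℝ := (energyFunctional α β₁ β₂).comp E.subtypeL
  have hf : ∀ e, q e = 0 → f e = 0 := fun e he =>
    h0 _ ((Submodule.Quotient.mk_eq_zero K).1 he) _ _ e.2.1 e.2.2
  have hf' : ∀ e e', q e = q e' → f e = f e' := fun e e' h => by
    rw [← sub_eq_zero, ← map_sub]
    exact hf _ (by rw [map_sub, h, sub_self])
  -- The open mapping theorem gives preimages of controlled norm. Their choice need not be linear,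
  -- because f depends only on the class; this yields both the linearity and the boundedness of ξ.
  obtain ⟨C, hC, hpre⟩ := q.exists_preimage_norm_le hq
  choose r hr hrn using hpre
  let ξ₀ : (H ⧸ K) →ₗ[ℝ] ℝ :=
    { toFun := fun y => f (r y)
      map_add' := fun y z => by
        rw [← map_add]; exact hf' _ _ (by rw [map_add, hr, hr, hr])
      map_smul' := fun t y => by
        rw [RingHom.id_apply, ← map_smul]; exact hf' _ _ (by rw [map_smul, hr, hr]) }
  refine ⟨ξ₀.mkContinuous (‖f‖ * C) fun y => ?_, fun v h₁ h₂ w1 w2 => ?_⟩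
  · calc ‖f (r y)‖ ≤ ‖f‖ * ‖r y‖ := f.le_opNorm _
      _ ≤ ‖f‖ * (C * ‖y‖) := by gcongr; exact hrn y
      _ = ‖f‖ * C * ‖y‖ := by ring
  · exact hf' _ ⟨WithLp.toLp 2 (v, WithLp.toLp 2 (h₁, h₂)), w1, w2⟩ (hr _)

end Abstract

/-! ### Derivatives along the curve -/

theorem inner_toLp_curve {L : ℝ} {f : ℝ → ℝ} (hf : MemLp f 2 (volume.restrict (Ioc 0 L)))
    (g : L2Curve L) : inner ℝ (hf.toLp f) g = ∫ s in Ioc 0 L, g s * f s := by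
  rw [inner_toLp_left]
  rfl

theorem isWeakDerivCurve_iff {L : ℝ} (g g' : L2Curve L) : IsWeakDerivCurve L g g' ↔
    ∀ (η : ℝ → ℝ) (h : ContDiff ℝ ∞ η), Function.Periodic η L →
      inner ℝ ((memLp_Ioc (h.continuous_deriv (by simp))).toLp (deriv η)) g
        + inner ℝ ((memLp_Ioc h.continuous).toLp η) g' = 0 := by
  refine forall_congr' fun η => forall_congr' fun h => forall_congr' fun _ => ?_
  rw [inner_toLp_curve, inner_toLp_curve, add_eq_zero_iff_eq_neg]

/-- The graph of the weak derivative along a closed curve of length `L`. -/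
noncomputable def weakDerivGraph (L : ℝ) : Submodule ℝ (L2Curve L × L2Curve L) where
  carrier := {p | IsWeakDerivCurve L p.1 p.2}
  zero_mem' := (isWeakDerivCurve_iff _ _).2 fun η h _ => by simp
  add_mem' := by
    intro p q hp hq
    refine (isWeakDerivCurve_iff _ _).2 fun η h hη => ?_
    have h1 := (isWeakDerivCurve_iff _ _).1 hp η h hη
    have h2 := (isWeakDerivCurve_iff _ _).1 hq η h hη
    rw [Prod.fst_add, Prod.snd_add, inner_add_right, inner_add_right]
    linarith
  smul_mem' := by
    intro c p hp
    refine (isWeakDerivCurve_iff _ _).2 fun η h hη => ?_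
    have h1 := (isWeakDerivCurve_iff _ _).1 hp η h hη
    rw [Prod.smul_fst, Prod.smul_snd, real_inner_smul_right, real_inner_smul_right, ← mul_add, h1,
      mul_zero]

theorem isClosed_weakDerivGraph (L : ℝ) :
    IsClosed (weakDerivGraph L : Set (L2Curve L × L2Curve L)) := by
  have : (weakDerivGraph L : Set (L2Curve L × L2Curve L)) = ⋂ (η : ℝ → ℝ) (h : ContDiff ℝ ∞ η)
      (_ : Function.Periodic η L), {p | inner ℝ ((memLp_Ioc (h.continuous_deriv (by simp))).toLp
        (deriv η)) p.1 + inner ℝ ((memLp_Ioc h.continuous).toLp η) p.2 = 0} := by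
    ext p
    simp only [mem_iInter]
    exact isWeakDerivCurve_iff _ _
  rw [this]
  exact isClosed_iInter fun η => isClosed_iInter fun h => isClosed_iInter fun _ =>
    isClosed_eq ((continuous_const.inner continuous_fst).add
      (continuous_const.inner continuous_snd)) continuous_const

theorem isWeakDerivCurve_of_periodic {L : ℝ} (hL : 0 < L) {k : ℝ → ℝ} (hk : ContDiff ℝ ∞ k)
    (hp : Function.Periodic k L) :
    IsWeakDerivCurve L ((memLp_Ioc hk.continuous).toLp k)
      ((memLp_Ioc (hk.continuous_deriv (by simp))).toLp (deriv k)) := by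
  intro η hη hηp
  have e1 : ∫ s in Ioc 0 L, ((memLp_Ioc hk.continuous).toLp k : L2Curve L) s * deriv η s
      = ∫ s in Ioc 0 L, k s * deriv η s := by
    refine integral_congr_ae ?_
    filter_upwards [(memLp_Ioc hk.continuous).coeFn_toLp] with s hs
    rw [hs]
  have e2 : ∫ s in Ioc 0 L,
      ((memLp_Ioc (hk.continuous_deriv (by simp))).toLp (deriv k) : L2Curve L) s * η s
      = ∫ s in Ioc 0 L, deriv k s * η s := by
    refine integral_congr_ae ?_
    filter_upwards [(memLp_Ioc (hk.continuous_deriv (by simp))).coeFn_toLp] with s hs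
    rw [hs]
  rw [e1, e2, ← intervalIntegral.integral_of_le hL.le, ← intervalIntegral.integral_of_le hL.le,
    intervalIntegral.integral_mul_deriv_eq_deriv_mul
      (fun s _ => (hk.differentiable (by simp) s).hasDerivAt)
      (fun s _ => (hη.differentiable (by simp) s).hasDerivAt)
      (hk.continuous_deriv (by simp)).continuousOn.intervalIntegrable
      (hη.continuous_deriv (by simp)).continuousOn.intervalIntegrable]
  have h1 : k L = k 0 := by simpa using hp 0
  have h2 : η L = η 0 := by simpa using hηp 0
  rw [h1, h2, sub_self, zero_sub]

theorem periodic_deriv {L : ℝ} {k : ℝ → ℝ} (hp : Function.Periodic k L) :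
    Function.Periodic (deriv k) L := fun s => by
  rw [← deriv_comp_add_const]
  exact congrArg (fun f => deriv f s) (funext hp)

theorem contDiff_comp_curve {Ω D : Set Plane} {L : ℝ} {γ : ℝ → Plane} (hΩ : IsOpen Ω)
    (hγ : IsArclengthParam (frontier D) L γ) (hDΩ : closure D ⊆ Ω) {φ : Plane → ℝ}
    (hφ : ContDiffOn ℝ ∞ φ Ω) : ContDiff ℝ ∞ fun s => φ (γ s) :=
  contDiff_iff_contDiffAt.2 fun s => (hφ.contDiffAt (hΩ.mem_nhds
    (hDΩ (frontier_subset_closure (hγ.range_eq ▸ mem_range_self s))))).comp s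
      hγ.smooth.contDiffAt

theorem contDiff_deriv {k : ℝ → ℝ} (hk : ContDiff ℝ ∞ k) : ContDiff ℝ ∞ (deriv k) :=
  (contDiff_infty_iff_deriv.1 hk).2

variable {Ω : Set Plane}

theorem hasH2Trace_of_smooth {D : Set Plane} {L : ℝ} {γ : ℝ → Plane} (hΩ : IsOpen Ω)
    (hγ : IsArclengthParam (frontier D) L γ) (hDΩ : closure D ⊆ Ω) {φ : Plane → ℝ}
    (hφ : ContDiffOn ℝ ∞ φ Ω) {u : H1 Ω} (hu : fn u =ᵐ[volume.restrict Ω] φ) :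
    have hk := contDiff_deriv (contDiff_comp_curve hΩ hγ hDΩ hφ)
    HasH2Trace L γ u ((memLp_Ioc hk.continuous).toLp _)
      ((memLp_Ioc (contDiff_deriv hk).continuous).toLp _) := by
  intro hk
  have hk0 := contDiff_comp_curve hΩ hγ hDΩ hφ
  have hp : Function.Periodic (fun s => φ (γ s)) L := fun s =>
    congrArg φ (hγ.periodic s)
  refine ⟨(memLp_Ioc hk0.continuous).toLp _, ?_,
    isWeakDerivCurve_of_periodic hγ.length_pos hk0 hp,
    isWeakDerivCurve_of_periodic hγ.length_pos hk (periodic_deriv hp)⟩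
  refine ⟨fun _ => u, fun _ => φ, fun _ => ⟨hφ, hu⟩, tendsto_const_nhds, ?_⟩
  have : eLpNorm (fun s => φ (γ s) - ((memLp_Ioc hk0.continuous).toLp _ : L2Curve L) s) 2
      (volume.restrict (Ioc 0 L)) = 0 := by
    rw [eLpNorm_congr_ae (g := fun _ => 0)]
    · exact eLpNorm_zero'
    · filter_upwards [(memLp_Ioc (L := L) hk0.continuous).coeFn_toLp] with s hs
      rw [hs, sub_self]
  simp only [this]
  exact tendsto_const_nhds

/-! ### The Dirichlet form -/

/-- The Dirichlet form `∫_s ∇u · ∇v` of a subset `s` of `Ω`. -/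
noncomputable def dirichlet (s : Set Plane) (u v : H1 Ω) : ℝ :=
  ∫ x in s, inner ℝ (grad u x) (grad v x)

theorem exists_dirichlet_clm {s : Set Plane} (hs : s ⊆ Ω) :
    ∃ A : H1 Ω →L[ℝ] H1 Ω →L[ℝ] ℝ, ∀ u v, A u v = dirichlet s u v := by
  refine ⟨(innerSL ℝ).bilinearComp
    ((LpToLpRestrictCLM Plane Plane ℝ (volume.restrict Ω) 2 s).comp (gradL Ω))
    ((LpToLpRestrictCLM Plane Plane ℝ (volume.restrict Ω) 2 s).comp (gradL Ω)), fun u v => ?_⟩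
  change inner ℝ (LpToLpRestrictCLM Plane Plane ℝ (volume.restrict Ω) 2 s (grad u))
    (LpToLpRestrictCLM Plane Plane ℝ (volume.restrict Ω) 2 s (grad v)) = _
  rw [L2.inner_def, dirichlet, ← Measure.restrict_restrict_of_subset (μ := volume) hs]
  refine integral_congr_ae ?_
  filter_upwards [LpToLpRestrictCLM_coeFn ℝ s (grad u), LpToLpRestrictCLM_coeFn ℝ s (grad v)]
    with x h1 h2
  rw [h1, h2]

theorem dirichlet_comm (s : Set Plane) (u v : H1 Ω) : dirichlet s u v = dirichlet s v u := by
  simp only [dirichlet, real_inner_comm]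

theorem dirichlet_self_nonneg (s : Set Plane) (u : H1 Ω) : 0 ≤ dirichlet s u u :=
  integral_nonneg fun _ => real_inner_self_nonneg

theorem integrable_inner_grad (u v : H1 Ω) :
    Integrable (fun x => inner ℝ (grad u x) (grad v x)) (volume.restrict Ω) :=
  L2.integrable_inner (grad u) (grad v)

theorem dirichlet_add {D : Set Plane} (hD : MeasurableSet D) (hDΩ : D ⊆ Ω) (u v : H1 Ω) :
    dirichlet (Ω \ D) u v + dirichlet D u v = inner ℝ (grad u) (grad v) := by
  rw [L2.inner_def, add_comm]
  have hi : IntegrableOn (fun x => inner ℝ (grad u x) (grad v x)) Ω := integrable_inner_grad u v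
  have := integral_inter_add_sdiff (s := Ω) hD hi
  rwa [inter_eq_right.2 hDΩ] at this

theorem dirichlet_eq_zero (s : Set Plane) {u : H1 Ω} (v : H1 Ω)
    (h : ∀ᵐ x ∂(volume.restrict s), grad u x = 0) : dirichlet s u v = 0 := by
  refine integral_eq_zero_of_ae ?_
  filter_upwards [h] with x hx
  rw [hx, inner_zero_left]
  rfl

theorem dirichlet_def (s : Set Plane) (u v : H1 Ω) :
    dirichlet s u v = ∫ x in s, inner ℝ (grad u x) (grad v x) := rfl

attribute [irreducible] dirichlet

end AntiplaneShear

namespace AntiplaneShear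

open MeasureTheory Filter Topology Set
open scoped ContDiff ENNReal NNReal

/-! ### Solvability with flux, and the duality argument in abstract form -/

section Abstract

variable {H F : Type*} [NormedAddCommGroup H] [InnerProductSpace ℝ H] [CompleteSpace H]
  [NormedAddCommGroup F] [InnerProductSpace ℝ F] [CompleteSpace F]

/-- Well-posedness of the inhomogeneous problem, together with its flux. -/
theorem exists_solution_flux {K : Submodule ℝ H} (hK : IsClosed (K : Set H)) (T : H →L[ℝ] F)
    {W : Submodule ℝ (F × F)} (hW : IsClosed (W : Set (F × F))) (α : H → H → ℝ)
    (hα : ∃ A : H →L[ℝ] H →L[ℝ] ℝ, ∀ u v, A u v = α u v) {c b a : ℝ} (hc : 0 < c) (hA : ∀ u ∈ K, c * ‖u‖ ^ 2 ≤ α u u) (hb : 0 < b) (ha : 0 < a)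
    (hs : ∀ u, ∃ v g₁ g₂, v - u ∈ K ∧ (T v, g₁) ∈ W ∧ (g₁, g₂) ∈ W) (u₀ : H) :
    ∃ u g₁ g₂, u - u₀ ∈ K ∧ (T u, g₁) ∈ W ∧ (g₁, g₂) ∈ W ∧
      (∀ v ∈ K, ∀ h₁ h₂, (T v, h₁) ∈ W → (h₁, h₂) ∈ W →
        α u v + b * inner ℝ g₁ h₁ + a * inner ℝ g₂ h₂ = 0) ∧
      ∃ ξ : StrongDual ℝ (H ⧸ K), ∀ v h₁ h₂, (T v, h₁) ∈ W → (h₁, h₂) ∈ W →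
        ξ (K.mkQ v) = α u v + b * inner ℝ g₁ h₁ + a * inner ℝ g₂ h₂ := by
  obtain ⟨A, hA'⟩ := hα
  obtain rfl : (fun u v => A u v) = α := funext₂ hA'
  obtain ⟨v₀, k₁, k₂, h1, h2, h3⟩ := hs u₀
  -- The data are lifted by v₀, and the correction w ∈ K solves the problem whose right-hand side is
  -- minus the form at v₀.
  obtain ⟨w, hw, l₁, l₂, h4, h5, h6⟩ := exists_energy_solution hK T hW A hc hA hb ha
    (-A v₀) (-b • k₁) (-a • k₂)
  have hsol : ∀ v ∈ K, ∀ h₁ h₂, (T v, h₁) ∈ W → (h₁, h₂) ∈ W →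
      A (v₀ + w) v + b * inner ℝ (k₁ + l₁) h₁ + a * inner ℝ (k₂ + l₂) h₂ = 0 := by
    intro v hv h₁ h₂ w1 w2
    have := h6 v hv h₁ h₂ w1 w2
    rw [real_inner_smul_left, real_inner_smul_left, neg_apply] at this
    rw [map_add, add_apply, inner_add_left, inner_add_left]
    linarith
  refine ⟨v₀ + w, k₁ + l₁, k₂ + l₂, ?_, ?_, W.add_mem h3 h5, hsol, ?_⟩
  · rw [add_sub_right_comm]
    exact K.add_mem h1 hw
  · rw [map_add]
    exact W.add_mem h2 h4
  · obtain ⟨ξ, hξ⟩ := exists_flux hK T hW hs (A (v₀ + w)) (b • (k₁ + l₁)) (a • (k₂ + l₂))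
      (fun v hv h₁ h₂ w1 w2 => by
        rw [real_inner_smul_left, real_inner_smul_left]
        exact hsol v hv h₁ h₂ w1 w2)
    refine ⟨ξ, fun v h₁ h₂ w1 w2 => ?_⟩
    rw [hξ v h₁ h₂ w1 w2, real_inner_smul_left, real_inner_smul_left]

/-- The orthogonality relation between the difference of two energy forms with the same flux map
and a test triple `(φ, φ₁, φ₂)`, by a duality argument of Runge type. Here `N` stands for the
functions vanishing near the inclusion, `α₀` and `α₁` for the outer and inner Dirichlet forms. -/
theorem energy_difference_eq_zero {K : Submodule ℝ H} (hK : IsClosed (K : Set H)) (T : H →L[ℝ] F)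
    {W : Submodule ℝ (F × F)} (hW : IsClosed (W : Set (F × F))) (α₀ α₁ : H → H → ℝ)
    (hα₀ : ∃ A : H →L[ℝ] H →L[ℝ] ℝ, ∀ u v, A u v = α₀ u v)
    (hα₁ : ∃ A : H →L[ℝ] H →L[ℝ] ℝ, ∀ u v, A u v = α₁ u v)
    (hs₀ : ∀ u v, α₀ u v = α₀ v u) (hs₁ : ∀ u v, α₁ u v = α₁ v u)
    {c μ b a μ' b' a' : ℝ} (hc : 0 < c) (hA : ∀ u ∈ K, c * ‖u‖ ^ 2 ≤ α₀ u u + μ * α₁ u u)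
    (hμ : 0 < μ) (hb : 0 < b) (ha : 0 < a) (hμ' : 0 < μ')
    (N : Set H) (hNT : ∀ v ∈ N, T v = 0) (hNA : ∀ v ∈ N, ∀ u, α₁ u v = 0)
    {φ : H} (hφK : φ ∈ K) {φ₁ φ₂ φ₄ : F} (hφ1 : (T φ, φ₁) ∈ W) (hφ2 : (φ₁, φ₂) ∈ W)
    (hφ : ∀ u g₁ g₂, (T u, g₁) ∈ W → (g₁, g₂) ∈ W →
      inner ℝ g₁ φ₁ = -inner ℝ (T u) φ₂ ∧ inner ℝ g₂ φ₂ = inner ℝ (T u) φ₄)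
    (hU : ∀ w ∈ K, (∀ v ∈ N, α₀ w v = 0) → T w = 0 ∧ (∀ v, α₀ w v = 0) ∧ α₁ w φ = 0)
    (hflux : ∀ v ∈ N, ∃ u g₁ g₂ u' g₁' g₂',
      u - v ∈ K ∧ (T u, g₁) ∈ W ∧ (g₁, g₂) ∈ W ∧
      u' - v ∈ K ∧ (T u', g₁') ∈ W ∧ (g₁', g₂') ∈ W ∧
      (∀ v ∈ K, ∀ h₁ h₂, (T v, h₁) ∈ W → (h₁, h₂) ∈ W →
        α₀ u v + μ * α₁ u v + b * inner ℝ g₁ h₁ + a * inner ℝ g₂ h₂ = 0) ∧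
      (∀ v ∈ K, ∀ h₁ h₂, (T v, h₁) ∈ W → (h₁, h₂) ∈ W →
        α₀ u' v + μ' * α₁ u' v + b' * inner ℝ g₁' h₁ + a' * inner ℝ g₂' h₂ = 0) ∧
      ∀ v ∈ N, α₀ u v = α₀ u' v) :
    (μ - μ') * α₁ φ φ + (b - b') * inner ℝ φ₁ φ₁ + (a - a') * inner ℝ φ₂ φ₂ = 0 := by
  obtain ⟨A₀, hA₀⟩ := hα₀
  obtain rfl : (fun u v => A₀ u v) = α₀ := funext₂ hA₀
  obtain ⟨A₁, hA₁⟩ := hα₁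
  obtain rfl : (fun u v => A₁ u v) = α₁ := funext₂ hA₁
  beta_reduce at *
  have hW0 : ((0 : F), (0 : F)) ∈ W := W.zero_mem
  -- The two solutions with boundary data v are the same function, and it is annihilated by the
  -- functional built from φ and the parameter differences.
  have key : ∀ v ∈ N, ∃ u g₁ g₂, u - v ∈ K ∧ (T u, g₁) ∈ W ∧ (g₁, g₂) ∈ W ∧
      (∀ v ∈ K, ∀ h₁ h₂, (T v, h₁) ∈ W → (h₁, h₂) ∈ W →
        A₀ u v + μ * A₁ u v + b * inner ℝ g₁ h₁ + a * inner ℝ g₂ h₂ = 0) ∧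
      (μ - μ') * A₁ φ u + (b - b') * inner ℝ φ₁ g₁ + (a - a') * inner ℝ φ₂ g₂ = 0 := by
    intro v hv
    obtain ⟨u, g₁, g₂, u', g₁', g₂', h1, h2, h3, h4, h5, h6, h7, h8, h9⟩ := hflux v hv
    have hwK : u - u' ∈ K := by
      have := K.sub_mem h1 h4
      rwa [sub_sub_sub_cancel_right] at this
    obtain ⟨hT, h10, -⟩ := hU _ hwK fun v hv => by
      rw [map_sub, sub_apply, h9 v hv, sub_self]
    -- The difference u - u' has zero trace and zero outer form, so testing both equations with it
    -- leaves only the inner forms: they vanish at u - u', and coercivity gives u = u'.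
    have e1 := h7 _ hwK 0 0 (by rwa [hT]) hW0
    have e2 := h8 _ hwK 0 0 (by rwa [hT]) hW0
    simp only [inner_zero_right, mul_zero, add_zero] at e1 e2
    rw [hs₀, h10, zero_add] at e1 e2
    have e3 : A₁ (u - u') (u - u') = 0 := by
      rw [map_sub A₁, sub_apply, (mul_eq_zero_iff_left hμ.ne').1 e1,
        (mul_eq_zero_iff_left hμ'.ne').1 e2, sub_self]
    have e4 := hA _ hwK
    rw [h10, e3, mul_zero, add_zero] at e4
    have e5 : ‖u - u'‖ ^ 2 ≤ 0 := by
      by_contra! h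
      nlinarith
    have e6 : u = u' := by
      rw [← sub_eq_zero, ← norm_eq_zero]
      exact pow_eq_zero_iff (two_ne_zero) |>.1 (le_antisymm e5 (sq_nonneg _))
    subst e6
    refine ⟨u, g₁, g₂, h1, h2, h3, h7, ?_⟩
    have f1 := h7 φ hφK φ₁ φ₂ hφ1 hφ2
    have f2 := h8 φ hφK φ₁ φ₂ hφ1 hφ2
    -- With the derivatives moved onto φ, both equations involve only T u, and the outer forms
    -- cancel upon subtraction.
    rw [(hφ _ _ _ h2 h3).1, (hφ _ _ _ h2 h3).2] at f1
    rw [(hφ _ _ _ h5 h6).1, (hφ _ _ _ h5 h6).2] at f2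
    rw [real_inner_comm g₁, real_inner_comm g₂, (hφ _ _ _ h2 h3).1, (hφ _ _ _ h2 h3).2, hs₁ φ u]
    linarith
  -- The adjoint state: the solution in K whose right-hand side is the functional that annihilates
  -- all solutions.
  obtain ⟨w, hw, l₁, l₂, hl1, hl2, hsol⟩ := exists_energy_solution hK T hW (A₀ + μ • A₁) hc
    hA hb ha ((μ - μ') • A₁ φ) ((b - b') • φ₁) ((a - a') • φ₂)
  have hsol' : ∀ v ∈ K, ∀ h₁ h₂, (T v, h₁) ∈ W → (h₁, h₂) ∈ W →
      A₀ w v + μ * A₁ w v + b * inner ℝ l₁ h₁ + a * inner ℝ l₂ h₂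
        = (μ - μ') * A₁ φ v + (b - b') * inner ℝ φ₁ h₁ + (a - a') * inner ℝ φ₂ h₂ := by
    intro v hv h₁ h₂ w1 w2
    have := hsol v hv h₁ h₂ w1 w2
    rw [real_inner_smul_left, real_inner_smul_left] at this
    exact this
  obtain ⟨hTw, hw0, hwφ⟩ := hU w hw fun v hv => by
    obtain ⟨u, g₁, g₂, h1, h2, h3, h4, h5⟩ := key v hv
    -- The equation of w is tested with u - v ∈ K and the equation of u with w ∈ K. As v is
    -- invisible near the inclusion, symmetry leaves only A₀ w v = 0.
    have e1 := hsol' _ h1 g₁ g₂ (by rwa [map_sub, hNT v hv, sub_zero]) h3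
    have e2 := h4 w hw l₁ l₂ hl1 hl2
    rw [map_sub, map_sub, map_sub, hNA v hv, hNA v hv, hs₀ w u, hs₁ w u, real_inner_comm g₁,
      real_inner_comm g₂, sub_zero, sub_zero] at e1
    linarith
  -- Every term on the left is now zero: the outer form, the inner form against φ, and the curve
  -- terms, which depend on w only through T w = 0.
  have e := hsol' φ hφK φ₁ φ₂ hφ1 hφ2
  rw [(hφ _ _ _ hl1 hl2).1, (hφ _ _ _ hl1 hl2).2, hTw, inner_zero_left, inner_zero_left, hw0,
    hwφ] at e
  linarith

end Abstract

end AntiplaneShear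

namespace AntiplaneShear

open MeasureTheory Filter Topology Set
open scoped ContDiff ENNReal NNReal

variable {Ω : Set Plane}

/-! ### Unique continuation -/

/-- The functions in `H¹(Ω)` that vanish near `closure D`. -/
def vanishingNear (Ω D : Set Plane) : Set (H1 Ω) :=
  {φ | ∃ V : Set Plane, IsOpen V ∧ closure D ⊆ V ∧ ∀ᵐ x ∂(volume.restrict Ω), x ∈ V → fn φ x = 0}

theorem dirichlet_of_mem_vanishingNear {D : Set Plane} (hΩ : IsOpen Ω) (hD : IsOpen D)
    (hDΩ : D ⊆ Ω) {v : H1 Ω} (hv : v ∈ vanishingNear Ω D) (u : H1 Ω) :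
    dirichlet D u v = 0 := by
  obtain ⟨V, hV, hDV, h⟩ := hv
  rw [dirichlet_comm]
  refine dirichlet_eq_zero D u ?_
  have h1 := grad_eq_zero_of_fn_eq_zero hΩ hD hDΩ v
    (h.mono fun x hx hxD => hx (hDV (subset_closure hxD)))
  filter_upwards [ae_restrict_of_ae_restrict_of_subset hDΩ h1,
    ae_restrict_mem hD.measurableSet] with x hx hxD
  exact hx hxD

theorem ofSmooth_mem_vanishingNear {D : Set Plane} {ψ : Plane → ℝ}
    (hψ : IsTestFunction (closure D)ᶜ ψ) :
    ofSmooth Ω ψ hψ.smooth hψ.compact ∈ vanishingNear Ω D := by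
  refine ⟨(tsupport ψ)ᶜ, (isClosed_tsupport ψ).isOpen_compl,
    fun x hx h => hψ.supp h hx, ?_⟩
  filter_upwards [fn_ofSmooth (Ω := Ω) hψ.smooth hψ.compact] with x hx hxV
  rw [hx, image_eq_zero_of_notMem_tsupport hxV]

/-- The support of ψ may cross ∂Ω: the vanishing boundary values of w remove the boundary term. This
is what lets the zero extension be harmonic across ∂Ω. -/
theorem integral_fn_mul_lap_of_mem_H10 (hΩ : IsOpen Ω) {w : H1 Ω} (hw : w ∈ H10 Ω)
    {ψ : Plane → ℝ} (hψ : ContDiff ℝ ∞ ψ) (hc : HasCompactSupport ψ) :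
    ∫ x in Ω, fn w x * lap ψ x = -inner ℝ (grad w) (grad (ofSmooth Ω ψ hψ hc)) :=
  integral_fn_mul_lap w hψ hc fun i =>
    integral_fn_mul_fderiv_of_mem_H10 hΩ hw (contDiff_pd hψ i) (hasCompactSupport_pd hc i) i

/-- Unique continuation from the outer boundary: a function in `H¹₀(Ω)` that is harmonic outside
`D` and has vanishing flux through `∂Ω` vanishes outside `D`. -/
theorem fn_eq_zero_of_flux_eq_zero {D : Set Plane} (hΩ : IsOpen Ω) (hb : Bornology.IsBounded Ω)
    (hD : IsSmoothDomain D) {L : ℝ} {γ : ℝ → Plane} (hγ : IsArclengthParam (frontier D) L γ)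
    (hDΩ : closure D ⊆ Ω) {w : H1 Ω} (hw : w ∈ H10 Ω)
    (h : ∀ v ∈ vanishingNear Ω D, dirichlet (Ω \ D) w v = 0) :
    ∀ᵐ x ∂(volume.restrict Ω), x ∈ Ω \ closure D → fn w x = 0 := by
  have hU : IsOpen (closure D)ᶜ := isClosed_closure.isOpen_compl
  have hDo := subset_closure.trans hDΩ
  -- A test function of the exterior restricts to an element vanishing near `closure D`, so the
  -- absence of flux applies to it even when it is nonzero on ∂Ω.
  have hwh : IsWeaklyHarmonic (closure D)ᶜ (ext0 w) := by
    intro ψ hψ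
    have hN := ofSmooth_mem_vanishingNear (Ω := Ω) hψ
    have e := dirichlet_add hD.isOpen.measurableSet hDo w
      (ofSmooth Ω ψ hψ.smooth hψ.compact)
    rw [h _ hN, dirichlet_of_mem_vanishingNear hΩ hD.isOpen hDo hN, add_zero] at e
    rw [integral_ext0_mul hΩ, integral_fn_mul_lap_of_mem_H10 hΩ hw hψ.smooth hψ.compact, ← e,
      neg_zero]
  obtain ⟨k, hk, hlap, hae⟩ := hwh.exists_harmonic hU (integrable_ext0 hΩ hb w)
  have han := analyticOnNhd_of_lap_eq_zero hU hk hlap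
  obtain ⟨R, hR⟩ := hb.subset_closedBall 0
  have hO : IsOpen (Metric.closedBall (0 : Plane) R)ᶜ := Metric.isClosed_closedBall.isOpen_compl
  have hOΩ : ∀ x ∈ (Metric.closedBall (0 : Plane) R)ᶜ, x ∉ Ω := fun x hx hxΩ => hx (hR hxΩ)
  have hOU : (Metric.closedBall (0 : Plane) R)ᶜ ⊆ (closure D)ᶜ := fun x hx hxD =>
    hOΩ x hx (hDΩ hxD)
  -- Outside a large ball the zero extension vanishes, and almost everywhere equality of continuous
  -- functions is equality on an open set.
  have hk0 : EqOn k 0 (Metric.closedBall (0 : Plane) R)ᶜ := by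
    refine Measure.eqOn_open_of_ae_eq (μ := volume) ?_ hO (hk.continuousOn.mono hOU)
      continuousOn_const
    filter_upwards [ae_restrict_of_ae hae, ae_restrict_mem hO.measurableSet] with x hx hxO
    rw [← hx (hOU hxO), ext0, indicator_of_notMem (hOΩ x hxO)]
    rfl
  obtain ⟨x₀, hx₀⟩ : (Metric.closedBall (0 : Plane) R)ᶜ.Nonempty := by
    obtain ⟨x, hx⟩ := NormedSpace.exists_lt_norm ℝ Plane R
    exact ⟨x, by simpa using hx⟩
  have hall := han.eqOn_zero_of_preconnected_of_eventuallyEq_zero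
    (hD.isPreconnected_exterior hγ) (hOU hx₀)
    (Filter.eventually_of_mem (hO.mem_nhds hx₀) hk0)
  filter_upwards [ae_restrict_of_ae hae] with x hx hxD
  have := hx hxD.2
  rw [hall hxD.2, ext0, indicator_of_mem hxD.1] at this
  exact this

/-- The passage from Ω \ `closure D` to Ω \ D costs only the boundary curve, a null set. -/
theorem grad_eq_zero_of_fn_eq_zero_outside {D : Set Plane} (hΩ : IsOpen Ω) (hD : IsOpen D)
    {L : ℝ} {γ : ℝ → Plane} (hγ : IsArclengthParam (frontier D) L γ) {w : H1 Ω}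
    (h : ∀ᵐ x ∂(volume.restrict Ω), x ∈ Ω \ closure D → fn w x = 0) :
    ∀ᵐ x ∂(volume.restrict (Ω \ D)), grad w x = 0 := by
  have h1 := grad_eq_zero_of_fn_eq_zero hΩ (hΩ.sdiff isClosed_closure) sdiff_subset w h
  have h2 : ∀ᵐ x ∂(volume : Measure Plane), x ∉ frontier D :=
    measure_eq_zero_iff_ae_notMem.1 hγ.volume_eq_zero
  filter_upwards [ae_restrict_of_ae_restrict_of_subset sdiff_subset h1, ae_restrict_of_ae h2,
    ae_restrict_mem (hΩ.measurableSet.diff hD.measurableSet)] with x e1 e2 e3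
  refine e1 ⟨e3.1, fun hc => e2 ?_⟩
  rw [hD.frontier_eq]
  exact ⟨hc, e3.2⟩

/-! ### Existence of the Dirichlet-to-Neumann map -/

theorem min_mul_le_add_mul {c r x y μ : ℝ} (hx : 0 ≤ x) (hy : 0 ≤ y) (hμ : 0 < μ)
    (h : c * r ≤ x + y) : min 1 μ * c * r ≤ x + μ * y := by
  have h0 : 0 < min 1 μ := lt_min one_pos hμ
  calc min 1 μ * c * r = min 1 μ * (c * r) := by ring
    _ ≤ min 1 μ * (x + y) := by gcongr
    _ = min 1 μ * x + min 1 μ * y := by ring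
    _ ≤ 1 * x + μ * y := by
      gcongr
      · exact min_le_left _ _
      · exact min_le_right _ _
    _ = x + μ * y := by ring

set_option maxHeartbeats 400000 in
theorem coercive_dirichlet (hΩ : IsOpen Ω) (hb : Bornology.IsBounded Ω) {D : Set Plane}
    (hD : MeasurableSet D) (hDΩ : D ⊆ Ω) {μ : ℝ} (hμ : 0 < μ) :
    ∃ c : ℝ, 0 < c ∧ ∀ u ∈ H10 Ω,
      c * ‖u‖ ^ 2 ≤ dirichlet (Ω \ D) u u + μ * dirichlet D u u := by
  obtain ⟨c, hc, h⟩ := poincare_norm_sq hΩ hb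
  exact ⟨min 1 μ * c, mul_pos (lt_min one_pos hμ) hc, fun u hu =>
    min_mul_le_add_mul (dirichlet_self_nonneg _ u) (dirichlet_self_nonneg _ u) hμ
      ((h u hu).trans_eq ((real_inner_self_eq_norm_sq (grad u)).symm.trans
        (dirichlet_add hD hDΩ u u).symm))⟩

theorem weak_form_eq (D : Set Plane) {L : ℝ} (u φ : H1 Ω) (u₁ u₂ φ₁ φ₂ : L2Curve L)
    (μ b a : ℝ) :
    (∫ x in Ω \ D, inner ℝ (grad u x) (grad φ x)) + (∫ x in D, μ * inner ℝ (grad u x) (grad φ x))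
      + (∫ s in Ioc 0 L, b * (u₁ s * φ₁ s)) + (∫ s in Ioc 0 L, a * (u₂ s * φ₂ s))
      = dirichlet (Ω \ D) u φ + μ * dirichlet D u φ + b * inner ℝ u₁ φ₁
        + a * inner ℝ u₂ φ₂ := by
  simp only [integral_const_mul]
  rw [dirichlet_def, dirichlet_def, real_inner_eq_integral_mul, real_inner_eq_integral_mul]

end AntiplaneShear

namespace AntiplaneShear

open MeasureTheory Filter Topology Set
open scoped ContDiff ENNReal NNReal

variable {Ω : Set Plane}

theorem hasH2Trace_iff {L : ℝ} {γ : ℝ → Plane} {T : H1 Ω →L[ℝ] L2Curve L}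
    (hT : ∀ u g, IsCurveTrace L γ u g ↔ g = T u) (u : H1 Ω) (g₁ g₂ : L2Curve L) :
    HasH2Trace L γ u g₁ g₂ ↔ (T u, g₁) ∈ weakDerivGraph L ∧ (g₁, g₂) ∈ weakDerivGraph L := by
  constructor
  · rintro ⟨g, h1, h2, h3⟩
    rw [(hT u g).1 h1] at h2
    exact ⟨h2, h3⟩
  · rintro ⟨h1, h2⟩
    exact ⟨T u, (hT u _).2 rfl, h1, h2⟩

/-- The harmonic representative is smooth near the curve, so it belongs to ℋ: every boundary value
is attained in ℋ. -/
theorem exists_sub_mem_hasH2Trace {D : Set Plane} (hΩ : IsOpen Ω) (hb : Bornology.IsBounded Ω)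
    {L : ℝ} {γ : ℝ → Plane} (hγ : IsArclengthParam (frontier D) L γ) (hDΩ : closure D ⊆ Ω)
    (u : H1 Ω) : ∃ v g₁ g₂, v - u ∈ H10 Ω ∧ HasH2Trace L γ v g₁ g₂ := by
  have hex := exists_dirichlet_solution hΩ hb u
  obtain ⟨v, hv, hort⟩ := hex
  have hex := exists_smooth_of_dirichlet hΩ hb hort
  obtain ⟨h, hh, hvh⟩ := hex
  exact ⟨v, _, _, hv, hasH2Trace_of_smooth hΩ hγ hDΩ hh hvh⟩

theorem trace_of_mem_vanishingNear {D : Set Plane} {L : ℝ} {T : H1 Ω →L[ℝ] L2Curve L}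
    (hΩ : IsOpen Ω) (hDΩ : closure D ⊆ Ω)
    (hT : ∀ N, IsOpen N → frontier D ⊆ N → N ⊆ Ω → ∀ u : H1 Ω,
      (∀ᵐ x ∂(volume.restrict Ω), x ∈ N \ closure D → fn u x = 0) → T u = 0)
    {v : H1 Ω} (hv : v ∈ vanishingNear Ω D) : T v = 0 := by
  obtain ⟨V, hV, hDV, h⟩ := hv
  exact hT (V ∩ Ω) (hV.inter hΩ)
    (subset_inter (frontier_subset_closure.trans hDV) (frontier_subset_closure.trans hDΩ))
    inter_subset_right v (h.mono fun x hx hxN => hx hxN.1.1)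

theorem exists_dirichlet_add_clm {D : Set Plane} (hDΩ : D ⊆ Ω) (μ : ℝ) :
    ∃ A : H1 Ω →L[ℝ] H1 Ω →L[ℝ] ℝ, ∀ u v,
      A u v = dirichlet (Ω \ D) u v + μ * dirichlet D u v := by
  have hex := exists_dirichlet_clm (Ω := Ω) (s := Ω \ D) sdiff_subset
  obtain ⟨A₀, h₀⟩ := hex
  have hex := exists_dirichlet_clm hDΩ
  obtain ⟨A₁, h₁⟩ := hex
  refine ⟨A₀ + μ • A₁, fun u v => ?_⟩
  exact congrArg₂ (fun x y => x + μ * y) (h₀ u v) (h₁ u v)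

set_option maxHeartbeats 1000000 in
-- The flux functional of the abstract problem is the normal derivative: against functions vanishing
-- near `closure D` the inner form and the curve terms disappear.
theorem exists_isDtNValue {D : Set Plane} (hΩ : IsOpen Ω) (hb : Bornology.IsBounded Ω)
    (hD : IsSmoothDomain D) {L : ℝ} {γ : ℝ → Plane} (hγ : IsArclengthParam (frontier D) L γ)
    (hDΩ : closure D ⊆ Ω) {μ μs ℓ : ℝ} (hμ : 0 < μ) (hμs : 0 < μs) (hℓ : 0 < ℓ)
    (f : HalfTrace Ω) : ∃ ξ, IsDtNValue D L γ μ μs ℓ f ξ := by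
  have hDo : D ⊆ Ω := subset_closure.trans hDΩ
  have hex := exists_traceMap hΩ hb hD hγ hDΩ
  obtain ⟨T, hT, hT0⟩ := hex
  have hex := coercive_dirichlet hΩ hb hD.isOpen.measurableSet hDo hμ
  obtain ⟨c, hc, hco⟩ := hex
  have hex := (H10 Ω).mkQ_surjective f
  obtain ⟨u₀, rfl⟩ := hex
  have hex := exists_solution_flux (isClosed_H10 Ω) T
    (isClosed_weakDerivGraph L) _ (exists_dirichlet_add_clm hDo μ) hc hco hμs
    (mul_pos hμs (pow_pos hℓ 2))
    (fun u => by
      obtain ⟨v, g₁, g₂, hv, h⟩ := exists_sub_mem_hasH2Trace hΩ hb hγ hDΩ u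
      exact ⟨v, g₁, g₂, hv, (hasH2Trace_iff hT v g₁ g₂).1 h⟩) u₀
  obtain ⟨u, g₁, g₂, h1, h2, h3, h4, ξ, hξ⟩ := hex
  refine ⟨ξ, u, ⟨(Submodule.Quotient.eq (H10 Ω)).2 h1, g₁, g₂,
    (hasH2Trace_iff hT u g₁ g₂).2 ⟨h2, h3⟩, fun φ hφ φ₁ φ₂ hh => ?_⟩, fun φ hφ => ?_⟩
  · have hex := (hasH2Trace_iff hT φ φ₁ φ₂).1 hh
    obtain ⟨w1, w2⟩ := hex
    exact (weak_form_eq D u φ g₁ g₂ φ₁ φ₂ μ μs _).trans (h4 φ hφ φ₁ φ₂ w1 w2)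
  · have hφT := trace_of_mem_vanishingNear hΩ hDΩ hT0 hφ
    have h0 : ((0 : L2Curve L), (0 : L2Curve L)) ∈ weakDerivGraph L := (weakDerivGraph L).zero_mem
    have e := hξ φ 0 0 (by rw [hφT]; exact h0) h0
    have e1 := dirichlet_of_mem_vanishingNear hΩ hD.isOpen hDo hφ u
    have e2 := dirichlet_def (Ω \ D) u φ
    refine e.trans (Eq.trans ?_ e2)
    rw [inner_zero_right, inner_zero_right, mul_zero, mul_zero, add_zero, add_zero, e1, mul_zero,
      add_zero]

/-- The default value in `dtn` is never taken for positive parameters. -/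
theorem isDtNValue_dtn {D : Set Plane} (hΩ : IsOpen Ω) (hb : Bornology.IsBounded Ω)
    (hD : IsSmoothDomain D) {L : ℝ} {γ : ℝ → Plane} (hγ : IsArclengthParam (frontier D) L γ)
    (hDΩ : closure D ⊆ Ω) {μ μs ℓ : ℝ} (hμ : 0 < μ) (hμs : 0 < μs) (hℓ : 0 < ℓ)
    (f : HalfTrace Ω) : IsDtNValue D L γ μ μs ℓ f (dtn Ω D L γ μ μs ℓ f) := by
  have h := exists_isDtNValue hΩ hb hD hγ hDΩ hμ hμs hℓ f
  rw [dtn, dif_pos h]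
  exact h.choose_spec

/-! ### The integral identity -/

/-- All derivatives go onto the smooth function k, up to its fourth one. The pairings then depend
only on the trace g, and vanish with it. -/
theorem inner_toLp_of_weakDeriv {L : ℝ} {k : ℝ → ℝ} (hk : ContDiff ℝ ∞ k)
    (hp : Function.Periodic k L) {g g₁ g₂ : L2Curve L} (h1 : (g, g₁) ∈ weakDerivGraph L)
    (h2 : (g₁, g₂) ∈ weakDerivGraph L) :
    have hk1 := contDiff_deriv hk
    have hk2 := contDiff_deriv hk1
    have hk4 := contDiff_deriv (contDiff_deriv hk2)
    inner ℝ g₁ ((memLp_Ioc hk1.continuous).toLp _ : L2Curve L)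
        = -inner ℝ g ((memLp_Ioc hk2.continuous).toLp _ : L2Curve L) ∧
      inner ℝ g₂ ((memLp_Ioc hk2.continuous).toLp _ : L2Curve L)
        = inner ℝ g ((memLp_Ioc hk4.continuous).toLp _ : L2Curve L) := by
  intro hk1 hk2 hk4
  have hk3 := contDiff_deriv hk2
  have hp1 := periodic_deriv hp
  have hp2 := periodic_deriv hp1
  have hp3 := periodic_deriv hp2
  rw [real_inner_comm, real_inner_comm _ g, real_inner_comm _ g₂, real_inner_comm _ g]
  simp only [inner_toLp_curve]
  have e1 := h1 _ hk1 hp1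
  have e2 := h1 _ hk3 hp3
  have e3 := h2 _ hk2 hp2
  dsimp only at e1 e2 e3
  exact ⟨by linarith, by linarith⟩

theorem dtn_flux {D : Set Plane} {L : ℝ} {γ : ℝ → Plane} {T : H1 Ω →L[ℝ] L2Curve L}
    (hT : ∀ u g, IsCurveTrace L γ u g ↔ g = T u) {μ μs ℓ : ℝ} {v : H1 Ω} {ξ : NegHalf Ω}
    (h : IsDtNValue D L γ μ μs ℓ (outerTrace v) ξ) :
    ∃ u g₁ g₂, u - v ∈ H10 Ω ∧ (T u, g₁) ∈ weakDerivGraph L ∧ (g₁, g₂) ∈ weakDerivGraph L ∧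
      (∀ v ∈ H10 Ω, ∀ h₁ h₂, (T v, h₁) ∈ weakDerivGraph L → (h₁, h₂) ∈ weakDerivGraph L →
        dirichlet (Ω \ D) u v + μ * dirichlet D u v + μs * inner ℝ g₁ h₁
          + μs * ℓ ^ 2 * inner ℝ g₂ h₂ = 0) ∧
      ∀ v ∈ vanishingNear Ω D, dirichlet (Ω \ D) u v = ξ (outerTrace v) := by
  obtain ⟨u, ⟨h1, g₁, g₂, h2, h3⟩, h4⟩ := h
  have hex := (hasH2Trace_iff hT u g₁ g₂).1 h2
  obtain ⟨w1, w2⟩ := hex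
  refine ⟨u, g₁, g₂, (Submodule.Quotient.eq (H10 Ω)).1 h1, w1, w2, fun v hv h₁ h₂ k1 k2 => ?_,
    fun v hv => ?_⟩
  · exact (weak_form_eq D u v g₁ g₂ h₁ h₂ μ μs _).symm.trans
      (h3 v hv h₁ h₂ ((hasH2Trace_iff hT v h₁ h₂).2 ⟨k1, k2⟩))
  · rw [dirichlet_def]
    exact (h4 v hv).symm

end AntiplaneShear

namespace AntiplaneShear

open MeasureTheory Filter Topology Set
open scoped ContDiff ENNReal NNReal

variable {Ω : Set Plane}

/-- Since w vanishes outside D, the form over D is the form over Ω, which equals -∫ w Δφ; at almost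
every point of Ω one of the two factors is zero. -/
theorem dirichlet_eq_zero_of_lap_eq_zero {D : Set Plane} (hΩ : IsOpen Ω) (hD : IsOpen D)
    (hDΩ : D ⊆ Ω) {L : ℝ} {γ : ℝ → Plane} (hγ : IsArclengthParam (frontier D) L γ) {w : H1 Ω}
    (hw : w ∈ H10 Ω) (h : ∀ᵐ x ∂(volume.restrict Ω), x ∈ Ω \ closure D → fn w x = 0)
    {φ : Plane → ℝ} (hφ : IsTestFunction Ω φ) (hl : ∀ x ∈ closure D, lap φ x = 0) :
    dirichlet D w (ofSmooth Ω φ hφ.smooth hφ.compact) = 0 := by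
  have h1 := dirichlet_add hD.measurableSet hDΩ w (ofSmooth Ω φ hφ.smooth hφ.compact)
  have h2 := dirichlet_eq_zero (Ω \ D) (ofSmooth Ω φ hφ.smooth hφ.compact)
    (grad_eq_zero_of_fn_eq_zero_outside hΩ hD hγ h)
  have h3 := integral_fn_mul_lap_of_mem_H10 hΩ hw hφ.smooth hφ.compact
  have h4 : ∫ x in Ω, fn w x * lap φ x = 0 := by
    refine integral_eq_zero_of_ae ?_
    filter_upwards [h, ae_restrict_mem hΩ.measurableSet] with x hx hxΩ
    by_cases hxD : x ∈ closure D
    · rw [hl x hxD, mul_zero]; rfl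
    · rw [hx ⟨hxΩ, hxD⟩, zero_mul]; rfl
  rw [h2, zero_add] at h1
  rw [h4, ← h1] at h3
  linarith

theorem dirichlet_ofSmooth_self {D : Set Plane} (hDΩ : D ⊆ Ω) {φ : Plane → ℝ}
    (hφ : ContDiff ℝ ∞ φ) (hc : HasCompactSupport φ) :
    dirichlet D (ofSmooth Ω φ hφ hc) (ofSmooth Ω φ hφ hc) = ∫ x in D, ‖gradient φ x‖ ^ 2 := by
  rw [dirichlet_def]
  refine integral_congr_ae ?_
  filter_upwards [ae_restrict_of_ae_restrict_of_subset hDΩ (grad_ofSmooth (Ω := Ω) hφ hc)]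
    with x hx
  rw [hx, real_inner_self_eq_norm_sq]

theorem inner_toLp_self {L : ℝ} {k : ℝ → ℝ} (hk : MemLp k 2 (volume.restrict (Ioc 0 L))) :
    inner ℝ (hk.toLp k) (hk.toLp k) = ∫ s in Ioc 0 L, k s ^ 2 := by
  rw [inner_toLp_curve]
  refine integral_congr_ae ?_
  filter_upwards [hk.coeFn_toLp] with s hs
  rw [hs, sq]

set_option maxHeartbeats 1000000 in
/-- The integral identity satisfied by two parameter triples with the same Dirichlet-to-Neumann
map, for test functions harmonic in the inclusion. -/
theorem integral_identity_of_isTestFunction {D : Set Plane} (hΩ : IsOpen Ω)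
    (hb : Bornology.IsBounded Ω) (hD : IsSmoothDomain D) {L : ℝ} {γ : ℝ → Plane}
    (hγ : IsArclengthParam (frontier D) L γ) (hDΩ : closure D ⊆ Ω) {μ μs ℓ μ' μs' ℓ' : ℝ}
    (hμ : 0 < μ) (hμs : 0 < μs) (hℓ : 0 < ℓ) (hμ' : 0 < μ') (hμs' : 0 < μs') (hℓ' : 0 < ℓ')
    (heq : dtn Ω D L γ μ μs ℓ = dtn Ω D L γ μ' μs' ℓ') {φ : Plane → ℝ} (hφ : IsTestFunction Ω φ)
    (hl : ∀ x ∈ closure D, lap φ x = 0) :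
    (μ - μ') * (∫ x in D, ‖gradient φ x‖ ^ 2)
      + (μs - μs') * (∫ s in Ioc 0 L, deriv (fun s => φ (γ s)) s ^ 2)
      + (μs * ℓ ^ 2 - μs' * ℓ' ^ 2) * (∫ s in Ioc 0 L, deriv (deriv fun s => φ (γ s)) s ^ 2)
      = 0 := by
  have hDo : D ⊆ Ω := subset_closure.trans hDΩ
  have hex := exists_traceMap hΩ hb hD hγ hDΩ
  obtain ⟨T, hT, hT0⟩ := hex
  have hex := coercive_dirichlet hΩ hb hD.isOpen.measurableSet hDo hμ
  obtain ⟨c, hc, hco⟩ := hex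
  have hk := contDiff_comp_curve hΩ hγ hDΩ hφ.smooth.contDiffOn
  have hp : Function.Periodic (fun s => φ (γ s)) L := fun s => congrArg φ (hγ.periodic s)
  have htr := (hasH2Trace_iff hT _ _ _).1 (hasH2Trace_of_smooth hΩ hγ hDΩ hφ.smooth.contDiffOn
    (fn_ofSmooth (Ω := Ω) hφ.smooth hφ.compact))
  have key := energy_difference_eq_zero (isClosed_H10 Ω) T (isClosed_weakDerivGraph L)
    (dirichlet (Ω \ D)) (dirichlet D) (exists_dirichlet_clm sdiff_subset)
    (exists_dirichlet_clm hDo) (dirichlet_comm _) (dirichlet_comm _) hc hco hμ hμs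
    (mul_pos hμs (pow_pos hℓ 2)) hμ' (b' := μs') (a' := μs' * ℓ' ^ 2) (vanishingNear Ω D)
    (fun v hv => trace_of_mem_vanishingNear hΩ hDΩ hT0 hv)
    (fun v hv => dirichlet_of_mem_vanishingNear hΩ hD.isOpen hDo hv)
    (ofSmooth_mem_H10 hφ) htr.1 htr.2
    (fun u g₁ g₂ h1 h2 => inner_toLp_of_weakDeriv hk hp h1 h2)
    -- Unique continuation supplies all three properties of a function without flux: zero trace,
    -- zero outer form, and orthogonality to φ inside D.
    (fun w hw h => by
      have h0 := fn_eq_zero_of_flux_eq_zero hΩ hb hD hγ hDΩ hw h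
      exact ⟨hT0 Ω hΩ (frontier_subset_closure.trans hDΩ) le_rfl w h0,
        fun v => dirichlet_eq_zero _ v (grad_eq_zero_of_fn_eq_zero_outside hΩ hD.isOpen hγ h0),
        dirichlet_eq_zero_of_lap_eq_zero hΩ hD.isOpen hDo hγ hw h0 hφ hl⟩)
    (fun v hv => by
      have h1 := isDtNValue_dtn hΩ hb hD hγ hDΩ hμ hμs hℓ (outerTrace v)
      have h2 := isDtNValue_dtn hΩ hb hD hγ hDΩ hμ' hμs' hℓ' (outerTrace v)
      rw [← heq] at h2
      have h3 := dtn_flux hT h1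
      have h4 := dtn_flux hT h2
      obtain ⟨u, g₁, g₂, a1, a2, a3, a4, a5⟩ := h3
      obtain ⟨u', g₁', g₂', b1, b2, b3, b4, b5⟩ := h4
      exact ⟨u, g₁, g₂, u', g₁', g₂', a1, a2, a3, b1, b2, b3, a4, b4,
        fun v hv => (a5 v hv).trans (b5 v hv).symm⟩)
  have e0 := dirichlet_ofSmooth_self hDo hφ.smooth hφ.compact
  rw [e0, inner_toLp_self, inner_toLp_self] at key
  exact key

theorem exists_isTestFunction_eventuallyEq {K : Set Plane} (hΩ : IsOpen Ω)
    (hb : Bornology.IsBounded Ω) (hK : IsCompact K) (hKΩ : K ⊆ Ω) {φ : Plane → ℝ}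
    (hφ : ContDiff ℝ ∞ φ) :
    ∃ ψ, IsTestFunction Ω ψ ∧ ∀ x ∈ K, ψ =ᶠ[𝓝 x] φ := by
  obtain ⟨χ, h0, h1, -⟩ := exists_contMDiffMap_zero_one_nhds_of_isClosed (n := (⊤ : ℕ∞))
    (modelWithCornersSelf ℝ Plane) hΩ.isClosed_compl hK.isClosed
    (disjoint_compl_left_iff_subset.2 hKΩ)
  have hsupp : tsupport (fun x => χ x * φ x) ⊆ Ω := by
    intro x hx
    by_contra hxΩ
    have h2 : ∀ᶠ y in 𝓝 x, χ y = 0 := (eventually_nhdsSet_iff_forall.1 h0) x hxΩ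
    refine (notMem_tsupport_iff_eventuallyEq.2 ?_) hx
    filter_upwards [h2] with y hy
    simp [hy]
  refine ⟨fun x => χ x * φ x, ⟨χ.contMDiff.contDiff.mul hφ, ?_, hsupp⟩, fun x hx => ?_⟩
  · exact Metric.isCompact_of_isClosed_isBounded (isClosed_tsupport _) (hb.subset hsupp)
  · filter_upwards [(eventually_nhdsSet_iff_forall.1 h1) x hx] with y hy
    rw [hy, one_mul]

/-- An entire harmonic function is cut off away from `closure D`; every integral in the identity
sees only `closure D`, where nothing changes. -/
theorem integral_identity {D : Set Plane} (hΩ : IsOpen Ω)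
    (hb : Bornology.IsBounded Ω) (hD : IsSmoothDomain D) {L : ℝ} {γ : ℝ → Plane}
    (hγ : IsArclengthParam (frontier D) L γ) (hDΩ : closure D ⊆ Ω) {μ μs ℓ μ' μs' ℓ' : ℝ}
    (hμ : 0 < μ) (hμs : 0 < μs) (hℓ : 0 < ℓ) (hμ' : 0 < μ') (hμs' : 0 < μs') (hℓ' : 0 < ℓ')
    (heq : dtn Ω D L γ μ μs ℓ = dtn Ω D L γ μ' μs' ℓ') {φ : Plane → ℝ} (hφ : ContDiff ℝ ∞ φ)
    (hl : ∀ x, lap φ x = 0) :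
    (μ - μ') * (∫ x in D, ‖gradient φ x‖ ^ 2)
      + (μs - μs') * (∫ s in Ioc 0 L, deriv (fun s => φ (γ s)) s ^ 2)
      + (μs * ℓ ^ 2 - μs' * ℓ' ^ 2) * (∫ s in Ioc 0 L, deriv (deriv fun s => φ (γ s)) s ^ 2)
      = 0 := by
  obtain ⟨ψ, hψ, he⟩ := exists_isTestFunction_eventuallyEq hΩ hb hD.isBounded.isCompact_closure hDΩ
    hφ
  have h1 := integral_identity_of_isTestFunction hΩ hb hD hγ hDΩ hμ hμs hℓ hμ' hμs' hℓ' heq hψ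
    fun x hx => (lap_congr (he x hx)).trans (hl x)
  have e1 : (fun s => ψ (γ s)) = fun s => φ (γ s) := funext fun s =>
    (he _ (frontier_subset_closure (hγ.range_eq ▸ mem_range_self s))).eq_of_nhds
  have e2 : ∫ x in D, ‖gradient ψ x‖ ^ 2 = ∫ x in D, ‖gradient φ x‖ ^ 2 := by
    refine setIntegral_congr_fun hD.isOpen.measurableSet fun x hx => ?_
    simp only [norm_gradient, (he x (subset_closure hx)).fderiv_eq]
  rwa [e1, e2] at h1

end AntiplaneShear

namespace AntiplaneShear

open MeasureTheory Filter Topology Set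
open scoped ContDiff ENNReal NNReal

/-! ### Harmonic exponentials -/

/-- The real part of `exp (λ (x₀ + i x₁))`. -/
noncomputable def expCos (l : ℝ) (x : Plane) : ℝ := Real.exp (l * x 0) * Real.cos (l * x 1)

/-- The imaginary part of `exp (λ (x₀ + i x₁))`. -/
noncomputable def expSin (l : ℝ) (x : Plane) : ℝ := Real.exp (l * x 0) * Real.sin (l * x 1)

theorem contDiff_expCos (l : ℝ) : ContDiff ℝ ∞ (expCos l) := by
  unfold expCos
  fun_prop

theorem contDiff_expSin (l : ℝ) : ContDiff ℝ ∞ (expSin l) := by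
  unfold expSin
  fun_prop

theorem expCos_sq_add_expSin_sq (l : ℝ) (x : Plane) :
    expCos l x ^ 2 + expSin l x ^ 2 = Real.exp (2 * l * x 0) := by
  have h : Real.exp (2 * l * x 0) = Real.exp (l * x 0) ^ 2 := by
    rw [← Real.exp_nat_mul]; congr 1; push_cast; ring
  rw [h, expCos, expSin]
  linear_combination Real.exp (l * x 0) ^ 2 * Real.sin_sq_add_cos_sq (l * x 1)

theorem hasDerivAt_coord {c : ℝ → Plane} {v : Plane} {s : ℝ} (h : HasDerivAt c v s) (i : Fin 2) :
    HasDerivAt (fun s => c s i) (v i) s :=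
  (EuclideanSpace.proj i : Plane →L[ℝ] ℝ).hasFDerivAt.comp_hasDerivAt s h

theorem hasDerivAt_expCos (l : ℝ) {c : ℝ → Plane} {v : Plane} {s : ℝ} (h : HasDerivAt c v s) :
    HasDerivAt (fun s => expCos l (c s)) (l * (v 0 * expCos l (c s) - v 1 * expSin l (c s))) s := by
  have h0 : HasDerivAt (fun s => c s 0) (v 0) s := hasDerivAt_coord h 0
  have h1 : HasDerivAt (fun s => c s 1) (v 1) s := hasDerivAt_coord h 1
  convert! (h0.const_mul l).exp.mul (h1.const_mul l).cos using 1
  simp only [expCos, expSin]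
  ring

theorem hasDerivAt_expSin (l : ℝ) {c : ℝ → Plane} {v : Plane} {s : ℝ} (h : HasDerivAt c v s) :
    HasDerivAt (fun s => expSin l (c s)) (l * (v 0 * expSin l (c s) + v 1 * expCos l (c s))) s := by
  have h0 : HasDerivAt (fun s => c s 0) (v 0) s := hasDerivAt_coord h 0
  have h1 : HasDerivAt (fun s => c s 1) (v 1) s := hasDerivAt_coord h 1
  convert! (h0.const_mul l).exp.mul (h1.const_mul l).sin using 1
  simp only [expCos, expSin]
  ring

theorem pd_eq_of_hasDerivAt {φ : Plane → ℝ} {x : Plane} {i : Fin 2} {d : ℝ}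
    (hφ : DifferentiableAt ℝ φ x)
    (h : HasDerivAt (fun t : ℝ => φ (x + t • EuclideanSpace.single i 1)) d 0) : pd i φ x = d := by
  rw [pd, ← hφ.lineDeriv_eq_fderiv]
  exact HasDerivAt.deriv h

theorem pd_expCos (l : ℝ) (x : Plane) (i : Fin 2) : pd i (expCos l) x
    = l * (EuclideanSpace.single i (1 : ℝ) 0 * expCos l x
      - EuclideanSpace.single i (1 : ℝ) 1 * expSin l x) := by
  refine pd_eq_of_hasDerivAt ((contDiff_expCos l).differentiable (by simp) x) ?_
  have h : HasDerivAt (fun t : ℝ => x + t • EuclideanSpace.single i (1 : ℝ))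
      (EuclideanSpace.single i 1) 0 := by
    simpa using ((hasDerivAt_id (0 : ℝ)).smul_const (EuclideanSpace.single i (1 : ℝ))).const_add x
  simpa using hasDerivAt_expCos l h

theorem pd_expSin (l : ℝ) (x : Plane) (i : Fin 2) : pd i (expSin l) x
    = l * (EuclideanSpace.single i (1 : ℝ) 0 * expSin l x
      + EuclideanSpace.single i (1 : ℝ) 1 * expCos l x) := by
  refine pd_eq_of_hasDerivAt ((contDiff_expSin l).differentiable (by simp) x) ?_
  have h : HasDerivAt (fun t : ℝ => x + t • EuclideanSpace.single i (1 : ℝ))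
      (EuclideanSpace.single i 1) 0 := by
    simpa using ((hasDerivAt_id (0 : ℝ)).smul_const (EuclideanSpace.single i (1 : ℝ))).const_add x
  simpa using hasDerivAt_expSin l h

theorem pd_const_mul {φ : Plane → ℝ} {x : Plane} (hφ : DifferentiableAt ℝ φ x) (i : Fin 2) (c : ℝ) :
    pd i (fun y => c * φ y) x = c * pd i φ x := by
  rw [pd, fderiv_const_mul hφ]
  rfl

theorem pd_zero_expCos (l : ℝ) : pd 0 (expCos l) = fun x => l * expCos l x := by
  ext x; simp [pd_expCos]

theorem pd_one_expCos (l : ℝ) : pd 1 (expCos l) = fun x => -l * expSin l x := by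
  ext x; simp [pd_expCos]

theorem pd_zero_expSin (l : ℝ) : pd 0 (expSin l) = fun x => l * expSin l x := by
  ext x; simp [pd_expSin]

theorem pd_one_expSin (l : ℝ) : pd 1 (expSin l) = fun x => l * expCos l x := by
  ext x; simp [pd_expSin]

theorem lap_expCos (l : ℝ) (x : Plane) : lap (expCos l) x = 0 := by
  have hc := (contDiff_expCos l).differentiable (by simp) x
  have hs := (contDiff_expSin l).differentiable (by simp) x
  rw [lap, Fin.sum_univ_two, pd_zero_expCos, pd_one_expCos, pd_const_mul hc, pd_const_mul hs,
    pd_zero_expCos, pd_one_expSin]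
  ring

theorem lap_expSin (l : ℝ) (x : Plane) : lap (expSin l) x = 0 := by
  have hc := (contDiff_expCos l).differentiable (by simp) x
  have hs := (contDiff_expSin l).differentiable (by simp) x
  rw [lap, Fin.sum_univ_two, pd_zero_expSin, pd_one_expSin, pd_const_mul hc, pd_const_mul hs,
    pd_zero_expSin, pd_one_expCos]
  ring

theorem norm_gradient_sq (φ : Plane → ℝ) (x : Plane) :
    ‖gradient φ x‖ ^ 2 = pd 0 φ x ^ 2 + pd 1 φ x ^ 2 := by
  rw [EuclideanSpace.norm_sq_eq, Fin.sum_univ_two, gradient_apply, gradient_apply,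
    Real.norm_eq_abs, Real.norm_eq_abs, sq_abs, sq_abs]

theorem norm_gradient_expCos_sq (l : ℝ) (x : Plane) :
    ‖gradient (expCos l) x‖ ^ 2 = l ^ 2 * Real.exp (2 * l * x 0) := by
  rw [norm_gradient_sq, pd_zero_expCos, pd_one_expCos, ← expCos_sq_add_expSin_sq]
  ring

theorem norm_gradient_expSin_sq (l : ℝ) (x : Plane) :
    ‖gradient (expSin l) x‖ ^ 2 = l ^ 2 * Real.exp (2 * l * x 0) := by
  rw [norm_gradient_sq, pd_zero_expSin, pd_one_expSin, ← expCos_sq_add_expSin_sq]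
  ring

theorem IsArclengthParam.hasDerivAt {Γ : Set Plane} {L : ℝ} {γ : ℝ → Plane}
    (hγ : IsArclengthParam Γ L γ) (s : ℝ) : HasDerivAt γ (deriv γ s) s :=
  (hγ.smooth.differentiable (by simp) s).hasDerivAt

theorem IsArclengthParam.hasDerivAt_deriv {Γ : Set Plane} {L : ℝ} {γ : ℝ → Plane}
    (hγ : IsArclengthParam Γ L γ) (s : ℝ) : HasDerivAt (deriv γ) (deriv (deriv γ) s) s :=
  (((contDiff_infty_iff_deriv.1 hγ.smooth).2).differentiable (by simp) s).hasDerivAt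

theorem IsArclengthParam.deriv_sq {Γ : Set Plane} {L : ℝ} {γ : ℝ → Plane}
    (hγ : IsArclengthParam Γ L γ) (s : ℝ) : deriv γ s 0 ^ 2 + deriv γ s 1 ^ 2 = 1 := by
  have h := EuclideanSpace.norm_sq_eq (deriv γ s)
  rw [hγ.unit_speed, Fin.sum_univ_two, Real.norm_eq_abs, Real.norm_eq_abs, sq_abs, sq_abs] at h
  linarith

/-- The squared modulus of the second derivative of `exp (λ z)` along the curve, divided by
`|exp (λ z)|²`. -/
noncomputable def curveSymbol (γ : ℝ → Plane) (l s : ℝ) : ℝ :=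
  (l * deriv (deriv γ) s 0 + l ^ 2 * (deriv γ s 0 ^ 2 - deriv γ s 1 ^ 2)) ^ 2
    + (l * deriv (deriv γ) s 1 + l ^ 2 * (2 * deriv γ s 0 * deriv γ s 1)) ^ 2

section Curve

variable {Γ : Set Plane} {L : ℝ} {γ : ℝ → Plane}

theorem deriv_expCos_curve (hγ : IsArclengthParam Γ L γ) (l : ℝ) :
    deriv (fun s => expCos l (γ s)) = fun s =>
      l * (deriv γ s 0 * expCos l (γ s) - deriv γ s 1 * expSin l (γ s)) :=
  funext fun s => (hasDerivAt_expCos l (hγ.hasDerivAt s)).deriv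

theorem deriv_expSin_curve (hγ : IsArclengthParam Γ L γ) (l : ℝ) :
    deriv (fun s => expSin l (γ s)) = fun s =>
      l * (deriv γ s 0 * expSin l (γ s) + deriv γ s 1 * expCos l (γ s)) :=
  funext fun s => (hasDerivAt_expSin l (hγ.hasDerivAt s)).deriv

theorem deriv_sq_add_deriv_sq (hγ : IsArclengthParam Γ L γ) (l s : ℝ) :
    deriv (fun s => expCos l (γ s)) s ^ 2 + deriv (fun s => expSin l (γ s)) s ^ 2
      = l ^ 2 * Real.exp (2 * l * γ s 0) := by
  rw [deriv_expCos_curve hγ, deriv_expSin_curve hγ, ← expCos_sq_add_expSin_sq]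
  linear_combination l ^ 2 * (expCos l (γ s) ^ 2 + expSin l (γ s) ^ 2) * hγ.deriv_sq s

theorem deriv_deriv_sq_add_deriv_deriv_sq (hγ : IsArclengthParam Γ L γ) (l s : ℝ) :
    deriv (deriv fun s => expCos l (γ s)) s ^ 2 + deriv (deriv fun s => expSin l (γ s)) s ^ 2
      = curveSymbol γ l s * Real.exp (2 * l * γ s 0) := by
  have h0 : HasDerivAt (fun s => deriv γ s 0) (deriv (deriv γ) s 0) s :=
    hasDerivAt_coord (hγ.hasDerivAt_deriv s) 0
  have h1 : HasDerivAt (fun s => deriv γ s 1) (deriv (deriv γ) s 1) s :=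
    hasDerivAt_coord (hγ.hasDerivAt_deriv s) 1
  have hc := hasDerivAt_expCos l (hγ.hasDerivAt s)
  have hs := hasDerivAt_expSin l (hγ.hasDerivAt s)
  rw [deriv_expCos_curve hγ, deriv_expSin_curve hγ,
    (((h0.fun_mul hc).fun_sub (h1.fun_mul hs)).const_mul l).deriv,
    (((h0.fun_mul hs).fun_add (h1.fun_mul hc)).const_mul l).deriv, ← expCos_sq_add_expSin_sq, curveSymbol]
  ring

/-- Unit speed makes the modulus of λ²(γ')² equal to λ², whereas the curvature term λγ'' is only of
order λ. -/
theorem exists_curveSymbol_bound (hγ : IsArclengthParam Γ L γ) :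
    ∃ l₀ : ℝ, ∀ l ≥ l₀, ∀ s ∈ Ioc 0 L, l ^ 4 / 2 ≤ curveSymbol γ l s := by
  have hcont : Continuous (deriv (deriv γ)) :=
    (contDiff_infty_iff_deriv.1 (contDiff_infty_iff_deriv.1 hγ.smooth).2).2.continuous
  obtain ⟨κ, hκ⟩ := (isCompact_Icc (a := (0 : ℝ)) (b := L)).exists_bound_of_continuousOn
    hcont.continuousOn
  -- The cross term is at least -4κ l³, which is at least -l⁴/3 when l ≥ 12κ.
  refine ⟨max 1 (12 * κ), fun l hl s hs => ?_⟩
  have hl1 : 1 ≤ l := (le_max_left _ _).trans hl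
  have hl2 : 12 * κ ≤ l := (le_max_right _ _).trans hl
  have hk := hκ s (Ioc_subset_Icc_self hs)
  have ha : |deriv (deriv γ) s 0| ≤ κ := (PiLp.norm_apply_le _ 0).trans hk
  have hb : |deriv (deriv γ) s 1| ≤ κ := (PiLp.norm_apply_le _ 1).trans hk
  have hu := hγ.deriv_sq s
  rw [curveSymbol]
  generalize deriv (deriv γ) s 0 = a at *
  generalize deriv (deriv γ) s 1 = b at *
  generalize deriv γ s 0 = x at *
  generalize deriv γ s 1 = y at *
  have e1 : |x ^ 2 - y ^ 2| ≤ 1 := abs_le.2 ⟨by nlinarith, by nlinarith⟩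
  have e2 : |2 * x * y| ≤ 1 := abs_le.2 ⟨by nlinarith [sq_nonneg (x + y)],
    by nlinarith [sq_nonneg (x - y)]⟩
  have e3 : |a * (x ^ 2 - y ^ 2)| ≤ κ := by
    rw [abs_mul]
    nlinarith [abs_nonneg a, abs_nonneg (x ^ 2 - y ^ 2)]
  have e4 : |b * (2 * x * y)| ≤ κ := by
    rw [abs_mul]
    nlinarith [abs_nonneg b, abs_nonneg (2 * x * y)]
  have e5 : (l * a + l ^ 2 * (x ^ 2 - y ^ 2)) ^ 2 + (l * b + l ^ 2 * (2 * x * y)) ^ 2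
      = l ^ 2 * (a ^ 2 + b ^ 2) + l ^ 4
        + 2 * l ^ 3 * (a * (x ^ 2 - y ^ 2) + b * (2 * x * y)) := by
    linear_combination l ^ 4 * (x ^ 2 + y ^ 2 + 1) * hu
  have e6 : -(2 * κ) ≤ a * (x ^ 2 - y ^ 2) + b * (2 * x * y) := by
    linarith [(abs_le.1 e3).1, (abs_le.1 e4).1]
  have e7 : 2 * l ^ 3 * (-(2 * κ)) ≤ 2 * l ^ 3 * (a * (x ^ 2 - y ^ 2) + b * (2 * x * y)) := by
    gcongr
  have e8 : l ^ 3 * (12 * κ) ≤ l ^ 3 * l := by gcongr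
  have e9 : 0 ≤ l ^ 2 * (a ^ 2 + b ^ 2) := by positivity
  have e10 : 0 ≤ l ^ 3 * l := by positivity
  rw [e5]
  nlinarith

end Curve

/-! ### Asymptotic separation of the three coefficients -/

theorem abs_mul_of_nonneg_right {x y : ℝ} (hy : 0 ≤ y) : |x * y| = |x| * y := by
  rw [abs_mul, abs_of_nonneg hy]

/-- The elementary asymptotic comparison that identifies the parameters. -/
theorem eq_zero_of_asymptotics {m b a : ℝ} {I J K : ℝ → ℝ} (hI : ∀ l, 0 < I l) (hJ : ∀ l, 0 < J l)
    (h : ∀ l, 0 < l → m * (2 * l ^ 2 * I l) + b * (l ^ 2 * J l) + a * K l = 0)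
    (hK : ∀ᶠ l in atTop, l ^ 4 / 2 * J l ≤ K l)
    (hIJ : ∀ ε > 0, ∀ᶠ l in atTop, I l ≤ ε * J l) : m = 0 ∧ b = 0 ∧ a = 0 := by
  -- The term a K grows like l⁴ J, while the other two are at most a multiple of l² J because I ≤ J
  -- eventually.
  have ha : a = 0 := by
    by_contra ha
    have ha' : 0 < |a| := abs_pos.2 ha
    have hlim : Tendsto (fun l : ℝ => |a| * l ^ 2 / 2) atTop atTop :=
      ((tendsto_pow_atTop two_ne_zero).const_mul_atTop ha').atTop_div_const two_pos
    obtain ⟨l, h1, h2, h3, hl⟩ := (hK.and ((hIJ 1 one_pos).and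
      ((hlim.eventually_gt_atTop (2 * |m| + |b|)).and (eventually_gt_atTop 0)))).exists
    have e := h l hl
    have hK0 : |a| * K l ≤ l ^ 2 * ((2 * |m| + |b|) * J l) := by
      have hKp : 0 ≤ K l := le_trans (by have := hJ l; positivity) h1
      have e1 : |a| * K l = |m * (2 * l ^ 2 * I l) + b * (l ^ 2 * J l)| := by
        rw [← abs_mul_of_nonneg_right hKp, ← abs_neg]
        congr 1
        linarith
      have e2 : |m * (2 * l ^ 2 * I l)| = |m| * (2 * l ^ 2 * I l) :=
        abs_mul_of_nonneg_right (by have := hI l; positivity)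
      have e3 : |b * (l ^ 2 * J l)| = |b| * (l ^ 2 * J l) :=
        abs_mul_of_nonneg_right (by have := hJ l; positivity)
      rw [e1]
      refine (abs_add_le _ _).trans ?_
      rw [e2, e3]
      have : |m| * (2 * l ^ 2 * I l) ≤ |m| * (2 * l ^ 2 * (1 * J l)) := by gcongr
      linarith
    have e4 : |a| * (l ^ 4 / 2 * J l) ≤ |a| * K l := by gcongr
    have e5 : l ^ 2 * ((2 * |m| + |b|) * J l) < l ^ 2 * (|a| * l ^ 2 / 2 * J l) := by
      have := hJ l
      gcongr
    nlinarith
  subst ha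
  simp only [zero_mul, add_zero] at h
  have hmb : ∀ l, 0 < l → m * (2 * I l) + b * J l = 0 := fun l hl => by
    have e := h l hl
    have : l ^ 2 * (m * (2 * I l) + b * J l) = 0 := by linarith
    exact (mul_eq_zero_iff_left (by positivity)).1 this
  have hb : b = 0 := by
    by_contra hb
    have hb' : 0 < |b| := abs_pos.2 hb
    -- With this ε the term in m is at most half of |b| J, although it has to balance it.
    have hε : 0 < |b| / (4 * (|m| + 1)) := by positivity
    obtain ⟨l, h1, hl⟩ := ((hIJ _ hε).and (eventually_gt_atTop 0)).exists
    have e := hmb l hl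
    have e1 : |b| * J l = |m| * (2 * I l) := by
      have hI' := hI l
      have hJ' := hJ l
      rw [← abs_mul_of_nonneg_right hJ'.le, ← abs_mul_of_nonneg_right (by positivity), ← abs_neg]
      congr 1
      linarith
    have e2 : |m| * (2 * I l) ≤ (|m| + 1) * (2 * (|b| / (4 * (|m| + 1)) * J l)) := by
      have hI' := hI l
      gcongr
      linarith
    have e3 : (|m| + 1) * (2 * (|b| / (4 * (|m| + 1)) * J l)) = |b| * J l / 2 := by
      field_simp
      ring
    have e4 : 0 < |b| * J l := mul_pos hb' (hJ l)
    linarith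
  refine ⟨?_, hb, rfl⟩
  have e := hmb 1 one_pos
  rw [hb, zero_mul, add_zero] at e
  exact (mul_eq_zero_iff_right (by have := hI 1; positivity)).1 e

end AntiplaneShear

namespace AntiplaneShear

open MeasureTheory Filter Topology Set
open scoped ContDiff ENNReal NNReal

/-! ### Comparison of the exponential integrals -/

theorem continuous_exp_coord (l : ℝ) : Continuous fun x : Plane => Real.exp (2 * l * x 0) := by
  fun_prop

theorem integrableOn_exp_coord {D : Set Plane} (hb : Bornology.IsBounded D) (l : ℝ) :
    IntegrableOn (fun x : Plane => Real.exp (2 * l * x 0)) D :=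
  ((continuous_exp_coord l).continuousOn.integrableOn_compact hb.isCompact_closure).mono_set
    subset_closure

/-- The extreme point of `D` in the first coordinate direction lies on the boundary curve. -/
theorem exists_curve_max {D : Set Plane} (hD : IsSmoothDomain D) {L : ℝ} {γ : ℝ → Plane}
    (hγ : IsArclengthParam (frontier D) L γ) :
    ∃ s₀, ∀ x ∈ closure D, x 0 ≤ γ s₀ 0 := by
  have hcont : Continuous fun x : Plane => x 0 := by fun_prop
  obtain ⟨x₀, hx₀, hmax⟩ := hD.isBounded.isCompact_closure.exists_isMaxOn
    hD.isConnected.nonempty.closure hcont.continuousOn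
  have hfr : x₀ ∈ frontier D := by
    rw [hD.isOpen.frontier_eq]
    refine ⟨hx₀, fun hxD => ?_⟩
    have hc : Tendsto (fun t : ℝ => x₀ + t • EuclideanSpace.single (0 : Fin 2) (1 : ℝ)) (𝓝[>] 0)
        (𝓝 x₀) := by
      have : Continuous fun t : ℝ => x₀ + t • EuclideanSpace.single (0 : Fin 2) (1 : ℝ) := by
        fun_prop
      exact (this.tendsto' 0 x₀ (by simp)).mono_left nhdsWithin_le_nhds
    obtain ⟨t, ht, ht0⟩ := ((hc.eventually (hD.isOpen.mem_nhds hxD)).and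
      self_mem_nhdsWithin).exists
    have := hmax (subset_closure ht)
    have ht0' : (0 : ℝ) < t := ht0
    simp at this
    linarith
  rw [← hγ.range_eq] at hfr
  obtain ⟨s₀, rfl⟩ := hfr
  exact ⟨s₀, fun x hx => hmax hx⟩

/-- D lies in a half-strip `x 0 ≤ M` of height 2R, over which the exponential integrates explicitly;
integrating in x₀ gains the factor 1/l. -/
theorem exists_area_bound {D : Set Plane} (hb : Bornology.IsBounded D) {M : ℝ}
    (hM : ∀ x ∈ D, x 0 ≤ M) :
    ∃ C > 0, ∀ l > 0, ∫ x in D, Real.exp (2 * l * x 0) ≤ C * (Real.exp (2 * l * M) / l) := by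
  obtain ⟨R, hR0, hR⟩ := hb.subset_closedBall_lt 0 (0 : Plane)
  refine ⟨R, hR0, fun l hl => ?_⟩
  have hsub : D ⊆ box (Iic M) (Icc (-R) R) := fun x hx => by
    refine ⟨hM x hx, abs_le.1 ?_⟩
    exact (PiLp.norm_apply_le x 1).trans (by simpa using hR hx)
  have h2l : 0 < 2 * l := by positivity
  rw [integral_eq_lintegral_of_nonneg_ae (Eventually.of_forall fun _ => (Real.exp_pos _).le)
    (continuous_exp_coord l).aestronglyMeasurable]
  refine ENNReal.toReal_le_of_le_ofReal (by positivity) ?_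
  calc ∫⁻ x in D, ENNReal.ofReal (Real.exp (2 * l * x 0))
      ≤ ∫⁻ x in box (Iic M) (Icc (-R) R), ENNReal.ofReal (Real.exp (2 * l * x 0)) :=
        lintegral_mono_set hsub
    _ = ∫⁻ s in Iic M, ∫⁻ _ in Icc (-R) R, ENNReal.ofReal (Real.exp (2 * l * s)) :=
        lintegral_box measurableSet_Iic measurableSet_Icc
          (continuous_exp_coord l).measurable.ennreal_ofReal
    _ = ENNReal.ofReal (2 * R) * ∫⁻ s in Iic M, ENNReal.ofReal (Real.exp (2 * l * s)) := by
        rw [← lintegral_const_mul' _ _ ENNReal.ofReal_ne_top]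
        refine lintegral_congr fun s => ?_
        rw [setLIntegral_const, Real.volume_Icc, mul_comm]
        congr 2
        ring
    _ = ENNReal.ofReal (2 * R) * ENNReal.ofReal (Real.exp (2 * l * M) / (2 * l)) := by
        rw [← ofReal_integral_eq_lintegral_ofReal (integrableOn_exp_mul_Iic h2l M)
          (Eventually.of_forall fun _ => (Real.exp_pos _).le), integral_exp_mul_Iic h2l]
    _ = ENNReal.ofReal (R * (Real.exp (2 * l * M) / l)) := by
        rw [← ENNReal.ofReal_mul (by positivity)]
        congr 1
        field_simp

/-- Periodicity moves the fundamental interval so that it begins at s₀, wherever s₀ lies. -/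
theorem le_integral_of_periodic {f : ℝ → ℝ} (hf : Continuous f) (h0 : ∀ s, 0 ≤ f s) {L : ℝ}
    (hL : 0 < L) (hp : Function.Periodic f L) {s₀ τ c : ℝ} (hτ : 0 ≤ τ) (hτL : τ ≤ L)
    (hc : ∀ s ∈ Icc s₀ (s₀ + τ), c ≤ f s) : τ * c ≤ ∫ s in Ioc 0 L, f s := by
  have h1 : ∫ s in Ioc 0 L, f s = ∫ s in s₀..s₀ + L, f s := by
    rw [← intervalIntegral.integral_of_le hL.le, hp.intervalIntegral_add_eq s₀ 0, zero_add]
  have h2 : ∫ s in s₀..s₀ + τ, f s ≤ ∫ s in s₀..s₀ + L, f s :=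
    intervalIntegral.integral_mono_interval le_rfl (by linarith) (by linarith)
      (Eventually.of_forall h0) (hf.intervalIntegrable _ _)
  have h3 : ∫ _ in s₀..s₀ + τ, c ≤ ∫ s in s₀..s₀ + τ, f s :=
    intervalIntegral.integral_mono_on (by linarith) intervalIntegrable_const
      (hf.intervalIntegrable _ _) hc
  rw [intervalIntegral.integral_const, smul_eq_mul, add_sub_cancel_left] at h3
  linarith

/-- At the point where `x 0` is largest the derivative of `γ s 0` vanishes. So `γ s 0` stays within
1/l of its maximum M on an arc of length (η l)⁻¹ with η as small as desired. On that arc the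
exponential is at least e^{-2} e^{2lM}, so the curve integral exceeds any multiple of e^{2lM}/l. -/
theorem eventually_area_le {D : Set Plane} (hD : IsSmoothDomain D) {L : ℝ} {γ : ℝ → Plane}
    (hγ : IsArclengthParam (frontier D) L γ) {ε : ℝ} (hε : 0 < ε) :
    ∀ᶠ l in atTop, ∫ x in D, Real.exp (2 * l * x 0)
      ≤ ε * ∫ s in Ioc 0 L, Real.exp (2 * l * γ s 0) := by
  obtain ⟨s₀, hs₀⟩ := exists_curve_max hD hγ
  obtain ⟨C, hC, hI⟩ := exists_area_bound hD.isBounded fun x hx => hs₀ x (subset_closure hx)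
  set M := γ s₀ 0
  have hd0 : HasDerivAt (fun s => γ s 0) (deriv γ s₀ 0) s₀ := hasDerivAt_coord (hγ.hasDerivAt s₀) 0
  have hmax : IsLocalMax (fun s => γ s 0) s₀ := Eventually.of_forall fun s =>
    hs₀ _ (frontier_subset_closure (hγ.range_eq ▸ mem_range_self s))
  have hd : HasDerivAt (fun s => γ s 0) 0 s₀ := by
    have := hmax.hasDerivAt_eq_zero hd0
    rwa [this] at hd0
  -- Chosen so that the lower bound for the curve integral, multiplied by ε, is exactly the upper
  -- bound for the area integral.
  set η := ε * Real.exp (-2) / C with hη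
  have hη0 : 0 < η := by positivity
  obtain ⟨δ, hδ, hball⟩ := Metric.eventually_nhds_iff.1 (hd.isLittleO.bound hη0)
  have hτ : Tendsto (fun l : ℝ => (η * l)⁻¹) atTop (𝓝 0) :=
    (tendsto_id.const_mul_atTop hη0).inv_tendsto_atTop
  filter_upwards [hτ.eventually_lt_const hδ, hτ.eventually_lt_const hγ.length_pos,
    eventually_gt_atTop 0] with l h1 h2 hl
  have hJ : (η * l)⁻¹ * Real.exp (2 * l * M - 2) ≤ ∫ s in Ioc 0 L, Real.exp (2 * l * γ s 0) := by
    refine le_integral_of_periodic (s₀ := s₀)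
      ((continuous_exp_coord l).comp hγ.smooth.continuous) (fun _ => (Real.exp_pos _).le)
      hγ.length_pos (hγ.periodic.comp _) (by positivity) h2.le fun s hs => ?_
    have hs1 : |s - s₀| ≤ (η * l)⁻¹ := by
      rw [abs_of_nonneg (by linarith [hs.1])]
      linarith [hs.2]
    have h3 := hball (y := s) (by rw [Real.dist_eq]; linarith)
    simp only [smul_zero, sub_zero, Real.norm_eq_abs] at h3
    have h4 : η * |s - s₀| ≤ l⁻¹ := by
      calc η * |s - s₀| ≤ η * (η * l)⁻¹ := by gcongr
        _ = l⁻¹ := by field_simp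
    have h5 : M - l⁻¹ ≤ γ s 0 := by linarith [(abs_le.1 h3).1]
    refine Real.exp_le_exp.2 ?_
    have h6 : 2 * l * (M - l⁻¹) ≤ 2 * l * γ s 0 := by gcongr
    have h7 : 2 * l * (M - l⁻¹) = 2 * l * M - 2 := by field_simp
    linarith
  calc ∫ x in D, Real.exp (2 * l * x 0) ≤ C * (Real.exp (2 * l * M) / l) := hI l hl
    _ = ε * ((η * l)⁻¹ * Real.exp (2 * l * M - 2)) := by
        rw [hη, sub_eq_add_neg, Real.exp_add]
        field_simp
    _ ≤ _ := by gcongr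

/-- The integral identity for harmonic exponentials determines the parameters. -/
theorem eq_zero_of_integral_identity {D : Set Plane} (hD : IsSmoothDomain D) {L : ℝ} {γ : ℝ → Plane}
    (hγ : IsArclengthParam (frontier D) L γ) {m b a : ℝ}
    (h : ∀ φ : Plane → ℝ, ContDiff ℝ ∞ φ → (∀ x, lap φ x = 0) →
      m * (∫ x in D, ‖gradient φ x‖ ^ 2)
        + b * (∫ s in Ioc 0 L, deriv (fun s => φ (γ s)) s ^ 2)
        + a * (∫ s in Ioc 0 L, deriv (deriv fun s => φ (γ s)) s ^ 2) = 0) :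
    m = 0 ∧ b = 0 ∧ a = 0 := by
  have hcγ : ∀ l, Continuous fun s => Real.exp (2 * l * γ s 0) := fun l =>
    (continuous_exp_coord l).comp hγ.smooth.continuous
  have hfi : ∀ f : ℝ → ℝ, Continuous f → Integrable f (volume.restrict (Ioc 0 L)) := fun f hf =>
    (hf.integrableOn_Icc (a := 0) (b := L)).mono_set Ioc_subset_Icc_self
  have hd1 : ContDiff ℝ ∞ (deriv γ) := (contDiff_infty_iff_deriv.1 hγ.smooth).2
  have hd2 : ContDiff ℝ ∞ (deriv (deriv γ)) := (contDiff_infty_iff_deriv.1 hd1).2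
  have hsym : ∀ l, Continuous (curveSymbol γ l) := fun l => by
    have c1 := hd1.continuous
    have c2 := hd2.continuous
    unfold curveSymbol
    fun_prop
  have hφ : ∀ φ : Plane → ℝ, ContDiff ℝ ∞ φ → ContDiff ℝ ∞ fun s => φ (γ s) := fun φ hφ =>
    hφ.comp hγ.smooth
  refine eq_zero_of_asymptotics (I := fun l => ∫ x in D, Real.exp (2 * l * x 0))
    (J := fun l => ∫ s in Ioc 0 L, Real.exp (2 * l * γ s 0))
    (K := fun l => ∫ s in Ioc 0 L, curveSymbol γ l s * Real.exp (2 * l * γ s 0))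
    (fun l => ?_) (fun l => ?_) (fun l hl => ?_) ?_ fun ε hε => eventually_area_le hD hγ hε
  · refine (setIntegral_pos_iff_support_of_nonneg_ae
      (Eventually.of_forall fun _ => (Real.exp_pos _).le)
      (integrableOn_exp_coord hD.isBounded l)).2 ?_
    rw [Function.support_eq_univ fun x => (Real.exp_pos _).ne', univ_inter]
    exact hD.isOpen.measure_pos _ hD.isConnected.nonempty
  · refine (setIntegral_pos_iff_support_of_nonneg_ae
      (Eventually.of_forall fun _ => (Real.exp_pos _).le) (hfi _ (hcγ l))).2 ?_
    rw [Function.support_eq_univ fun x => (Real.exp_pos _).ne', univ_inter, Real.volume_Ioc]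
    simpa using hγ.length_pos
  · have hc := h _ (contDiff_expCos l) (lap_expCos l)
    have hs := h _ (contDiff_expSin l) (lap_expSin l)
    simp only [norm_gradient_expCos_sq, norm_gradient_expSin_sq, integral_const_mul] at hc hs
    have ec := contDiff_deriv (hφ _ (contDiff_expCos l))
    have es := contDiff_deriv (hφ _ (contDiff_expSin l))
    have e1 : (∫ s in Ioc 0 L, deriv (fun s => expCos l (γ s)) s ^ 2)
        + ∫ s in Ioc 0 L, deriv (fun s => expSin l (γ s)) s ^ 2
        = l ^ 2 * ∫ s in Ioc 0 L, Real.exp (2 * l * γ s 0) := by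
      refine (integral_add (hfi _ (ec.continuous.pow 2)) (hfi _ (es.continuous.pow 2))).symm.trans
        ?_
      rw [← integral_const_mul]
      exact integral_congr_ae (Eventually.of_forall fun s => deriv_sq_add_deriv_sq hγ l s)
    have e2 : (∫ s in Ioc 0 L, deriv (deriv fun s => expCos l (γ s)) s ^ 2)
        + ∫ s in Ioc 0 L, deriv (deriv fun s => expSin l (γ s)) s ^ 2
        = ∫ s in Ioc 0 L, curveSymbol γ l s * Real.exp (2 * l * γ s 0) := by
      refine (integral_add (hfi _ ((contDiff_deriv ec).continuous.pow 2))
        (hfi _ ((contDiff_deriv es).continuous.pow 2))).symm.trans ?_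
      exact integral_congr_ae
        (Eventually.of_forall fun s => deriv_deriv_sq_add_deriv_deriv_sq hγ l s)
    rw [← e1, ← e2]
    linear_combination hc + hs
  · obtain ⟨l₀, hl₀⟩ := exists_curveSymbol_bound hγ
    filter_upwards [eventually_ge_atTop l₀] with l hl
    rw [← integral_const_mul]
    refine setIntegral_mono_on ((hfi _ (hcγ l)).const_mul _) (hfi _ ((hsym l).mul (hcγ l)))
      measurableSet_Ioc fun s hs => ?_
    have := hl₀ l hl s hs
    gcongr

end AntiplaneShear

theorem theorem4p2 (Ω D : Set AntiplaneShear.Plane)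
    (hΩ : AntiplaneShear.IsSmoothDomain Ω) (hD : AntiplaneShear.IsSmoothDomain D)
    (hDΩ : closure D ⊆ Ω)
    (L : ℝ) (γ : ℝ → AntiplaneShear.Plane)
    (hγ : AntiplaneShear.IsArclengthParam (frontier D) L γ) :
    Set.InjOn
      (fun p : ℝ × ℝ × ℝ => AntiplaneShear.dtn Ω D L γ p.1 p.2.1 p.2.2)
      {p : ℝ × ℝ × ℝ | 0 < p.1 ∧ 0 < p.2.1 ∧ 0 < p.2.2} := by
  rintro ⟨μ, μs, ℓ⟩ ⟨hμ, hμs, hℓ⟩ ⟨μ', μs', ℓ'⟩ ⟨hμ', hμs', hℓ'⟩ heq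
  dsimp only at hμ hμs hℓ hμ' hμs' hℓ' heq
  obtain ⟨hm, hb, ha⟩ := AntiplaneShear.eq_zero_of_integral_identity hD hγ fun φ hφ hl =>
    AntiplaneShear.integral_identity hΩ.isOpen hΩ.isBounded hD hγ hDΩ hμ hμs hℓ hμ' hμs' hℓ' heq
      hφ hl
  have h1 : μ = μ' := sub_eq_zero.1 hm
  have h2 : μs = μs' := sub_eq_zero.1 hb
  subst h1 h2
  -- The third coefficient only determines μ_s ℓ²; μ_s is already known, and positivity selects the
  -- root.
  have h3 : ℓ ^ 2 = ℓ' ^ 2 := mul_left_cancel₀ hμs.ne' (sub_eq_zero.1 ha)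
  rw [(pow_left_inj₀ hℓ.le hℓ'.le two_ne_zero).1 h3]
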